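/- Consider the following parameterized problem. An instance is a triple $(G,k,S)$ of a finite graph $G=(V,E)$, a number $k\in\mathbb{N}$ and a vertex cover $S\subseteq V$ of $G$; the question is whether $\mathrm{td}(G)\le k$, and the parameter is $|S|$. Here the tree depth $\mathrm{td}(G)$ is the minimum width (maximum bag size minus one) of a tree decomposition $(T,\iota)$ of $G$ whose tree $T$ can be rooted such that $\iota(p)\subsetneq\iota(q)$ whenever $q$ is a descendant of $p$. Instances are encoded as binary words (the number of vertices in unary, the adjacency matrix, the characteristic word of $S$, and $k$ in binary). Let $Q\subseteq\{0,1\}^*$ be the set of encodings of yes-instances, and let $\kappa(x)=|S|$ if $x$ encodes $(G,k,S)$, and $\kappa(x)=0$ if $x$ encodes no instance. **Theorem.** There is a DLOGTIME-uniform family $(C_n)_{n\in\mathbb{N}}$ of $\mathrm{TC}^0$-circuits (polynomial size, constant depth, unbounded fan-in, with threshold gates, such that some deterministic Turing machine computes, on input of a position and of $n$ in binary, the bit at this position of an encoding of $C_n$ in $O(\log n)$ steps) that computes a kernelization with $O(|S|^3)$ vertices. That is, the function $K\colon\{0,1\}^*\to\{0,1\}^*$ computed by the family satisfies, for some computable $f\colon\mathbb{N}\to\mathbb{N}$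 and some constant $C$: 1. for every word $x$, we have $x\in Q$ if and only if $K(x)\in Q$, and $|K(x)|\le f(\kappa(x))$; 2. if $x$ encodes an instance $(G,k,S)$, then $K(x)$ encodes an instance whose graph has at most $C\cdot|S|^3$ vertices. -/

import Mathlib

namespace ParKernel

/-! ### Boolean circuits with threshold gates -/

/-- The kinds of gates of a `TC`-circuit on `n` input bits: a gate reading the input bit `i`,
a negation, conjunctions and disjunctions of unbounded fan-in, and threshold gates of unbounded
fan-in that fire iff at least `t` of their predecessors do. -/
inductive GateKind (n : ℕ) : Type
  | input (i : Fin n)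
  | not
  | and
  | or
  | thr (t : ℕ)

/-- A `TC`-circuit with `n` input bits: a finite acyclic graph of gates; `wire h g` says that the
output of gate `h` is fed into gate `g`.  Since the length of the computed word may depend on the
input, the circuit outputs `outLen` symbols over the alphabet `{0, 1, blank}`:
the `j`-th symbol is blank iff the gate `outPresent j` evaluates to false, and otherwise it is the
value of the gate `outBit j`. -/
structure Circuit (n : ℕ) where
  size : ℕ
  kind : Fin size → GateKind n
  wire : Fin size → Fin size → Prop
  acyclic : WellFounded wire
  input_fanin : ∀ g i, kind g = GateKind.input i → ∀ h, ¬ wire h g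
  not_fanin : ∀ g, kind g = GateKind.not → ∃! h, wire h g
  outLen : ℕ
  outPresent : Fin outLen → Fin size
  outBit : Fin outLen → Fin size

namespace Circuit

variable {n : ℕ}

/-- The value of every gate on the input `x`, by recursion along the wires. -/
def value (C : Circuit n) (x : Fin n → Bool) : Fin C.size → Prop :=
  C.acyclic.fix fun g val =>
    match C.kind g with
    | GateKind.input i => x i = true
    | GateKind.not => ∀ h (w : C.wire h g), ¬ val h w
    | GateKind.and => ∀ h (w : C.wire h g), val h w
    | GateKind.or => ∃ h, ∃ w : C.wire h g, val h w
    | GateKind.thr t => t ≤ Nat.card {h : Fin C.size // ∃ w : C.wire h g, val h w}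

open Classical in
/-- The word computed by the circuit on input `x`: the output symbols before the first blank. -/
noncomputable def output (C : Circuit n) (x : Fin n → Bool) : List Bool :=
  ((List.finRange C.outLen).takeWhile fun j => decide (C.value x (C.outPresent j))).map
    fun j => decide (C.value x (C.outBit j))

/-- Every directed path in the circuit has at most `d` wires. -/
def DepthAtMost (C : Circuit n) (d : ℕ) : Prop :=
  ∀ l : List (Fin C.size), l.IsChain C.wire → l.length ≤ d + 1

/-- The encoding of a circuit as a table of bits.  A position of the table is an address
`(t, a, b)`, where `t` selects one of eight relations that together describe the circuit. -/
def tableBit (C : Circuit n) (t : Fin 8) (a b : ℕ) : Prop :=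
  match t with
  | 0 => ∃ ha : a < C.size, C.kind ⟨a, ha⟩ = GateKind.not
  | 1 => ∃ ha : a < C.size, C.kind ⟨a, ha⟩ = GateKind.and
  | 2 => ∃ ha : a < C.size, C.kind ⟨a, ha⟩ = GateKind.or
  | 3 => ∃ ha : a < C.size, ∃ hb : b < n, C.kind ⟨a, ha⟩ = GateKind.input ⟨b, hb⟩
  | 4 => ∃ ha : a < C.size, C.kind ⟨a, ha⟩ = GateKind.thr b
  | 5 => ∃ ha : a < C.size, ∃ hb : b < C.size, C.wire ⟨a, ha⟩ ⟨b, hb⟩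
  | 6 => ∃ ha : a < C.outLen, (C.outPresent ⟨a, ha⟩ : ℕ) = b
  | 7 => ∃ ha : a < C.outLen, (C.outBit ⟨a, ha⟩ : ℕ) = b

end Circuit

/-! ### `DLOGTIME`-uniform families -/

/-- Binary encoding of a number, over the alphabet `{0, 1, #}`, where `none` is the symbol `#`. -/
def bin (a : ℕ) : List (Option Bool) := a.bits.map some

/-- The query word `bin(t)#bin(a)#bin(b)#bin(n)`, which asks for the bit at address `(t, a, b)` of
the encoding of the `n`-th circuit. -/
def query (t : Fin 8) (a b n : ℕ) : List (Option Bool) :=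
  bin t ++ none :: (bin a ++ none :: (bin b ++ none :: bin n))

open Classical in
/-- A family of circuits is `DLOGTIME`-uniform if a fixed deterministic (multi-stack) Turing machine
outputs, on input of an address in the encoding of the `n`-th circuit and of `n`, both in binary,
the bit at this address within `O(log n)` steps.
The encoding of the `n`-th circuit is a table of dimensions `8`, `2 ^ w`, `2 ^ w`, where
`w = (b + 1) * (⌊log₂ n⌋ + 1)` for a constant `b`, so that the table has polynomial size and gates,
output positions and input positions have addresses of `w` bits. -/
def DlogtimeUniform (F : ∀ n : ℕ, Circuit n) : Prop :=
  ∃ (M : Turing.TM2ComputableAux (Option Bool) Bool) (b c : ℕ), ∀ n : ℕ,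
    (F n).size ≤ 2 ^ ((b + 1) * (Nat.log 2 n + 1)) ∧
    (F n).outLen ≤ 2 ^ ((b + 1) * (Nat.log 2 n + 1)) ∧
    ∀ (t : Fin 8) (u v : ℕ),
      u < 2 ^ ((b + 1) * (Nat.log 2 n + 1)) → v < 2 ^ ((b + 1) * (Nat.log 2 n + 1)) →
      Nonempty (Turing.TM2OutputsInTime M.tm
        ((query t u v n).map M.inputAlphabet.invFun)
        (some [M.outputAlphabet.invFun (decide ((F n).tableBit t u v))])
        (c * (Nat.log 2 n + 1)))

/-- A `DLOGTIME`-uniform family of `TC⁰`-circuits: polynomial size, constant depth, unbounded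
fan-in, with threshold gates. -/
structure IsUniformTC0 (F : ∀ n : ℕ, Circuit n) : Prop where
  poly_size : ∃ c : ℕ, ∀ n, (F n).size ≤ n ^ c + c
  const_depth : ∃ d : ℕ, ∀ n, (F n).DepthAtMost d
  uniform : DlogtimeUniform F

/-- The function on words computed by a family of circuits: a word of length `n` is given to the
`n`-th circuit. -/
noncomputable def compute (F : ∀ n : ℕ, Circuit n) (x : List Bool) : List Bool :=
  (F x.length).output x.get

/-! ### Parameterized problems and kernelizations -/

/-- `K` is a kernelization of the parameterized problem `(Q, κ)`. -/
def IsKernelization (Q : Set (List Bool)) (κ : List Bool → ℕ) (K : List Bool → List Bool) : Prop :=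
  ∃ f : ℕ → ℕ, Computable f ∧ ∀ x, (x ∈ Q ↔ K x ∈ Q) ∧ (K x).length ≤ f (κ x)

/-! ### Tree depth -/

/-- Tree decompositions of a graph, over finite trees. -/
structure TreeDecomposition {V : Type*} (G : SimpleGraph V) where
  nodes : ℕ
  tree : SimpleGraph (Fin nodes)
  isTree : tree.IsTree
  bag : Fin nodes → Finset V
  exists_mem_bag : ∀ u : V, ∃ p, u ∈ bag p
  exists_edge_bag : ∀ u v : V, G.Adj u v → ∃ p, u ∈ bag p ∧ v ∈ bag p
  connected : ∀ u : V, (tree.induce {p | u ∈ bag p}).Connected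

namespace TreeDecomposition

variable {V : Type*} {G : SimpleGraph V}

/-- The maximum size of the bags minus one (and `0` if all bags are empty, which is possible for the
empty graph only). -/
def width (D : TreeDecomposition G) : ℕ := (Finset.univ.sup fun p => (D.bag p).card) - 1

/-- In the tree rooted at `r`, the node `q` is a (proper) descendant of the node `p`: the path from
the root `r` to `q` goes through `p`. -/
def Descendant (D : TreeDecomposition G) (r p q : Fin D.nodes) : Prop :=
  p ≠ q ∧ ∃ P : D.tree.Walk r q, P.IsPath ∧ p ∈ P.support

/-- The tree can be rooted so that the bags grow strictly from every node to its descendants. -/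
def IsDepthDecomposition (D : TreeDecomposition G) : Prop :=
  ∃ r, ∀ p q, D.Descendant r p q → D.bag p ⊂ D.bag q

end TreeDecomposition

/-- The tree depth of a finite graph: the minimum width of a tree decomposition that can be rooted
so that bags grow strictly towards the descendants.  In this normalization a single vertex has
tree depth `0`. -/
noncomputable def treeDepth {V : Type*} (G : SimpleGraph V) : ℕ :=
  sInf {w | ∃ D : TreeDecomposition G, D.IsDepthDecomposition ∧ D.width = w}

/-! ### Tree depth parameterized by a given vertex cover -/

/-- Instances: a finite graph on `n` vertices, a number `k`, and a vertex cover `S`. -/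
structure Instance where
  n : ℕ
  G : SimpleGraph (Fin n)
  k : ℕ
  S : Finset (Fin n)
  cover : G.IsVertexCover (S : Set (Fin n))

open Classical in
/-- The encoding of an instance as a word: the number `n` of vertices in unary, terminated by a
zero, the adjacency matrix in row-major order, the characteristic word of `S`, and `k` in binary. -/
noncomputable def encode (I : Instance) : List Bool :=
  List.replicate I.n true ++ false ::
    (List.ofFn (fun p : Fin (I.n * I.n) => decide (I.G.Adj p.divNat p.modNat)) ++
      (List.ofFn (fun v : Fin I.n => decide (v ∈ I.S)) ++ I.k.bits))

/-- Tree depth parameterized by a given vertex cover, as a language: is `td(G) ≤ k`? -/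
def tdLanguage : Set (List Bool) := {x | ∃ I : Instance, encode I = x ∧ treeDepth I.G ≤ I.k}

/-- The parameter: `|S|` on (the encoding of) an instance, and `0` on words that encode none. -/
noncomputable def tdParam : List Bool → ℕ :=
  Function.extend encode (fun I => I.S.card) (fun _ => 0)

/-- The parameter and the language are well-defined: instances are determined by their encodings. -/
theorem encode_injective : Function.Injective encode := by
  have key : ∀ (a b : ℕ) (l l' : List Bool),
      List.replicate a true ++ false :: l = List.replicate b true ++ false :: l' →
        a = b ∧ l = l' := by
    intro a
    induction a with
    | zero => intro b l l' h; cases b <;> simp_all [List.replicate_succ]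
    | succ a ih =>
      intro b l l' h
      cases b with
      | zero => simp [List.replicate_succ] at h
      | succ b =>
        simp only [List.replicate_succ, List.cons_append, List.cons.injEq, true_and] at h
        obtain ⟨h1, h2⟩ := ih b l l' h
        exact ⟨by rw [h1], h2⟩
  rintro ⟨n, G, k, S, hS⟩ ⟨n', G', k', S', hS'⟩ h
  obtain ⟨rfl, h2⟩ := key _ _ _ _ h
  obtain ⟨h3, h4⟩ := List.append_inj h2 (by simp)
  obtain ⟨h5, h6⟩ := List.append_inj h4 (by simp)
  have hk : k = k' := by
    have e := Nat.digits_two_eq_bits k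
    rw [h6, ← Nat.digits_two_eq_bits k'] at e
    exact Nat.digits.injective 2 e
  have hG : G = G' := by
    have e := List.ofFn_injective h3
    ext u v
    have e2 := congrFun e (finProdFinEquiv (u, v))
    have e3 : (finProdFinEquiv (u, v)).divNat = u ∧ (finProdFinEquiv (u, v)).modNat = v := by
      have := finProdFinEquiv.symm_apply_apply (u, v)
      exact ⟨congrArg Prod.fst this, congrArg Prod.snd this⟩
    simpa [e3.1, e3.2] using e2
  have hS : S = S' := by
    have e := List.ofFn_injective h5
    ext u
    simpa using congrFun e u
  subst hk hG hS
  rfl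

end ParKernel

namespace ParKernel

/-! ### Tree depth by elimination orders -/

/-! Tree depth at most `k` amounts to a rooted-forest order on the vertices in which adjacent
vertices are comparable and no vertex has more than `k + 1` ancestors, itself included
(`treeDepth_le_iff`). All arguments about the kernel manipulate such orders.

If `k ≥ |S|` the answer is yes: the cover forms a chain and every other vertex is a leaf below it
(`hasElim_of_cover_le`). The empty graph is then a correct output. Let `k < |S|`. Two vertices of
`S` with more than `k` common neighbours outside `S` are comparable in every admissible order, since
otherwise these neighbours would all be ancestors of both; hence they may be joined by an edge
(`HasElim.kernel`). A vertex outside `S` whose neighbours have become a clique is deleted if each of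
its neighbours has more than `k` neighbours of the same kind with smaller numbers. It can be put
back as a leaf below its lowest neighbour `x`: some kept neighbour of `x` lies strictly below `x`,
so the new leaf is no deeper than that one (`exists_larger_of_superfluous`, `HasElim.of_kernel`).
Each vertex that survives is in `S`, or is charged to a pair in `S` with few common neighbours or to
a vertex of `S` among whose first neighbours it is; this leaves `O(|S| ^ 3)` vertices
(`count_keep_le`). All edges are added at once and all deletions are made at once, so no iteration
is needed and counting suffices.

The output is therefore definable in first-order logic with counting of pairs of positions. Counting
pairs yields addition and multiplication, hence powers of two and the binary digits of `k`. The
variables only reach the length of the word, but `k` matters only when `k < |S|`, which is in range.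
A formula becomes a circuit with one gate for every subformula and every assignment
(`circuit_value`), whose depth is at most the size of the formula.

For uniformity, a gate address interleaves the bits of the values of all variables and of a one-hot
code of the subformula. Every relation in the table of the circuit then compares such fields with
each other, with the length, or with 0 and 1, and a finite automaton decides it reading columns of
bits, lowest first (`recognizable_autoTable`). A stack machine aligns the two addresses with the
length and runs the automaton in logarithmic time (`dlogtimeUniform_of_recognizable`). -/

/-- A rooted-forest order on the finite vertex set `W` such that adjacent vertices are comparable
and every vertex has at most `k + 1` ancestors, itself included. -/
structure IsElim {α : Type*} (a : α → α → Prop) (W : Finset α) (k : ℕ) (le : α → α → Prop) :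
    Prop where
  refl : ∀ u ∈ W, le u u
  antisymm : ∀ u ∈ W, ∀ v ∈ W, le u v → le v u → u = v
  trans : ∀ u ∈ W, ∀ v ∈ W, ∀ w ∈ W, le u v → le v w → le u w
  chain : ∀ u ∈ W, ∀ v ∈ W, ∀ w ∈ W, le u w → le v w → le u v ∨ le v u
  adj : ∀ u ∈ W, ∀ v ∈ W, a u v → le u v ∨ le v u
  card : ∀ v ∈ W, ∀ D : Finset α, (∀ u ∈ D, u ∈ W ∧ le u v) → D.card ≤ k + 1

/-- The vertex set `W` has an elimination order of height at most `k`. -/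
def HasElim {α : Type*} (a : α → α → Prop) (W : Finset α) (k : ℕ) : Prop :=
  ∃ le, IsElim a W k le

/-- Pull the order back along `f`; injectivity preserves antisymmetry and the bound on the number of
ancestors. This serves both for subgraphs and for renumbering vertices. -/
theorem HasElim.of_injOn {α β : Type*} {a : α → α → Prop} {b : β → β → Prop} {W : Finset α}
    {X : Finset β} {k : ℕ} (f : α → β) (hf : ∀ u ∈ W, f u ∈ X)
    (hinj : ∀ u ∈ W, ∀ v ∈ W, f u = f v → u = v)
    (hadj : ∀ u ∈ W, ∀ v ∈ W, a u v → b (f u) (f v)) (h : HasElim b X k) : HasElim a W k := by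
  classical
  obtain ⟨le, h⟩ := h
  refine ⟨fun u v => le (f u) (f v), fun u hu => h.refl _ (hf u hu),
    fun u hu v hv h1 h2 => hinj u hu v hv (h.antisymm _ (hf u hu) _ (hf v hv) h1 h2),
    fun u hu v hv w hw => h.trans _ (hf u hu) _ (hf v hv) _ (hf w hw),
    fun u hu v hv w hw => h.chain _ (hf u hu) _ (hf v hv) _ (hf w hw),
    fun u hu v hv huv => h.adj _ (hf u hu) _ (hf v hv) (hadj u hu v hv huv),
    fun v hv D hD => ?_⟩
  rw [← Finset.card_image_of_injOn (f := f) (s := D)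
    fun x hx y hy => hinj x (hD x hx).1 y (hD y hy).1]
  refine h.card _ (hf v hv) _ fun u hu => ?_
  obtain ⟨x, hx, rfl⟩ := Finset.mem_image.1 hu
  exact ⟨hf x (hD x hx).1, (hD x hx).2⟩

/-! ### Rooted trees and their descendant-closed subtrees -/

section Tree

variable {V : Type*} {t : SimpleGraph V} {r : V}

/-- In the tree `t` with root `r`, the node `p` lies on the path from the root to `q`. -/
def IsAncestor (t : SimpleGraph V) (r p q : V) : Prop :=
  ∃ P : t.Walk r q, P.IsPath ∧ p ∈ P.support

/-- Paths in a tree are unique, so both nodes lie on the same path to `x`, and the one met first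
lies on the path to the other. -/
theorem IsAncestor.comparable (ht : t.IsTree) {p q x : V} (hp : IsAncestor t r p x)
    (hq : IsAncestor t r q x) : IsAncestor t r p q ∨ IsAncestor t r q p := by
  classical
  obtain ⟨P, hP, hpP⟩ := hp
  obtain ⟨Q, hQ, hqQ⟩ := hq
  obtain rfl : P = Q := (ht.existsUnique_path r x).unique hP hQ
  by_cases h : q ∈ (P.takeUntil p hpP).support
  · exact Or.inr ⟨_, hP.takeUntil hpP, h⟩
  · have h' : q ∈ (P.dropUntil p hpP).support := by
      rw [← P.take_spec hpP, SimpleGraph.Walk.mem_support_append_iff] at hqQ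
      tauto
    refine Or.inl ⟨(P.takeUntil p hpP).append ((P.dropUntil p hpP).takeUntil q h'), ?_, ?_⟩
    · apply SimpleGraph.Walk.IsPath.of_append_left (q := (P.dropUntil p hpP).dropUntil q h')
      rw [← SimpleGraph.Walk.append_assoc, SimpleGraph.Walk.take_spec, SimpleGraph.Walk.take_spec]
      exact hP
    · simp

theorem IsAncestor.trans (ht : t.IsTree) {p q x : V} (hp : IsAncestor t r p q)
    (hq : IsAncestor t r q x) : IsAncestor t r p x := by
  classical
  obtain ⟨P, hP, hqP⟩ := hq
  obtain ⟨Q, hQ, hpQ⟩ := hp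
  obtain rfl := (ht.existsUnique_path r q).unique hQ (hP.takeUntil hqP)
  exact ⟨P, hP, P.support_takeUntil_subset_support _ hpQ⟩

/-- A node of `T` closest to the root works. Moving along edges inside `T`, the path from the root
gains or loses its last node; it could lose `p` only by moving from `p` to its parent, which is too
close to the root to be in `T`. -/
theorem exists_top (ht : t.IsTree) {T : Set V} (hT : (t.induce T).Connected) :
    ∃ p ∈ T, ∀ q ∈ T, IsAncestor t r p q := by
  classical
  choose P hP _ using ht.existsUnique_path r
  have hne : T.Nonempty := Set.nonempty_coe_sort.1 hT.nonempty
  obtain ⟨p, hpT, hp⟩ := exists_minimal_of_wellFoundedLT (fun x => x ∈ (fun q => (P q).length) '' T)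
    (hne.image _)
  obtain ⟨p, hpT, rfl⟩ := hpT
  refine ⟨p, hpT, fun q hq => ?_⟩
  have hr := (SimpleGraph.reachable_iff_reflTransGen _ _).1 (hT.preconnected ⟨p, hpT⟩ ⟨q, hq⟩)
  have key : ∀ x : T, Relation.ReflTransGen (t.induce T).Adj ⟨p, hpT⟩ x → p ∈ (P x).support := by
    intro x hx
    induction hx with
    | refl => simp
    | @tail b c _ hbc ih =>
      have hbc' : t.Adj b c := hbc
      by_cases hb : (b : V) ∈ (P c).support
      · rw [ht.isAcyclic.path_concat (hP b) (hP c) hbc' hb]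
        simp [SimpleGraph.Walk.support_concat, ih]
      -- Here `c` is the parent of `b`.
      · have hc := ht.isAcyclic.mem_support_of_ne_mem_support_of_adj_of_isPath (hP b) (hP c) hbc' hb
        have e := ht.isAcyclic.path_concat (hP c) (hP b) hbc'.symm hc
        rw [e] at ih
        simp only [SimpleGraph.Walk.support_concat, List.mem_append,
          List.mem_singleton] at ih
        rcases ih with ih | ih
        · exact ih
        · have hl : (P b).length = (P c).length + 1 := by rw [e]; simp
          have hpb : (P p).length = (P b).length := by rw [ih]
          have : (P p).length ≤ (P c).length := hp ⟨c, c.2, rfl⟩ (by simp only; omega)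
          omega
  exact ⟨P q, hP q, key _ hr⟩

/-- The tops of both sets are ancestors of `x`, hence comparable; closure under descendants turns
this into an inclusion. -/
theorem subset_or_subset_of_mem (ht : t.IsTree) {T T' : Set V} (hT : (t.induce T).Connected)
    (hT' : (t.induce T').Connected) (hd : ∀ p q, IsAncestor t r p q → p ∈ T → q ∈ T)
    (hd' : ∀ p q, IsAncestor t r p q → p ∈ T' → q ∈ T') {x : V} (hx : x ∈ T) (hx' : x ∈ T') :
    T ⊆ T' ∨ T' ⊆ T := by
  obtain ⟨p, hp, hpt⟩ := exists_top (r := r) ht hT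
  obtain ⟨q, hq, hqt⟩ := exists_top (r := r) ht hT'
  rcases (hpt x hx).comparable ht (hqt x hx') with h | h
  · exact Or.inr fun y hy => hd _ _ (h.trans ht (hqt y hy)) hp
  · exact Or.inl fun y hy => hd' _ _ (h.trans ht (hpt y hy)) hq

end Tree

/-! ### Equivalence of elimination orders and depth decompositions -/

section FromElim

variable {n : ℕ}

/-- Trees built from a rank function: every vertex of `T` other than `p₀` has a neighbour in `T` of
smaller rank. -/
theorem connected_induce_of_rank {V : Type*} {t : SimpleGraph V} {T : Set V} (rk : V → ℕ) {p₀ : V}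
    (h₀ : p₀ ∈ T) (h : ∀ q ∈ T, q ≠ p₀ → ∃ p ∈ T, rk p < rk q ∧ t.Adj p q) :
    (t.induce T).Connected := by
  have key : ∀ m, ∀ q (hq : q ∈ T), rk q = m → (t.induce T).Reachable ⟨p₀, h₀⟩ ⟨q, hq⟩ := by
    intro m
    induction m using Nat.strong_induction_on with
    | _ m ih =>
      rintro q hq rfl
      by_cases hqp : q = p₀
      · subst hqp; exact SimpleGraph.Reachable.refl _
      · obtain ⟨p, hp, hlt, hadj⟩ := h q hq hqp
        exact (ih _ hlt p hp rfl).trans (SimpleGraph.Adj.reachable (by simpa using hadj))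
  have : Nonempty T := ⟨⟨p₀, h₀⟩⟩
  exact ⟨fun x y => (key _ x.1 x.2 rfl).symm.trans (key _ y.1 y.2 rfl)⟩

/-- The tree on `Fin (n + 1)` with root `0` in which `par v` is the parent of `v.succ`. -/
def parentTree (par : Fin n → Fin (n + 1)) : SimpleGraph (Fin (n + 1)) :=
  SimpleGraph.fromRel fun p q => ∃ v, q = v.succ ∧ p = par v

theorem parentTree_adj {par : Fin n → Fin (n + 1)} {v : Fin n} (h : par v ≠ v.succ) :
    (parentTree par).Adj (par v) v.succ := by
  rw [parentTree, SimpleGraph.fromRel_adj]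
  exact ⟨h, Or.inl ⟨v, rfl, rfl⟩⟩

/-- Descending ranks connect every node to the root, and each edge comes from some `v : Fin n`; a
connected graph on `n + 1` vertices with at most `n` edges is a tree. -/
theorem parentTree_isTree {par : Fin n → Fin (n + 1)} (rk : Fin (n + 1) → ℕ)
    (hrk : ∀ v, rk (par v) < rk v.succ) : (parentTree par).IsTree := by
  have hc : (parentTree par).Connected := by
    rw [← (SimpleGraph.induceUnivIso _).connected_iff]
    refine connected_induce_of_rank rk (Set.mem_univ 0) fun q _ hq => ?_
    obtain ⟨v, rfl⟩ := Fin.exists_succ_eq.2 hq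
    exact ⟨par v, Set.mem_univ _, hrk v, parentTree_adj fun h => (hrk v).ne (by rw [h])⟩
  refine SimpleGraph.isTree_iff_connected_and_card.2 ⟨hc, le_antisymm ?_
    hc.card_vert_le_card_edgeSet_add_one⟩
  have hsub : (parentTree par).edgeSet ⊆ Set.range fun v : Fin n => s(par v, v.succ) := by
    intro e
    induction e with
    | _ p q =>
      rw [SimpleGraph.mem_edgeSet, parentTree, SimpleGraph.fromRel_adj]
      rintro ⟨_, ⟨v, rfl, rfl⟩ | ⟨v, rfl, rfl⟩⟩
      · exact ⟨v, rfl⟩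
      · exact ⟨v, Sym2.eq_swap⟩
  have h1 := Nat.card_mono (Set.finite_range _) hsub
  have h2 := Finite.card_range_le fun v : Fin n => s(par v, v.succ)
  simp only [Nat.card_eq_fintype_card, Fintype.card_fin] at h1 h2 ⊢
  omega

/-- Induction on the size of the bag of `q`: the path to `q` arrives from the parent. Otherwise `q`
would be an ancestor of its own parent, and the induction hypothesis would bound its bag by the
strictly smaller bag of the parent. -/
theorem bag_ssubset_of_isAncestor {β : Type*} {par : Fin n → Fin (n + 1)}
    (bag : Fin (n + 1) → Finset β) (hbag : ∀ v, bag (par v) ⊂ bag v.succ) {p q : Fin (n + 1)}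
    (h : IsAncestor (parentTree par) 0 p q) : p = q ∨ bag p ⊂ bag q := by
  have ht : (parentTree par).IsTree :=
    parentTree_isTree (fun p => (bag p).card) fun v => Finset.card_lt_card (hbag v)
  have key : ∀ m, ∀ q p, (bag q).card = m → IsAncestor (parentTree par) 0 p q →
      p = q ∨ bag p ⊂ bag q := by
    intro m
    induction m using Nat.strong_induction_on with
    | _ m ih =>
      rintro q p rfl ⟨P, hP, hp⟩
      by_cases hq : q = 0
      · subst hq
        obtain rfl : P = SimpleGraph.Walk.nil :=
          (ht.existsUnique_path 0 0).unique hP SimpleGraph.Walk.IsPath.nil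
        left; simpa using hp
      · obtain ⟨v, rfl⟩ := Fin.exists_succ_eq.2 hq
        have hlt := Finset.card_lt_card (hbag v)
        obtain ⟨Q, hQ, -⟩ := ht.existsUnique_path 0 (par v)
        have hadj := parentTree_adj (par := par) (v := v) fun h => hlt.ne (by rw [h])
        by_cases hv : par v ∈ P.support
        · rw [ht.isAcyclic.path_concat hQ hP hadj hv] at hp
          simp only [SimpleGraph.Walk.support_concat, List.mem_append, List.mem_singleton] at hp
          rcases hp with hp | hp
          · right
            rcases ih _ hlt _ p rfl ⟨Q, hQ, hp⟩ with rfl | h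
            · exact hbag v
            · exact h.trans (hbag v)
          · exact Or.inl hp
        · have := ht.isAcyclic.mem_support_of_ne_mem_support_of_adj_of_isPath hQ hP hadj hv
          rcases ih _ hlt _ _ rfl ⟨Q, hQ, this⟩ with h | h
          · rw [h] at hlt; exact absurd hlt (lt_irrefl _)
          · exact absurd (h.trans (hbag v)) (ssubset_irrefl _)
  exact key _ q p rfl h

/-- The bag of `v.succ` consists of the ancestors of `v`. The extra root `0` has the empty bag and
joins the trees of the forest into one. -/
theorem IsElim.exists_decomposition {G : SimpleGraph (Fin n)} {k : ℕ}
    {le : Fin n → Fin n → Prop} (h : IsElim G.Adj Finset.univ k le) :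
    ∃ D : TreeDecomposition G, D.IsDepthDecomposition ∧ D.width ≤ k := by
  classical
  let down (v : Fin n) : Finset (Fin n) := Finset.univ.filter (le · v)
  have hdown : ∀ u v, u ∈ down v ↔ le u v := fun u v => by simp [down]
  let bag : Fin (n + 1) → Finset (Fin n) := Fin.cases ∅ down
  have hrefl := fun u => h.refl u (Finset.mem_univ u)
  have htrans := fun {u v w} => h.trans u (Finset.mem_univ u) v (Finset.mem_univ v) w
    (Finset.mem_univ w)
  -- The proper ancestors of `v` form a chain; its lowest element, the one with most ancestors, is
  -- the parent. If there is none, the parent is the root.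
  have hpar : ∀ v, ∃ p, bag p = (down v).erase v := by
    intro v
    rcases ((down v).erase v).eq_empty_or_nonempty with he | hne
    · exact ⟨0, he.symm⟩
    · obtain ⟨u, hu, hmax⟩ := Finset.exists_max_image _ (fun u => (down u).card) hne
      simp only [Finset.mem_erase, hdown] at hu hmax
      refine ⟨u.succ, ?_⟩
      ext x
      simp only [bag, Fin.cases_succ, Finset.mem_erase, hdown]
      constructor
      · intro hx
        refine ⟨?_, htrans hx hu.2⟩
        rintro rfl
        exact hu.1 (h.antisymm _ (Finset.mem_univ _) _ (Finset.mem_univ _) hu.2 hx)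
      · rintro ⟨hxv, hx⟩
        rcases h.chain x (Finset.mem_univ _) u (Finset.mem_univ _) v (Finset.mem_univ _) hx hu.2
          with hxu | hux
        · exact hxu
        · have hs : down u ⊆ down x := fun y hy =>
            (hdown _ _).2 (htrans ((hdown _ _).1 hy) hux)
          have := Finset.eq_of_subset_of_card_le hs (hmax x ⟨hxv, hx⟩)
          rw [← hdown, this, hdown]
          exact hrefl x
  choose par hpar using hpar
  have hbag : ∀ v, bag (par v) ⊂ bag v.succ := fun v => by
    rw [hpar]
    exact Finset.erase_ssubset ((hdown _ _).2 (hrefl v))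
  have ht : (parentTree par).IsTree :=
    parentTree_isTree (fun p => (bag p).card) fun v => Finset.card_lt_card (hbag v)
  refine ⟨⟨n + 1, parentTree par, ht, bag, fun u => ⟨u.succ, (hdown _ _).2 (hrefl u)⟩, ?_, ?_⟩,
    ⟨0, ?_⟩, ?_⟩
  · intro u v huv
    rcases h.adj u (Finset.mem_univ _) v (Finset.mem_univ _) huv with h1 | h1
    · exact ⟨v.succ, (hdown _ _).2 h1, (hdown _ _).2 (hrefl v)⟩
    · exact ⟨u.succ, (hdown _ _).2 (hrefl u), (hdown _ _).2 h1⟩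
  · intro u
    refine connected_induce_of_rank (fun p => (bag p).card) (p₀ := u.succ)
      ((hdown _ _).2 (hrefl u)) fun q hq hqu => ?_
    obtain ⟨v, rfl⟩ : ∃ v : Fin n, v.succ = q := Fin.exists_succ_eq.2 (by
      rintro rfl; simp [bag] at hq)
    have hlt := Finset.card_lt_card (hbag v)
    refine ⟨par v, ?_, hlt, parentTree_adj fun h => hlt.ne (by rw [h])⟩
    rw [Set.mem_ofPred_eq, hpar, Finset.mem_erase]
    exact ⟨fun e => hqu (by rw [e]), hq⟩
  · rintro p q ⟨hpq, P, hP, hp⟩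
    exact (bag_ssubset_of_isAncestor bag hbag ⟨P, hP, hp⟩).resolve_left hpq
  · have : (Finset.univ.sup fun p => (bag p).card) ≤ k + 1 := by
      refine Finset.sup_le fun p _ => ?_
      cases p using Fin.cases with
      | zero => simp [bag]
      | succ v => exact h.card v (Finset.mem_univ _) _ fun u hu =>
          ⟨Finset.mem_univ _, (hdown _ _).1 hu⟩
    exact Nat.sub_le_of_le_add this

/-- Order the vertices by reverse inclusion of the sets `T u` of nodes whose bags contain them, and
by number if these sets coincide. Vertices in a common bag have nested sets, and every bag that
contains `v` contains all ancestors of `v`. -/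
theorem hasElim_of_decomposition {G : SimpleGraph (Fin n)} {k : ℕ} (D : TreeDecomposition G)
    (hD : D.IsDepthDecomposition) (hw : D.width ≤ k) : HasElim G.Adj Finset.univ k := by
  classical
  obtain ⟨r, hr⟩ := hD
  let T (u : Fin n) : Set (Fin D.nodes) := {p | u ∈ D.bag p}
  have hT : ∀ u p q, IsAncestor D.tree r p q → p ∈ T u → q ∈ T u := by
    intro u p q hpq hp
    by_cases e : p = q
    · exact e ▸ hp
    · exact (hr p q ⟨e, hpq⟩).1 hp
  have hcomp : ∀ u v x, x ∈ T u → x ∈ T v → T u ⊆ T v ∨ T v ⊆ T u := fun u v x hu hv =>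
    subset_or_subset_of_mem D.isTree (D.connected u) (D.connected v) (hT u) (hT v) hu hv
  have htot : ∀ u v, (T u ⊆ T v ∨ T v ⊆ T u) →
      (T v ⊆ T u ∧ (T u ⊆ T v → u ≤ v)) ∨ (T u ⊆ T v ∧ (T v ⊆ T u → v ≤ u)) := by
    intro u v h
    rcases le_total u v with h1 | h1 <;> tauto
  refine ⟨fun u v => T v ⊆ T u ∧ (T u ⊆ T v → u ≤ v), ?_, ?_, ?_, ?_, ?_, ?_⟩
  · exact fun u _ => ⟨subset_rfl, fun _ => le_rfl⟩
  · exact fun u _ v _ h1 h2 => le_antisymm (h1.2 h2.1) (h2.2 h1.1)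
  · exact fun u _ v _ w _ h1 h2 => ⟨h2.1.trans h1.1, fun h =>
      (h1.2 (h.trans h2.1)).trans (h2.2 (h1.1.trans h))⟩
  · intro u _ v _ w _ h1 h2
    obtain ⟨x, hx⟩ := D.exists_mem_bag w
    exact htot u v (hcomp u v x (h1.1 hx) (h2.1 hx))
  · intro u _ v _ huv
    obtain ⟨x, hu, hv⟩ := D.exists_edge_bag u v huv
    exact htot u v (hcomp u v x hu hv)
  · intro v _ E hE
    obtain ⟨x, hx⟩ := D.exists_mem_bag v
    have h1 : E ⊆ D.bag x := fun u hu => (hE u hu).2.1 hx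
    have h2 : (D.bag x).card ≤ Finset.univ.sup fun p => (D.bag p).card :=
      Finset.le_sup (f := fun p => (D.bag p).card) (Finset.mem_univ x)
    have h3 := Finset.card_le_card h1
    unfold TreeDecomposition.width at hw
    omega

theorem treeDepth_le_iff {G : SimpleGraph (Fin n)} {k : ℕ} :
    treeDepth G ≤ k ↔ HasElim G.Adj Finset.univ k := by
  constructor
  · intro h
    -- The infimum of an empty set would be the junk value `0`; the usual linear order on the
    -- vertices provides a decomposition.
    have hne : {w | ∃ D : TreeDecomposition G, D.IsDepthDecomposition ∧ D.width = w}.Nonempty := by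
      have : IsElim G.Adj Finset.univ n (· ≤ ·) :=
        ⟨fun u _ => le_rfl, fun u _ v _ => le_antisymm, fun u _ v _ w _ => le_trans,
          fun u _ v _ w _ _ _ => le_total u v, fun u _ v _ _ => le_total u v,
          fun v _ D _ => (Finset.card_le_univ D).trans (by simp)⟩
      obtain ⟨D, hD, -⟩ := this.exists_decomposition
      exact ⟨_, D, hD, rfl⟩
    obtain ⟨D, hD, hw⟩ := Nat.sInf_mem hne
    exact hasElim_of_decomposition D hD (hw.trans_le h)
  · rintro ⟨le, h⟩
    obtain ⟨D, hD, hw⟩ := h.exists_decomposition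
    have : treeDepth G ≤ D.width := Nat.sInf_le ⟨D, hD, rfl⟩
    exact this.trans hw

end FromElim

end ParKernel

namespace ParKernel

/-! ### The kernel on graphs with vertices `0, …, N - 1` -/

/-- The number of elements below `n` that satisfy `P`. -/
noncomputable def cnt (P : ℕ → Prop) (n : ℕ) : ℕ :=
  @Nat.count P (fun _ => Classical.propDecidable _) n

theorem cnt_eq_count (P : ℕ → Prop) [DecidablePred P] (n : ℕ) : cnt P n = Nat.count P n := by
  unfold cnt; congr

theorem cnt_eq_card (P : ℕ → Prop) [DecidablePred P] (n : ℕ) :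
    cnt P n = ((Finset.range n).filter P).card := by
  rw [cnt_eq_count, Nat.count_eq_card_filter_range]

theorem cnt_injective {P : ℕ → Prop} {u v : ℕ} (hu : P u) (hv : P v) (h : cnt P u = cnt P v) :
    u = v := by
  classical
  rw [cnt_eq_count, cnt_eq_count] at h
  exact Nat.count_injective hu hv h

namespace Kernel

/-- The number of common neighbours of `u` and `v` outside the vertex cover. -/
noncomputable def common (N : ℕ) (a : ℕ → ℕ → Prop) (s : ℕ → Prop) (u v : ℕ) : ℕ :=
  cnt (fun w => ¬ s w ∧ a w u ∧ a w v) N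

/-- The graph in which vertices of the cover with more than `k` common neighbours are joined. -/
def Adj (N k : ℕ) (a : ℕ → ℕ → Prop) (s : ℕ → Prop) (u v : ℕ) : Prop :=
  a u v ∨ (u ≠ v ∧ s u ∧ s v ∧ k < common N a s u v)

/-- Simplicial vertices of the augmented graph outside the cover. -/
def Simplicial (N k : ℕ) (a : ℕ → ℕ → Prop) (s : ℕ → Prop) (w : ℕ) : Prop :=
  ¬ s w ∧ ∀ u < N, ∀ v < N, a w u → a w v → u ≠ v → Adj N k a s u v

/-- Superfluous simplicial vertices: each neighbour has more than `k` smaller simplicial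
neighbours. -/
def Superfluous (N k : ℕ) (a : ℕ → ℕ → Prop) (s : ℕ → Prop) (w : ℕ) : Prop :=
  Simplicial N k a s w ∧
    ∀ x < N, a w x → k < cnt (fun w' => Simplicial N k a s w' ∧ a w' x) w

/-- The vertices of the kernel. -/
def Keep (N k : ℕ) (a : ℕ → ℕ → Prop) (s : ℕ → Prop) (v : ℕ) : Prop :=
  v < N ∧ ¬ Superfluous N k a s v

/-- The adjacency relation `a` is a graph on `0, …, N - 1` with vertex cover `s`. -/
structure IsCovered (N : ℕ) (a : ℕ → ℕ → Prop) (s : ℕ → Prop) : Prop where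
  symm : ∀ u v, a u v → a v u
  irrefl : ∀ u, ¬ a u u
  lt : ∀ u v, a u v → u < N
  cover : ∀ u v, a u v → s u ∨ s v
  cover_lt : ∀ u, s u → u < N

/-- `cnt P` numbers the elements of `P` consecutively from `0`, so at most `k + 1` of them receive a
number up to `k`. -/
theorem card_filter_count_le (P : ℕ → Prop) (N k : ℕ)
    [DecidablePred fun w => P w ∧ cnt P w ≤ k] :
    ((Finset.range N).filter fun w => P w ∧ cnt P w ≤ k).card ≤ k + 1 := by
  rw [← Finset.card_range (k + 1)]
  refine Finset.card_le_card_of_injOn (cnt P) ?_ ?_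
  · intro w hw
    simp only [Finset.coe_filter, Set.mem_ofPred_eq] at hw
    simp only [Finset.coe_range, Set.mem_Iio]
    omega
  · intro v hv w hw h
    simp only [Finset.coe_filter, Set.mem_ofPred_eq] at hv hw
    exact cnt_injective hv.2.1 hw.2.1 h

/-- As `P` has more than `k` elements below `M`, its elements with the numbers `0, …, k` exist and
are less than `N`. -/
theorem lt_card_filter_count {P : ℕ → Prop} {M N k : ℕ}
    [DecidablePred fun w => P w ∧ cnt P w ≤ k] (hM : M ≤ N) (h : k < cnt P M) :
    k < ((Finset.range N).filter fun w => P w ∧ cnt P w ≤ k).card := by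
  have hlt : ∀ i < k + 1, i < cnt P M := fun i hi => by omega
  have hf : ∀ i < k + 1, ∀ hf : (Set.ofPred P).Finite, i < hf.toFinset.card := fun i hi hf =>
    lt_of_lt_of_le (hlt i hi) (by classical rw [cnt_eq_count]; exact Nat.count_le_card hf M)
  have hc : ∀ i < k + 1, cnt P (Nat.nth P i) = i := fun i hi => by
    classical rw [cnt_eq_count]; exact Nat.count_nth (hf i hi)
  rw [← Nat.succ_le_iff, Nat.succ_eq_add_one, ← Finset.card_range (k + 1)]
  refine Finset.card_le_card_of_injOn (Nat.nth P) ?_ ?_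
  · intro i hi
    simp only [Finset.coe_range, Set.mem_Iio] at hi
    simp only [Finset.coe_filter, Set.mem_ofPred_eq, Finset.mem_range]
    refine ⟨?_, ?_, ?_⟩
    · classical exact
        (Nat.nth_lt_of_lt_count ((hlt i hi).trans_eq (cnt_eq_count P M))).trans_le hM
    · exact Nat.nth_mem i (hf i hi)
    · rw [hc i hi]; omega
  · intro i hi j hj h
    simp only [Finset.coe_range, Set.mem_Iio] at hi hj
    rw [← hc i hi, h, hc j hj]

section

variable {N k : ℕ} {a : ℕ → ℕ → Prop} {s : ℕ → Prop}

theorem Adj.symm (h : IsCovered N a s) {u v : ℕ} (huv : Adj N k a s u v) : Adj N k a s v u := by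
  rcases huv with h1 | ⟨h1, h2, h3, h4⟩
  · exact Or.inl (h.symm _ _ h1)
  · refine Or.inr ⟨h1.symm, h3, h2, ?_⟩
    have : common N a s v u = common N a s u v := by
      unfold common; congr 1; ext w; tauto
    rwa [this]

theorem Adj.isCovered (h : IsCovered N a s) : IsCovered N (Adj N k a s) s where
  symm _ _ := Adj.symm h
  irrefl u hu := by
    rcases hu with h1 | h1
    · exact h.irrefl _ h1
    · exact h1.1 rfl
  lt u v hu := by
    rcases hu with h1 | h1
    · exact h.lt _ _ h1
    · exact h.cover_lt _ h1.2.1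
  cover u v hu := by
    rcases hu with h1 | h1
    · exact h.cover _ _ h1
    · exact Or.inl h1.2.1
  cover_lt := h.cover_lt

-- The cover is a chain on top and the other vertices are pairwise incomparable leaves below all of
-- it, so a vertex has at most `|S| + 1` ancestors.
open Classical in
theorem hasElim_of_cover_le (h : IsCovered N a s) (hk : cnt s N ≤ k) :
    HasElim a (Finset.range N) k := by
  refine ⟨fun u v => u = v ∨ (s u ∧ (s v → u ≤ v)), ?_, ?_, ?_, ?_, ?_, ?_⟩
  · exact fun u _ => Or.inl rfl
  · rintro u _ v _ (h1 | h1) (h2 | h2)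
    · exact h1
    · exact h1
    · exact h2.symm
    · exact le_antisymm (h1.2 h2.1) (h2.2 h1.1)
  · rintro u _ v _ w _ (rfl | h1) (rfl | h2)
    · exact Or.inl rfl
    · exact Or.inr h2
    · exact Or.inr h1
    · exact Or.inr ⟨h1.1, fun hw => (h1.2 h2.1).trans (h2.2 hw)⟩
  · rintro u _ v _ w _ (rfl | h1) (rfl | h2)
    · exact Or.inl (Or.inl rfl)
    · exact Or.inr (Or.inr h2)
    · exact Or.inl (Or.inr h1)
    · rcases le_total u v with h3 | h3
      · exact Or.inl (Or.inr ⟨h1.1, fun _ => h3⟩)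
      · exact Or.inr (Or.inr ⟨h2.1, fun _ => h3⟩)
  · intro u _ v _ huv
    by_cases hu : s u <;> by_cases hv : s v
    · rcases le_total u v with h3 | h3
      · exact Or.inl (Or.inr ⟨hu, fun _ => h3⟩)
      · exact Or.inr (Or.inr ⟨hv, fun _ => h3⟩)
    · exact Or.inl (Or.inr ⟨hu, fun h => absurd h hv⟩)
    · exact Or.inr (Or.inr ⟨hv, fun h => absurd h hu⟩)
    · exact absurd (h.cover u v huv) (by tauto)
  · intro v _ D hD
    have : D ⊆ insert v ((Finset.range N).filter s) := by
      intro u hu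
      obtain ⟨h1, h2⟩ := hD u hu
      rw [Finset.mem_insert, Finset.mem_filter]
      tauto
    refine (Finset.card_le_card this).trans ((Finset.card_insert_le _ _).trans ?_)
    rw [← cnt_eq_card]
    omega

-- The given order still works. If `u` and `v` were incomparable, each common neighbour, being
-- comparable to both, would be an ancestor of both.
open Classical in
theorem HasElim.kernel (h : IsCovered N a s) (he : HasElim a (Finset.range N) k) :
    HasElim (Adj N k a s) ((Finset.range N).filter (Keep N k a s)) k := by
  obtain ⟨le, he⟩ := he
  have hsub : ∀ {u}, u ∈ (Finset.range N).filter (Keep N k a s) → u ∈ Finset.range N :=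
    fun hu => (Finset.mem_filter.1 hu).1
  refine ⟨le, fun u hu => he.refl u (hsub hu), fun u hu v hv => he.antisymm u (hsub hu) v (hsub hv),
    fun u hu v hv w hw => he.trans u (hsub hu) v (hsub hv) w (hsub hw),
    fun u hu v hv w hw => he.chain u (hsub hu) v (hsub hv) w (hsub hw), ?_,
    fun v hv D hD => he.card v (hsub hv) D fun u hu => ⟨hsub (hD u hu).1, (hD u hu).2⟩⟩
  rintro u hu v hv (huv | ⟨-, -, -, hc⟩)
  · exact he.adj u (hsub hu) v (hsub hv) huv
  · by_contra hn
    rw [common, cnt_eq_card] at hc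
    set C := (Finset.range N).filter fun w => ¬ s w ∧ a w u ∧ a w v
    have huC : u ∉ C := fun h' => h.irrefl u (Finset.mem_filter.1 h').2.2.1
    -- Together with `u` itself, the more than `k` common neighbours exceed the `k + 1` ancestors
    -- that `u` may have.
    have := he.card u (hsub hu) (insert u C) (by
      intro w hw
      rcases Finset.mem_insert.1 hw with rfl | hw
      · exact ⟨hsub hu, he.refl _ (hsub hu)⟩
      · obtain ⟨hwN, _, hwu, hwv⟩ := Finset.mem_filter.1 hw
        refine ⟨hwN, ?_⟩
        rcases he.adj w hwN u (hsub hu) hwu with h1 | h1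
        · exact h1
        · exfalso
          apply hn
          rcases he.adj w hwN v (hsub hv) hwv with h2 | h2
          · exact Or.inl (he.trans u (hsub hu) w hwN v (hsub hv) h1 h2)
          · exact he.chain u (hsub hu) v (hsub hv) w hwN h1 h2)
    rw [Finset.card_insert_of_notMem huC] at this
    omega

/-- The first `k + 1` simplicial neighbours of `x` are not superfluous, as `x` itself witnesses.
They cannot all be ancestors of `x`, which would then have `k + 2` ancestors; since each is
comparable to `x`, one is a proper descendant. -/
theorem exists_larger_of_superfluous (h : IsCovered N a s) {le : ℕ → ℕ → Prop} {W : Finset ℕ}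
    (hW : ∀ v, v ∈ W ↔ Keep N k a s v) (he : IsElim (Adj N k a s) W k le) {w x : ℕ}
    (hw : Superfluous N k a s w) (hwx : a w x) (hx : x ∈ W) : ∃ y ∈ W, le x y ∧ y ≠ x := by
  classical
  have hwN := h.lt _ _ hwx
  have hxN := h.lt _ _ (h.symm _ _ hwx)
  set P := fun w' => Simplicial N k a s w' ∧ a w' x
  have hlt := lt_card_filter_count hwN.le (hw.2 x hxN hwx)
  set C := (Finset.range N).filter fun w => P w ∧ cnt P w ≤ k
  have hCW : ∀ y ∈ C, y ∈ W ∧ y ≠ x ∧ a y x := by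
    intro y hy
    obtain ⟨hyN, ⟨hys, hyx⟩, hyc⟩ := Finset.mem_filter.1 hy
    refine ⟨(hW y).2 ⟨Finset.mem_range.1 hyN, fun hsup => ?_⟩, ?_, hyx⟩
    · exact absurd (hsup.2 x hxN hyx) (not_lt.2 hyc)
    · rintro rfl; exact h.irrefl _ hyx
  by_contra! hn
  have := he.card x hx (insert x C) (by
    intro y hy
    rcases Finset.mem_insert.1 hy with rfl | hy
    · exact ⟨hx, he.refl _ hx⟩
    · obtain ⟨h1, h2, h3⟩ := hCW y hy
      refine ⟨h1, (he.adj y h1 x hx (Or.inl h3)).resolve_right fun h4 => h2 (hn y h1 h4)⟩)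
  rw [Finset.card_insert_of_notMem fun h' => (hCW x h').2.1 rfl] at this
  omega

-- Each superfluous vertex is put back as a leaf below its neighbours, which form a chain because
-- they are a clique in the augmented graph. The height does not grow because the lowest neighbour
-- already has a proper descendant.
open Classical in
theorem HasElim.of_kernel (h : IsCovered N a s)
    (he : HasElim (Adj N k a s) ((Finset.range N).filter (Keep N k a s)) k) :
    HasElim a (Finset.range N) k := by
  obtain ⟨le, he⟩ := he
  set W := (Finset.range N).filter (Keep N k a s) with hWdef
  have hW : ∀ v, v ∈ W ↔ Keep N k a s v := fun v => by
    rw [hWdef, Finset.mem_filter, Finset.mem_range]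
    exact ⟨fun h => h.2, fun h => ⟨h.1, h⟩⟩
  have hnW : ∀ v < N, v ∉ W → Superfluous N k a s v := fun v hv hvW => by
    rw [hW, Keep] at hvW
    by_contra hn
    exact hvW ⟨hv, hn⟩
  -- Removed vertices are outside the cover, hence pairwise non-adjacent.
  have hnb : ∀ w x, w ∉ W → a w x → x ∈ W := fun w x hw hwx => by
    by_contra hx
    have h1 := hnW w (h.lt _ _ hwx) hw
    have h2 := hnW x (h.lt _ _ (h.symm _ _ hwx)) hx
    rcases h.cover _ _ hwx with h3 | h3
    · exact h1.1.1 h3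
    · exact h2.1.1 h3
  have hcl : ∀ w x y, w ∉ W → a w x → a w y → le x y ∨ le y x := fun w x y hw hx hy => by
    by_cases e : x = y
    · subst e; exact Or.inl (he.refl _ (hnb w x hw hx))
    · exact he.adj x (hnb w x hw hx) y (hnb w y hw hy) ((hnW w (h.lt _ _ hx) hw).1.2 x
        (h.lt _ _ (h.symm _ _ hx)) y (h.lt _ _ (h.symm _ _ hy)) hx hy e)
  have hdc : ∀ w, w ∉ W → ∀ u ∈ W, ∀ v ∈ W, ∀ x y, a w x → a w y → le u x → le v y →
      le u v ∨ le v u := fun w hw u hu v hv x y hx hy hux hvy => by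
    have hxW := hnb w x hw hx
    have hyW := hnb w y hw hy
    rcases hcl w x y hw hx hy with hxy | hxy
    · exact he.chain u hu v hv y hyW (he.trans u hu x hxW y hyW hux hxy) hvy
    · exact he.chain u hu v hv x hxW hux (he.trans v hv y hyW x hxW hvy hxy)
  -- A removed vertex has as proper ancestors exactly the kept vertices that are above or equal to
  -- one of its neighbours.
  let lt' (u v : ℕ) : Prop := u = v ∨ (u ∈ W ∧ v ∈ W ∧ le u v) ∨
    (u ∈ W ∧ v ∉ W ∧ ∃ x, a v x ∧ le u x)
  refine ⟨lt', fun u _ => Or.inl rfl, ?_, ?_, ?_, ?_, ?_⟩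
  · rintro u _ v _ (h1 | ⟨h1, h2, h3⟩ | ⟨h1, h2, _⟩) (h4 | ⟨h4, h5, h6⟩ | ⟨h4, h5, _⟩)
    · exact h1
    · exact h1
    · exact h1
    · exact h4.symm
    · exact he.antisymm u h1 v h2 h3 h6
    · exact absurd h1 h5
    · exact h4.symm
    · exact absurd h4 h2
    · exact absurd h4 h2
  · rintro u _ v _ w _ (rfl | ⟨h1, h2, h3⟩ | ⟨h1, h2, h3⟩) (rfl | ⟨h4, h5, h6⟩ | ⟨h4, h5, x, hx, h6⟩)
    · exact Or.inl rfl
    · exact Or.inr (Or.inl ⟨h4, h5, h6⟩)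
    · exact Or.inr (Or.inr ⟨h4, h5, x, hx, h6⟩)
    · exact Or.inr (Or.inl ⟨h1, h2, h3⟩)
    · exact Or.inr (Or.inl ⟨h1, h5, he.trans u h1 v h2 w h5 h3 h6⟩)
    · exact Or.inr (Or.inr ⟨h1, h5, x, hx, he.trans u h1 v h2 x (hnb w x h5 hx) h3 h6⟩)
    · exact Or.inr (Or.inr ⟨h1, h2, h3⟩)
    · exact absurd h4 h2
    · exact absurd h4 h2
  · rintro u _ v _ w _ (rfl | ⟨h1, h2, h3⟩ | ⟨h1, h2, x, hx, h3⟩)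
      (rfl | ⟨h4, h5, h6⟩ | ⟨h4, h5, y, hy, h6⟩)
    · exact Or.inl (Or.inl rfl)
    · exact Or.inr (Or.inr (Or.inl ⟨h4, h5, h6⟩))
    · exact Or.inr (Or.inr (Or.inr ⟨h4, h5, y, hy, h6⟩))
    · exact Or.inl (Or.inr (Or.inl ⟨h1, h2, h3⟩))
    · rcases he.chain u h1 v h4 w h2 h3 h6 with h7 | h7
      · exact Or.inl (Or.inr (Or.inl ⟨h1, h4, h7⟩))
      · exact Or.inr (Or.inr (Or.inl ⟨h4, h1, h7⟩))
    · exact absurd h2 h5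
    · exact Or.inl (Or.inr (Or.inr ⟨h1, h2, x, hx, h3⟩))
    · exact absurd h5 h2
    · rcases hdc w h2 u h1 v h4 x y hx hy h3 h6 with h7 | h7
      · exact Or.inl (Or.inr (Or.inl ⟨h1, h4, h7⟩))
      · exact Or.inr (Or.inr (Or.inl ⟨h4, h1, h7⟩))
  · intro u _ v _ huv
    by_cases hu : u ∈ W
    · by_cases hv : v ∈ W
      · rcases he.adj u hu v hv (Or.inl huv) with h1 | h1
        · exact Or.inl (Or.inr (Or.inl ⟨hu, hv, h1⟩))
        · exact Or.inr (Or.inr (Or.inl ⟨hv, hu, h1⟩))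
      · exact Or.inl (Or.inr (Or.inr ⟨hu, hv, u, h.symm _ _ huv, he.refl u hu⟩))
    · have hv := hnb u v hu huv
      exact Or.inr (Or.inr (Or.inr ⟨hv, hu, v, huv, he.refl v hv⟩))
  · intro v hv D hD
    by_cases hvW : v ∈ W
    · refine he.card v hvW D fun u hu => ?_
      rcases (hD u hu).2 with rfl | ⟨h1, _, h3⟩ | ⟨_, h2, _⟩
      · exact ⟨hvW, he.refl u hvW⟩
      · exact ⟨h1, h3⟩
      · exact absurd hvW h2
    · have hD' : ∀ u ∈ D, u ≠ v → u ∈ W ∧ ∃ x, a v x ∧ le u x := by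
        intro u hu huv
        rcases (hD u hu).2 with rfl | ⟨_, h2, _⟩ | ⟨h1, _, h3⟩
        · exact absurd rfl huv
        · exact absurd h2 hvW
        · exact ⟨h1, h3⟩
      set M := (Finset.range N).filter (a v)
      have hM : ∀ x, x ∈ M ↔ a v x := fun x => by
        rw [Finset.mem_filter, Finset.mem_range]
        exact ⟨fun h => h.2, fun hx => ⟨h.lt _ _ (h.symm _ _ hx), hx⟩⟩
      -- A removed vertex without neighbours is an isolated root. Otherwise let `x` be its lowest
      -- neighbour, found as the one with most ancestors.
      rcases M.eq_empty_or_nonempty with hMe | hMne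
      · have : D ⊆ {v} := fun u hu => by
          by_contra hn
          rw [Finset.mem_singleton] at hn
          obtain ⟨-, x, hx, -⟩ := hD' u hu hn
          have := (hM x).2 hx
          simp [hMe] at this
        have := Finset.card_le_card this
        rw [Finset.card_singleton] at this
        omega
      · obtain ⟨x, hx, hxmax⟩ := Finset.exists_max_image M (fun x => (W.filter (le · x)).card) hMne
        have hx' := (hM x).1 hx
        have hxW := hnb v x hvW hx'
        have hle : ∀ y, a v y → le y x := fun y hy => by
          have hyW := hnb v y hvW hy
          rcases hcl v x y hvW hx' hy with h1 | h1
          · have hs : W.filter (le · x) ⊆ W.filter (le · y) := fun z hz => by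
              rw [Finset.mem_filter] at hz ⊢
              exact ⟨hz.1, he.trans z hz.1 x hxW y hyW hz.2 h1⟩
            have := Finset.eq_of_subset_of_card_le hs (hxmax y ((hM y).2 hy))
            have h2 : y ∈ W.filter (le · y) := Finset.mem_filter.2 ⟨hyW, he.refl y hyW⟩
            rw [← this] at h2
            exact (Finset.mem_filter.1 h2).2
          · exact h1
        obtain ⟨y, hyW, hxy, hne⟩ :=
          exists_larger_of_superfluous h hW he (hnW v (Finset.mem_range.1 hv) hvW) hx' hxW
        have hDx : ∀ u ∈ D.erase v, u ∈ W ∧ le u x := fun u hu => by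
          rw [Finset.mem_erase] at hu
          obtain ⟨h1, z, hz, h2⟩ := hD' u hu.2 hu.1
          exact ⟨h1, he.trans u h1 z (hnb v z hvW hz) x hxW h2 (hle z hz)⟩
        have hy : y ∉ D.erase v := fun h' =>
          hne (he.antisymm y hyW x hxW (hDx y h').2 hxy)
        -- The proper ancestors of `v` are ancestors of `x`, hence proper ancestors of `y`; in the
        -- count `y` takes the place of `v`.
        have := he.card y hyW (insert y (D.erase v)) (by
          intro u hu
          rcases Finset.mem_insert.1 hu with rfl | hu
          · exact ⟨hyW, he.refl u hyW⟩
          · exact ⟨(hDx u hu).1, he.trans u (hDx u hu).1 x hxW y hyW (hDx u hu).2 hxy⟩)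
        rw [Finset.card_insert_of_notMem hy] at this
        have := Finset.pred_card_le_card_erase (s := D) (a := v)
        omega

-- With `c = |S|`, there are at most `c` kept vertices in `S`. A vertex that is not simplicial has
-- two neighbours in `S` with at most `k` common neighbours, giving at most `c * c * k` of them. A
-- kept simplicial vertex is among the first `k + 1` simplicial neighbours of some `x` in `S`,
-- giving at most `c * (k + 1)`. Since `k < c`, each of the three terms is at most `c ^ 3`.
open Classical in
theorem count_keep_le (h : IsCovered N a s) (hk : k < cnt s N) :
    cnt (Keep N k a s) N ≤ 3 * cnt s N ^ 3 := by
  set S := (Finset.range N).filter s with hS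
  have hmS : ∀ v, v ∈ S ↔ s v := fun v => by
    rw [hS, Finset.mem_filter, Finset.mem_range]
    exact ⟨fun h => h.2, fun hv => ⟨h.cover_lt _ hv, hv⟩⟩
  rw [cnt_eq_card s, ← hS] at hk ⊢
  rw [cnt_eq_card]
  let B (p : ℕ × ℕ) := if common N a s p.1 p.2 ≤ k then
    (Finset.range N).filter (fun w => ¬ s w ∧ a w p.1 ∧ a w p.2) else ∅
  let E (x : ℕ) := (Finset.range N).filter fun w => (Simplicial N k a s w ∧ a w x) ∧
    cnt (fun w' => Simplicial N k a s w' ∧ a w' x) w ≤ k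
  have hsub : (Finset.range N).filter (Keep N k a s) ⊆
      S ∪ ((S ×ˢ S).biUnion B ∪ S.biUnion E) := by
    intro w hw
    obtain ⟨hwN, -, hws⟩ := Finset.mem_filter.1 hw
    rw [Finset.mem_union, Finset.mem_union, Finset.mem_biUnion, Finset.mem_biUnion, hmS]
    by_cases hs : s w
    · exact Or.inl hs
    · right
      have hN : ∀ x, a w x → s x := fun x hx => (h.cover _ _ hx).resolve_left hs
      by_cases hsim : Simplicial N k a s w
      · right
        have : ∃ x, a w x ∧ ¬ k < cnt (fun w' => Simplicial N k a s w' ∧ a w' x) w := by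
          by_contra! hn
          exact hws ⟨hsim, fun x _ hx => hn x hx⟩
        obtain ⟨x, hx, hc⟩ := this
        exact ⟨x, (hmS x).2 (hN x hx), Finset.mem_filter.2 ⟨hwN, ⟨hsim, hx⟩, not_lt.1 hc⟩⟩
      · left
        have : ∃ u v, a w u ∧ a w v ∧ u ≠ v ∧ ¬ Adj N k a s u v := by
          by_contra! hn
          exact hsim ⟨hs, fun u _ v _ h1 h2 h3 => hn u v h1 h2 h3⟩
        obtain ⟨u, v, hu, hv, huv, hn⟩ := this
        refine ⟨(u, v), Finset.mem_product.2 ⟨(hmS u).2 (hN u hu), (hmS v).2 (hN v hv)⟩, ?_⟩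
        have hc : common N a s u v ≤ k := by
          by_contra hc
          exact hn (Or.inr ⟨huv, hN u hu, hN v hv, not_le.1 hc⟩)
        simp only [B, hc, if_true, Finset.mem_filter]
        exact ⟨hwN, hs, hu, hv⟩
  have hB : ((S ×ˢ S).biUnion B).card ≤ (S ×ˢ S).card * k :=
    Finset.card_biUnion_le_card_mul _ _ _ fun p _ => by
      simp only [B]
      split_ifs with hc
      · rwa [common, cnt_eq_card] at hc
      · simp
  have hE : (S.biUnion E).card ≤ S.card * (k + 1) :=
    Finset.card_biUnion_le_card_mul _ _ _ fun x _ =>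
      card_filter_count_le (fun w' => Simplicial N k a s w' ∧ a w' x) N k
  rw [Finset.card_product] at hB
  have h1 := Finset.card_le_card hsub
  have h2 := Finset.card_union_le S ((S ×ˢ S).biUnion B ∪ S.biUnion E)
  have h3 := Finset.card_union_le ((S ×ˢ S).biUnion B) (S.biUnion E)
  generalize S.card = c at *
  have h4 : c * c * k ≤ c * c * c := Nat.mul_le_mul_left _ hk.le
  have h5 : c * (k + 1) ≤ c * c := Nat.mul_le_mul_left _ hk
  have h6 : c * c ≤ c * c * c := Nat.le_mul_of_pos_right _ (by omega)
  have h7 : c ≤ c * c := Nat.le_mul_of_pos_right _ (by omega)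
  have h8 : c ^ 3 = c * c * c := by ring
  rw [h8]
  linarith

end

end Kernel

end ParKernel

namespace ParKernel

/-! ### Finite automata on the columns of addresses -/

/-- The `b` lowest bits of `u`, as a column of height `B`. -/
def column (B b u : ℕ) : Fin B → Bool := fun i => decide (i.val < b) && u.testBit i

/-- A finite automaton that reads two columns of height `B` and one further bit in every step. -/
structure Automaton (B : ℕ) where
  State : Type
  fin : Fintype State
  init : State
  step : State → (Fin B → Bool) → (Fin B → Bool) → Bool → State
  accept : State → Bool

namespace Automaton

variable {B : ℕ}

/-- The run on `L` columns of `u`, `v` and `n`, where the columns of `u` and `v` consist of `bu` and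
`bv` bits. -/
def run (A : Automaton B) (bu bv : ℕ) : ℕ → A.State → ℕ → ℕ → ℕ → A.State
  | 0, q, _, _, _ => q
  | L + 1, q, u, v, n =>
    A.run bu bv L (A.step q (column B bu u) (column B bv v) (n.testBit 0)) (u / 2 ^ bu) (v / 2 ^ bv)
      (n / 2)

end Automaton

/-- The relation `P L u v n` is recognized by a finite automaton reading `L` columns. -/
def Recognizable (B bu bv : ℕ) (P : ℕ → ℕ → ℕ → ℕ → Prop) : Prop :=
  ∃ A : Automaton B, ∀ L u v n, A.accept (A.run bu bv L A.init u v n) = true ↔ P L u v n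

/-- The number formed by the bits at index `i` of the first `L` columns of height `b` of `g`. -/
def field (b i : ℕ) : ℕ → ℕ → ℕ
  | 0, _ => 0
  | L + 1, g => (decide (i < b) && g.testBit i).toNat + 2 * field b i L (g / 2 ^ b)

/-- The numbers that an automaton can compare. -/
inductive Track (B : ℕ) : Type
  | fst (i : Fin B)
  | snd (i : Fin B)
  | len

namespace Track

variable {B : ℕ}

/-- The bit of a track in the current columns. -/
def bit (cu cv : Fin B → Bool) (cn : Bool) : Track B → Bool
  | fst i => cu i
  | snd i => cv i
  | len => cn

/-- The number on a track. -/
def val (bu bv L u v n : ℕ) : Track B → ℕ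
  | fst i => field bu i L u
  | snd i => field bv i L v
  | len => field 1 0 L n

theorem val_zero (bu bv u v n : ℕ) (T : Track B) : T.val bu bv 0 u v n = 0 := by
  cases T <;> rfl

theorem val_succ (bu bv L u v n : ℕ) (T : Track B) : T.val bu bv (L + 1) u v n =
    (T.bit (column B bu u) (column B bv v) (n.testBit 0)).toNat +
      2 * T.val bu bv L (u / 2 ^ bu) (v / 2 ^ bv) (n / 2) := by
  cases T <;> simp [val, bit, field, column]

end Track

namespace Recognizable

variable {B bu bv : ℕ} {P Q : ℕ → ℕ → ℕ → ℕ → Prop}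

theorem congr (h : Recognizable B bu bv P) (hPQ : ∀ L u v n, P L u v n ↔ Q L u v n) :
    Recognizable B bu bv Q := by
  obtain ⟨A, hA⟩ := h
  exact ⟨A, fun L u v n => (hA L u v n).trans (hPQ L u v n)⟩

theorem const (B bu bv : ℕ) (p : Prop) : Recognizable B bu bv fun _ _ _ _ => p := by
  classical
  exact ⟨⟨Unit, inferInstance, (), fun _ _ _ _ => (), fun _ => decide p⟩, fun L u v n => by simp⟩

theorem not (h : Recognizable B bu bv P) : Recognizable B bu bv fun L u v n => ¬ P L u v n := by
  obtain ⟨A, hA⟩ := h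
  let A' : Automaton B := ⟨A.State, A.fin, A.init, A.step, fun q => !A.accept q⟩
  have hrun : ∀ L q u v n, A'.run bu bv L q u v n = A.run bu bv L q u v n := by
    intro L
    induction L with
    | zero => intros; rfl
    | succ L ih => intro q u v n; exact ih _ _ _ _
  refine ⟨A', fun L u v n => ?_⟩
  change _ ↔ ¬ P L u v n
  rw [← hA, hrun]
  simp [A']

theorem and (h : Recognizable B bu bv P) (h' : Recognizable B bu bv Q) :
    Recognizable B bu bv fun L u v n => P L u v n ∧ Q L u v n := by
  obtain ⟨A, hA⟩ := h
  obtain ⟨A', hA'⟩ := h'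
  have := A.fin
  have := A'.fin
  let C : Automaton B := ⟨A.State × A'.State, inferInstance, (A.init, A'.init),
    fun q x y z => (A.step q.1 x y z, A'.step q.2 x y z), fun q => A.accept q.1 && A'.accept q.2⟩
  have hrun : ∀ L q u v n, C.run bu bv L q u v n =
      (A.run bu bv L q.1 u v n, A'.run bu bv L q.2 u v n) := by
    intro L
    induction L with
    | zero => intros; rfl
    | succ L ih => intro q u v n; exact ih _ _ _ _
  refine ⟨C, fun L u v n => ?_⟩
  change _ ↔ P L u v n ∧ Q L u v n
  rw [← hA, ← hA', hrun]
  simp [C]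

theorem or (h : Recognizable B bu bv P) (h' : Recognizable B bu bv Q) :
    Recognizable B bu bv fun L u v n => P L u v n ∨ Q L u v n :=
  (h.not.and h'.not).not.congr fun _ _ _ _ => by tauto

theorem all {ι : Type*} [Finite ι] {R : ι → ℕ → ℕ → ℕ → ℕ → Prop}
    (h : ∀ i, Recognizable B bu bv (R i)) : Recognizable B bu bv fun L u v n => ∀ i, R i L u v n := by
  classical
  have := Fintype.ofFinite ι
  have key : ∀ s : Finset ι, Recognizable B bu bv fun L u v n => ∀ i ∈ s, R i L u v n := by
    intro s
    induction s using Finset.induction_on with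
    | empty => exact (const B bu bv True).congr fun _ _ _ _ => by simp
    | insert i s _ ih => exact ((h i).and ih).congr fun _ _ _ _ => by simp
  exact (key Finset.univ).congr fun _ _ _ _ => by simp

theorem ex {ι : Type*} [Finite ι] {R : ι → ℕ → ℕ → ℕ → ℕ → Prop}
    (h : ∀ i, Recognizable B bu bv (R i)) : Recognizable B bu bv fun L u v n => ∃ i, R i L u v n :=
  (all fun i => (h i).not).not.congr fun _ _ _ _ => by simp

theorem track_eq (T T' : Track B) :
    Recognizable B bu bv fun L u v n => T.val bu bv L u v n = T'.val bu bv L u v n := by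
  let A : Automaton B := ⟨Bool, inferInstance, true,
    fun q x y z => q && (T.bit x y z == T'.bit x y z), id⟩
  have key : ∀ L q u v n, A.run bu bv L q u v n = true ↔
      q = true ∧ T.val bu bv L u v n = T'.val bu bv L u v n := by
    intro L
    induction L with
    | zero => intro q u v n; simp [Automaton.run, Track.val_zero]
    | succ L ih =>
      intro q u v n
      rw [Automaton.run, ih, Track.val_succ, Track.val_succ]
      simp only [A, Bool.and_eq_true, beq_iff_eq]
      cases T.bit (column B bu u) (column B bv v) (n.testBit 0) <;>
        cases T'.bit (column B bu u) (column B bv v) (n.testBit 0) <;> simp <;> omega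
  exact ⟨A, fun L u v n => (key L true u v n).trans (by simp)⟩

/-- The highest differing bit decides. As low bits are read first, every differing column overwrites
the verdict so far. -/
theorem track_lt (T T' : Track B) :
    Recognizable B bu bv fun L u v n => T.val bu bv L u v n < T'.val bu bv L u v n := by
  let A : Automaton B := ⟨Bool, inferInstance, false,
    fun q x y z => if T.bit x y z = T'.bit x y z then q else T'.bit x y z, id⟩
  have key : ∀ L q u v n, A.run bu bv L q u v n = true ↔
      T.val bu bv L u v n < T'.val bu bv L u v n ∨
        (q = true ∧ T.val bu bv L u v n = T'.val bu bv L u v n) := by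
    intro L
    induction L with
    | zero => intro q u v n; simp [Automaton.run, Track.val_zero]
    | succ L ih =>
      intro q u v n
      rw [Automaton.run, ih, Track.val_succ, Track.val_succ]
      simp only [A]
      cases T.bit (column B bu u) (column B bv v) (n.testBit 0) <;>
        cases T'.bit (column B bu u) (column B bv v) (n.testBit 0) <;> simp <;> omega
  exact ⟨A, fun L u v n => (key L false u v n).trans (by simp)⟩

theorem track_const (T : Track B) (c : Bool) :
    Recognizable B bu bv fun L u v n => T.val bu bv L u v n = c.toNat := by
  -- The first component is the bit expected next: `c` in the first column and `0` afterwards. A `1`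
  -- still expected at the end means that no column was read, and then the track has value `0`.
  let A : Automaton B := ⟨Bool × Bool, inferInstance, (c, true),
    fun q x y z => (false, q.2 && (T.bit x y z == q.1)), fun q => q.2 && !q.1⟩
  have key : ∀ L q u v n, A.accept (A.run bu bv L q u v n) = true ↔
      q.2 = true ∧ T.val bu bv L u v n = q.1.toNat := by
    intro L
    induction L with
    | zero =>
      rintro ⟨q, q'⟩ u v n
      cases q <;> simp [A, Automaton.run, Track.val_zero]
    | succ L ih =>
      rintro ⟨q, q'⟩ u v n
      rw [Automaton.run, ih, Track.val_succ]
      simp only [A, Bool.and_eq_true, beq_iff_eq]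
      cases T.bit (column B bu u) (column B bv v) (n.testBit 0) <;> cases q <;> simp
  exact ⟨A, fun L u v n => (key L (c, true) u v n).trans (by simp)⟩

end Recognizable

/-! ### Fields of numbers -/

theorem field_lt (b i L g : ℕ) : field b i L g < 2 ^ L := by
  induction L generalizing g with
  | zero => simp [field]
  | succ L ih =>
    have := ih (g / 2 ^ b)
    have h2 := Bool.toNat_le (decide (i < b) && g.testBit i)
    rw [field, pow_succ]
    omega

theorem field_one {L g : ℕ} (h : g < 2 ^ L) : field 1 0 L g = g := by
  induction L generalizing g with
  | zero => simp at h; simp [field, h]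
  | succ L ih =>
    rw [field, pow_one, ih (by rw [pow_succ] at h; omega), Nat.testBit_zero]
    rcases Nat.mod_two_eq_zero_or_one g with h1 | h1 <;> simp [h1] <;> omega

theorem eq_of_field_eq {b L g h : ℕ} (hg : g < 2 ^ (b * L)) (hh : h < 2 ^ (b * L))
    (e : ∀ i < b, field b i L g = field b i L h) : g = h := by
  induction L generalizing g h with
  | zero => simp at hg hh; omega
  | succ L ih =>
    have hb : ∀ i < b, g.testBit i = h.testBit i ∧
        field b i L (g / 2 ^ b) = field b i L (h / 2 ^ b) := by
      intro i hi
      have := e i hi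
      simp only [field, hi, decide_true, Bool.true_and] at this
      cases h1 : g.testBit i <;> cases h2 : h.testBit i <;> simp [h1, h2] at this ⊢ <;> omega
    have hdiv : ∀ x : ℕ, x < 2 ^ (b * (L + 1)) → x / 2 ^ b < 2 ^ (b * L) := fun x hx =>
      Nat.div_lt_of_lt_mul (by rwa [← pow_add, show b + b * L = b * (L + 1) by ring])
    have h1 := ih (hdiv g hg) (hdiv h hh) fun i hi => (hb i hi).2
    have h2 : g % 2 ^ b = h % 2 ^ b := by
      apply Nat.eq_of_testBit_eq
      intro i
      rw [Nat.testBit_mod_two_pow, Nat.testBit_mod_two_pow]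
      by_cases hi : i < b
      · simp [(hb i hi).1]
      · simp [hi]
    rw [← Nat.div_add_mod g (2 ^ b), h1, h2, Nat.div_add_mod]

/-- A number of `B * L` bits as a tuple of `B` numbers of `L` bits. -/
def fields (B L : ℕ) (g : Fin (2 ^ (B * L))) : Fin B → Fin (2 ^ L) :=
  fun i => ⟨field B i L g, field_lt _ _ _ _⟩

/-- The fields determine the number, and both sides have `2 ^ (B * L)` elements. Surjectivity is
what provides gate addresses with prescribed fields. -/
theorem fields_bijective (B L : ℕ) : Function.Bijective (fields B L) := by
  refine (Fintype.bijective_iff_injective_and_card _).2 ⟨fun g h e => ?_, ?_⟩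
  · refine Fin.ext (eq_of_field_eq g.2 h.2 fun i hi => ?_)
    simpa [fields] using congrFun e ⟨i, hi⟩
  · simp [← pow_mul, mul_comm]

end ParKernel

namespace ParKernel

/-! ### A stack machine that runs automata on queries -/

namespace QueryMachine

/-- The stacks: the input, two pairs of stacks for the two addresses, and the output. -/
inductive Stack : Type
  | inp | a | b | c | d | out
  deriving DecidableEq

instance : Fintype Stack :=
  ⟨{.inp, .a, .b, .c, .d, .out}, fun x => by cases x <;> simp⟩

/-- The alphabets of the stacks. -/
abbrev Alph : Stack → Type
  | .out => Bool
  | _ => Option Bool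

/-- The labels of the machine for automata with state space `Q`. -/
inductive Label (Q : Type) : Type
  | readT (i : Fin 4) (t : Fin 8)
  | readU (t : Fin 8)
  | readV (t : Fin 8)
  | revU (t : Fin 8)
  | revV (t : Fin 8)
  | col (q : Q)
  | drainU (r : Bool)
  | drainV (r : Bool)
  deriving Fintype

variable {B : ℕ}

/-- The local variables: the last symbol seen, the last bit of the length, and two columns. -/
abbrev Var (B : ℕ) : Type := Option (Option Bool) × Bool × (Fin B → Bool) × (Fin B → Bool)

variable {Q : Type}

abbrev Stmt (B : ℕ) (Q : Type) : Type := Turing.TM2.Stmt Alph (Label Q) (Var B)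

open Turing.TM2.Stmt

/-- Pop a column of `b` bits from the stack of the first address. -/
def popU : ℕ → Stmt B Q → Stmt B Q
  | 0, s => s
  | b + 1, s => popU b (pop Stack.c (fun x (o : Option (Option Bool)) =>
      (x.1, x.2.1, fun i => if i.val = b then decide (o = some (some true)) else x.2.2.1 i, x.2.2.2)) s)

/-- Pop a column of `b` bits from the stack of the second address. -/
def popV : ℕ → Stmt B Q → Stmt B Q
  | 0, s => s
  | b + 1, s => popV b (pop Stack.d (fun x (o : Option (Option Bool)) =>
      (x.1, x.2.1, x.2.2.1, fun i => if i.val = b then decide (o = some (some true)) else x.2.2.2 i)) s)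

/-- The data of the machine: for each of the eight tables, the heights of the columns, and an
automaton. -/
structure Data (B : ℕ) where
  bu : Fin 8 → ℕ
  bv : Fin 8 → ℕ
  auto : Fin 8 → Automaton B

namespace Data

/-- The states of all automata. -/
abbrev State (D : Data B) : Type := Σ t : Fin 8, (D.auto t).State

/-- The step of the automata on the columns stored in the local variables. -/
def next (D : Data B) (q : D.State) (x : Var B) : D.State :=
  ⟨q.1, (D.auto q.1).step q.2 (fun i => decide (i.val < D.bu q.1) && x.2.2.1 i)
    (fun i => decide (i.val < D.bv q.1) && x.2.2.2 i) x.2.1⟩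

/-- Acceptance by the automata. -/
def accepts (D : Data B) (q : D.State) : Bool := (D.auto q.1).accept q.2

/-- The initial local variables. -/
def var₀ : Var B := (none, false, fun _ => false, fun _ => false)

/-- The program. -/
def program (D : Data B) : Label D.State → Stmt B D.State
  | .readT i t => pop Stack.inp (fun x o => (o, x.2)) (goto fun x =>
      match x.1 with
      | some (some e) => .readT (i + 1) (if e then t + Fin.ofNat 8 (2 ^ i.val) else t)
      | _ => .readU t)
  | .readU t => pop Stack.inp (fun x o => (o, x.2)) (branch (fun x => (x.1.bind id).isSome)
      (push Stack.a (fun x => x.1.bind id) (goto fun _ => .readU t)) (goto fun _ => .readV t))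
  | .readV t => pop Stack.inp (fun x o => (o, x.2)) (branch (fun x => (x.1.bind id).isSome)
      (push Stack.b (fun x => x.1.bind id) (goto fun _ => .readV t)) (goto fun _ => .revU t))
  | .revU t => pop Stack.a (fun x o => (o, x.2)) (branch (fun x => (x.1.bind id).isSome)
      (push Stack.c (fun x => x.1.bind id) (goto fun _ => .revU t)) (goto fun _ => .revV t))
  | .revV t => pop Stack.b (fun x o => (o, x.2)) (branch (fun x => (x.1.bind id).isSome)
      (push Stack.d (fun x => x.1.bind id) (goto fun _ => .revV t))
      (goto fun _ => .col ⟨t, (D.auto t).init⟩))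
  -- All pops of a column belong to one statement, so a column costs a single step. The bits of the
  -- length act as a clock: the last column is reached when `peek` finds the input stack empty.
  | .col q => popU (D.bu q.1) (popV (D.bv q.1) (pop Stack.inp
      (fun x (o : Option (Option Bool)) => (x.1, decide (o = some (some true)), x.2.2))
      (peek Stack.inp (fun x o => (o, x.2)) (goto fun x =>
        if x.1.isSome then .col (D.next q x) else
          .drainU (D.accepts (D.next q x))))))
  -- A symbol left over after the last column means that the address is too large for its columns,
  -- so the answer becomes `false`. Emptying the stacks is also required of a halting configuration.
  | .drainU r => pop Stack.c (fun x o => (o, x.2)) (goto fun x =>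
      if x.1.isSome then .drainU false else .drainV r)
  | .drainV r => pop Stack.d (fun x o => (o, x.2)) (branch (fun x => x.1.isSome)
      -- `Turing.haltList` demands that the local variables are back at their initial value.
      (goto fun _ => .drainV false) (push Stack.out (fun _ => r) (load (fun _ => var₀) halt)))

/-- The machine. -/
def machine (D : Data B) : Turing.FinTM2 :=
  have : ∀ t, Fintype (D.auto t).State := fun t => (D.auto t).fin
  have : Fintype (Alph Stack.inp) := inferInstanceAs (Fintype (Option Bool))
  { K := Stack
    k₀ := .inp
    k₁ := .out
    Γ := Alph
    Λ := Label D.State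
    main := .readT 0 0
    σ := Var B
    initialState := var₀
    m := D.program }

end Data

/-- The contents of the stacks. -/
def stk (i a b c d : List (Option Bool)) (o : List Bool) : ∀ k, List (Alph k)
  | .inp => i
  | .a => a
  | .b => b
  | .c => c
  | .d => d
  | .out => o

section

variable (i a b c d l : List (Option Bool)) (o : List Bool)

@[simp] theorem update_inp : Function.update (stk i a b c d o) .inp l = stk l a b c d o := by
  funext k; cases k <;> rfl
@[simp] theorem update_a : Function.update (stk i a b c d o) .a l = stk i l b c d o := by
  funext k; cases k <;> rfl
@[simp] theorem update_b : Function.update (stk i a b c d o) .b l = stk i a l c d o := by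
  funext k; cases k <;> rfl
@[simp] theorem update_c : Function.update (stk i a b c d o) .c l = stk i a b l d o := by
  funext k; cases k <;> rfl
@[simp] theorem update_d : Function.update (stk i a b c d o) .d l = stk i a b c l o := by
  funext k; cases k <;> rfl
@[simp] theorem update_out (l : List Bool) :
    Function.update (stk i a b c d o) .out l = stk i a b c d l := by
  funext k; cases k <;> rfl

end

/-- The configuration `y` is reached from `x` in exactly `m` steps. -/
def Steps (D : Data B) (x : D.machine.Cfg) (m : ℕ) (y : D.machine.Cfg) : Prop :=
  (flip bind D.machine.step)^[m] (some x) = some y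

variable {D : Data B}

theorem Steps.refl (x : D.machine.Cfg) : Steps D x 0 x := rfl

theorem Steps.trans {x y z : D.machine.Cfg} {m m' : ℕ} (h : Steps D x m y) (h' : Steps D y m' z) :
    Steps D x (m + m') z := by
  unfold Steps at *
  rw [add_comm, Function.iterate_add_apply, h, h']

theorem Steps.head {x y z : D.machine.Cfg} {m : ℕ} (h : D.machine.step x = some y)
    (h' : Steps D y m z) : Steps D x (m + 1) z := by
  unfold Steps at *
  rw [Function.iterate_succ_apply]
  change _^[m] (D.machine.step x) = _
  rw [h, h']

/-- Configurations. -/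
def cfg (D : Data B) (l : Label D.State) (x : Var B) (i a b c d : List (Option Bool)) :
    D.machine.Cfg :=
  ⟨some l, x, stk i a b c d []⟩

@[simp] theorem stk_inp (i a b c d : List (Option Bool)) (o : List Bool) :
    stk i a b c d o .inp = i := rfl
@[simp] theorem stk_c (i a b c d : List (Option Bool)) (o : List Bool) :
    stk i a b c d o .c = c := rfl
@[simp] theorem stk_d (i a b c d : List (Option Bool)) (o : List Bool) :
    stk i a b c d o .d = d := rfl

theorem step_cfg (l : Label D.State) (x : Var B) (i a b c d : List (Option Bool)) :
    D.machine.step (cfg D l x i a b c d) =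
      some (Turing.TM2.stepAux (D.program l) x (stk i a b c d [])) := rfl

theorem steps_readU (t : Fin 8) (w : List Bool) (x : Var B) (i a b c d : List (Option Bool)) :
    ∃ x', Steps D (cfg D (.readU t) x (w.map some ++ none :: i) a b c d) (w.length + 1)
      (cfg D (.readV t) x' i ((w.map some).reverse ++ a) b c d) := by
  induction w generalizing x a with
  | nil => exact ⟨_, Steps.head (by
      rw [step_cfg]; simp [Data.program]; rfl) (Steps.refl _)⟩
  | cons e w ih =>
    obtain ⟨x', h⟩ := ih (some (some e), x.2) (some e :: a)
    refine ⟨x', Steps.head (y := cfg D (.readU t) (some (some e), x.2) (w.map some ++ none :: i)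
      (some e :: a) b c d) ?_ ?_⟩
    · rw [step_cfg]; simp [Data.program]; rfl
    · simpa using h

theorem steps_readV (t : Fin 8) (w : List Bool) (x : Var B) (i a b c d : List (Option Bool)) :
    ∃ x', Steps D (cfg D (.readV t) x (w.map some ++ none :: i) a b c d) (w.length + 1)
      (cfg D (.revU t) x' i a ((w.map some).reverse ++ b) c d) := by
  induction w generalizing x b with
  | nil => exact ⟨_, Steps.head (by
      rw [step_cfg]; simp [Data.program]; rfl) (Steps.refl _)⟩
  | cons e w ih =>
    obtain ⟨x', h⟩ := ih (some (some e), x.2) (some e :: b)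
    refine ⟨x', Steps.head (y := cfg D (.readV t) (some (some e), x.2) (w.map some ++ none :: i)
      a (some e :: b) c d) ?_ ?_⟩
    · rw [step_cfg]; simp [Data.program]; rfl
    · simpa using h

theorem steps_revU (t : Fin 8) (w : List Bool) (x : Var B) (i b c d : List (Option Bool)) :
    ∃ x', Steps D (cfg D (.revU t) x i (w.map some) b c d) (w.length + 1)
      (cfg D (.revV t) x' i [] b ((w.map some).reverse ++ c) d) := by
  induction w generalizing x c with
  | nil => exact ⟨_, Steps.head (by
      rw [step_cfg]; simp [Data.program]; rfl) (Steps.refl _)⟩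
  | cons e w ih =>
    obtain ⟨x', h⟩ := ih (some (some e), x.2) (some e :: c)
    refine ⟨x', Steps.head (y := cfg D (.revU t) (some (some e), x.2) i (w.map some)
      b (some e :: c) d) ?_ ?_⟩
    · rw [step_cfg]; simp [Data.program]; rfl
    · simpa using h

theorem steps_revV (t : Fin 8) (w : List Bool) (x : Var B) (i a c d : List (Option Bool)) :
    ∃ x', Steps D (cfg D (.revV t) x i a (w.map some) c d) (w.length + 1)
      (cfg D (.col ⟨t, (D.auto t).init⟩) x' i a [] c ((w.map some).reverse ++ d)) := by
  induction w generalizing x d with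
  | nil => exact ⟨_, Steps.head (by
      rw [step_cfg]; simp [Data.program]; rfl) (Steps.refl _)⟩
  | cons e w ih =>
    obtain ⟨x', h⟩ := ih (some (some e), x.2) (some e :: d)
    refine ⟨x', Steps.head (y := cfg D (.revV t) (some (some e), x.2) i a (w.map some)
      c (some e :: d)) ?_ ?_⟩
    · rw [step_cfg]; simp [Data.program]; rfl
    · simpa using h

theorem steps_drainU (r : Bool) (w : List Bool) (x : Var B) (i a b d : List (Option Bool)) :
    ∃ x', Steps D (cfg D (.drainU r) x i a b (w.map some) d) (w.length + 1)
      (cfg D (.drainV (r && w.isEmpty)) x' i a b [] d) := by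
  induction w generalizing x r with
  | nil => exact ⟨_, Steps.head (by
      rw [step_cfg]; simp [Data.program]; rfl) (Steps.refl _)⟩
  | cons e w ih =>
    obtain ⟨x', h⟩ := ih false (some (some e), x.2)
    refine ⟨x', Steps.head (y := cfg D (.drainU false) (some (some e), x.2) i a b (w.map some)
      d) ?_ ?_⟩
    · rw [step_cfg]; simp [Data.program]; rfl
    · simpa using h

theorem steps_drainV (r : Bool) (w : List Bool) (x : Var B) :
    Steps D (cfg D (.drainV r) x [] [] [] [] (w.map some)) (w.length + 1)
      ⟨none, Data.var₀, stk [] [] [] [] [] [r && w.isEmpty]⟩ := by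
  induction w generalizing x r with
  | nil => exact Steps.head (by
      rw [step_cfg]; simp [Data.program]; rfl) (Steps.refl _)
  | cons e w ih =>
    have h := ih false (some (some e), x.2)
    refine Steps.head (y := cfg D (.drainV false) (some (some e), x.2) [] [] [] [] (w.map some)) ?_ ?_
    · rw [step_cfg]; simp [Data.program]; rfl
    · simpa using h

theorem steps_readT (t : Fin 8) (x : Var B) (i : List (Option Bool)) :
    ∃ x', Steps D (cfg D (.readT 0 0) x (bin t ++ none :: i) [] [] [] [])
      ((t : ℕ).bits.length + 1) (cfg D (.readU t) x' i [] [] [] []) := by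
  have e1 : ∀ (j : Fin 4) (u : Fin 8) (x : Var B) (e : Bool) (l : List (Option Bool)),
      D.machine.step (cfg D (.readT j u) x (some e :: l) [] [] [] []) = some (cfg D (.readT (j + 1)
        (if e then u + Fin.ofNat 8 (2 ^ j.val) else u)) (some (some e), x.2) l [] [] [] []) := by
    intro j u x e l
    rw [step_cfg]; simp [Data.program]; rfl
  have e2 : ∀ (j : Fin 4) (u : Fin 8) (x : Var B) (l : List (Option Bool)),
      D.machine.step (cfg D (.readT j u) x (none :: l) [] [] [] []) =
        some (cfg D (.readU u) (some none, x.2) l [] [] [] []) := by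
    intro j u x l
    rw [step_cfg]; simp [Data.program]; rfl
  fin_cases t
  · exact ⟨_, (Steps.refl _).head (e2 _ _ _ _)⟩
  · exact ⟨_, ((Steps.refl _).head (e2 _ _ _ _)).head (e1 _ _ _ _ _)⟩
  · exact ⟨_, (((Steps.refl _).head (e2 _ _ _ _)).head (e1 _ _ _ _ _)).head (e1 _ _ _ _ _)⟩
  · exact ⟨_, (((Steps.refl _).head (e2 _ _ _ _)).head (e1 _ _ _ _ _)).head (e1 _ _ _ _ _)⟩
  all_goals exact ⟨_, ((((Steps.refl _).head (e2 _ _ _ _)).head (e1 _ _ _ _ _)).head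
    (e1 _ _ _ _ _)).head (e1 _ _ _ _ _)⟩

theorem stepAux_popU (h : ℕ) (s : Stmt B D.State) (x : Var B) (i a b c d : List (Option Bool)) :
    Turing.TM2.stepAux (popU h s) x (stk i a b c d []) = Turing.TM2.stepAux s
      (x.1, x.2.1, fun j => if j.val < h then decide ((c)[j.val]? = some (some true)) else x.2.2.1 j,
        x.2.2.2) (stk i a b (c.drop h) d []) := by
  induction h generalizing s with
  | zero => simp [popU]
  | succ h ih =>
    rw [popU, ih, Turing.TM2.stepAux, update_c, stk_c, List.head?_drop, List.tail_drop]
    congr 4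
    funext j
    rcases lt_trichotomy j.val h with h1 | h1 | h1
    · simp [h1, h1.ne, Nat.lt_succ_of_lt h1]
    · simp [h1]
    · simp [h1.ne', not_lt.2 h1.le, show ¬ j.val < h + 1 by omega]

theorem stepAux_popV (h : ℕ) (s : Stmt B D.State) (x : Var B) (i a b c d : List (Option Bool)) :
    Turing.TM2.stepAux (popV h s) x (stk i a b c d []) = Turing.TM2.stepAux s
      (x.1, x.2.1, x.2.2.1,
        fun j => if j.val < h then decide (d[j.val]? = some (some true)) else x.2.2.2 j)
      (stk i a b c (d.drop h) []) := by
  induction h generalizing s with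
  | zero => simp [popV]
  | succ h ih =>
    rw [popV, ih, Turing.TM2.stepAux, update_d, stk_d, List.head?_drop, List.tail_drop]
    congr 4
    funext j
    rcases lt_trichotomy j.val h with h1 | h1 | h1
    · simp [h1, h1.ne, Nat.lt_succ_of_lt h1]
    · simp [h1]
    · simp [h1.ne', not_lt.2 h1.le, show ¬ j.val < h + 1 by omega]

theorem bits_drop (u h : ℕ) : u.bits.drop h = (u / 2 ^ h).bits := by
  induction h generalizing u with
  | zero => simp
  | succ h ih =>
    rw [← List.drop_drop, ih, List.drop_one, ← Nat.div2_bits_eq_tail, Nat.div2_val,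
      Nat.div_div_eq_div_mul, ← pow_succ]

theorem bits_getElem? (u j : ℕ) : u.bits[j]? = some true ↔ u.testBit j = true := by
  rw [Nat.testBit_eq_inth, List.getI_eq_getElem?_getD]
  cases u.bits[j]? <;> simp

theorem decide_map_bits (u j : ℕ) :
    decide ((u.bits.map some)[j]? = some (some true)) = u.testBit j := by
  rw [Bool.eq_iff_iff, decide_eq_true_iff, ← bits_getElem?, List.getElem?_map]
  cases u.bits[j]? <;> simp

theorem step_col (q : D.State) (x : Var B) (u v n : ℕ) :
    ∃ x', D.machine.step (cfg D (.col q) x (n.bits.map some) [] [] (u.bits.map some)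
      (v.bits.map some)) = some (cfg D (if n / 2 = 0 then
        .drainU ((D.auto q.1).accept ((D.auto q.1).step q.2 (column B (D.bu q.1) u)
          (column B (D.bv q.1) v) (n.testBit 0)))
        else .col ⟨q.1, (D.auto q.1).step q.2 (column B (D.bu q.1) u)
          (column B (D.bv q.1) v) (n.testBit 0)⟩) x' ((n / 2).bits.map some) [] []
          ((u / 2 ^ D.bu q.1).bits.map some) ((v / 2 ^ D.bv q.1).bits.map some)) := by
  rw [step_cfg]
  simp only [Data.program, stepAux_popU, stepAux_popV]
  simp only [Turing.TM2.stepAux, stk_inp, update_inp, List.head?_eq_getElem?, decide_map_bits,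
    ← List.map_drop, bits_drop]
  have e1 : (n.bits.map (some : Bool → Option Bool)).tail = (n / 2).bits.map some := by
    rw [← Nat.div2_val, Nat.div2_bits_eq_tail, List.map_tail]
  have e2 : ((n / 2).bits.map (some : Bool → Option Bool))[0]?.isSome = true ↔ ¬ n / 2 = 0 := by
    rw [← List.head?_eq_getElem?]
    rcases Nat.eq_zero_or_pos (n / 2) with h | h
    · simp [h]
    · obtain ⟨e, l, hl⟩ : ∃ e l, (n / 2).bits = e :: l := by
        cases h' : (n / 2).bits with
        | nil =>
          have : (n / 2).bits.length = (n / 2).size := Nat.size_eq_bits_len _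
          rw [h'] at this
          exact absurd (Nat.size_eq_zero.1 this.symm) h.ne'
        | cons e l => exact ⟨e, l, rfl⟩
      simp [hl, h.ne']
  have e3 : ∀ (b' w : ℕ) (f : Fin B → Bool),
      (fun j : Fin B => decide (j.val < b') && if j.val < b' then w.testBit j else f j) =
        column B b' w := by
    intro b' w f
    funext j
    by_cases h : j.val < b' <;> simp [column, h]
  simp only [Data.next, e3, e1, e2]
  by_cases h : n / 2 = 0
  · simp only [h, not_true_eq_false, if_true, if_false]; exact ⟨_, rfl⟩
  · simp only [h, not_false_eq_true, if_true, if_false]; exact ⟨_, rfl⟩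

/-- Induction on the number of columns. The number `0` has no bits but still gets one column, in
agreement with `Nat.log 2 0 + 1 = 1`; popping from the empty stack then reads the bit `0`. -/
theorem steps_col (L : ℕ) (t : Fin 8) (q : (D.auto t).State) (x : Var B) (u v n : ℕ)
    (hn : n.bits.length = L + 1 ∨ (L = 0 ∧ n = 0)) :
    ∃ x', Steps D (cfg D (.col ⟨t, q⟩) x (n.bits.map some) [] [] (u.bits.map some)
      (v.bits.map some)) (L + 1) (cfg D (.drainU ((D.auto t).accept ((D.auto t).run (D.bu t) (D.bv t)
        (L + 1) q u v n))) x' [] [] [] ((u / 2 ^ (D.bu t * (L + 1))).bits.map some)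
        ((v / 2 ^ (D.bv t * (L + 1))).bits.map some)) := by
  induction L generalizing q x u v n with
  | zero =>
    obtain ⟨x', h⟩ := step_col ⟨t, q⟩ x u v n
    have h0 : n / 2 = 0 := by
      rcases hn with hn | hn
      · rw [Nat.size_eq_bits_len, zero_add] at hn
        have := Nat.size_le.1 hn.le
        omega
      · simp [hn.2]
    rw [if_pos h0, h0] at h
    refine ⟨x', Steps.head h ?_⟩
    simp only [Automaton.run, zero_add, mul_one, Nat.zero_bits, List.map_nil]
    exact Steps.refl _
  | succ L ih =>
    obtain ⟨x₁, h⟩ := step_col ⟨t, q⟩ x u v n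
    have hn' : n.bits.length = L + 1 + 1 := by omega
    have h1 : (n / 2).bits.length = L + 1 := by
      rw [← Nat.div2_val, Nat.div2_bits_eq_tail, List.length_tail, hn', Nat.add_sub_cancel]
    have h0 : n / 2 ≠ 0 := by
      intro h0
      rw [h0] at h1
      simp at h1
    rw [if_neg h0] at h
    obtain ⟨x', h'⟩ := ih ((D.auto t).step q (column B (D.bu t) u) (column B (D.bv t) v)
      (n.testBit 0)) x₁ (u / 2 ^ D.bu t) (v / 2 ^ D.bv t) (n / 2) (Or.inl h1)
    refine ⟨x', Steps.head h ?_⟩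
    rw [Nat.div_div_eq_div_mul, Nat.div_div_eq_div_mul, ← pow_add, ← pow_add] at h'
    rw [show D.bu t * (L + 1 + 1) = D.bu t + D.bu t * (L + 1) by ring,
      show D.bv t * (L + 1 + 1) = D.bv t + D.bv t * (L + 1) by ring]
    exact h'

theorem bits_length_log (n : ℕ) : n.bits.length = Nat.log 2 n + 1 ∨ (Nat.log 2 n = 0 ∧ n = 0) := by
  rcases Nat.eq_zero_or_pos n with rfl | hn
  · simp
  · left
    rw [Nat.size_eq_bits_len]
    refine le_antisymm (Nat.size_le.2 (Nat.lt_pow_succ_log_self (by norm_num) n)) ?_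
    exact Nat.lt_size.2 (Nat.pow_log_le_self 2 hn.ne')

theorem bits_isEmpty_div (u m : ℕ) : (u / 2 ^ m).bits.isEmpty = decide (u < 2 ^ m) := by
  rw [Bool.eq_iff_iff, decide_eq_true_iff, List.isEmpty_iff, ← List.length_eq_zero_iff,
    Nat.size_eq_bits_len, Nat.size_eq_zero, Nat.div_eq_zero_iff]
  have := Nat.two_pow_pos m
  omega

theorem bits_div_length_le (u m : ℕ) : (u / 2 ^ m).bits.length ≤ u.bits.length := by
  rw [← bits_drop, List.length_drop]; omega

/-- Each address is walked through at most three times: reading, reversing, draining. The constant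
`11` consists of at most three bits of `t` and one extra step in each of the eight phases. -/
theorem outputs (D : Data B) (t : Fin 8) (u v n : ℕ) :
    ∃ m ≤ 11 + 3 * u.bits.length + 3 * v.bits.length + Nat.log 2 n,
      Steps D (cfg D (.readT 0 0) Data.var₀ (query t u v n) [] [] [] []) m
        ⟨none, Data.var₀, stk [] [] [] [] []
          [(D.auto t).accept ((D.auto t).run (D.bu t) (D.bv t) (Nat.log 2 n + 1) (D.auto t).init
            u v n) && decide (u < 2 ^ (D.bu t * (Nat.log 2 n + 1))) &&
            decide (v < 2 ^ (D.bv t * (Nat.log 2 n + 1)))]⟩ := by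
  have ht : (t : ℕ).bits.length ≤ 3 := by
    rw [Nat.size_eq_bits_len, Nat.size_le]; exact t.2
  obtain ⟨x1, h1⟩ := steps_readT (D := D) t Data.var₀ (bin u ++ none :: (bin v ++ none :: bin n))
  obtain ⟨x2, h2⟩ := steps_readU (D := D) t u.bits x1 (bin v ++ none :: bin n) [] [] [] []
  obtain ⟨x3, h3⟩ := steps_readV (D := D) t v.bits x2 (bin n)
    ((u.bits.map some).reverse ++ []) [] [] []
  obtain ⟨x4, h4⟩ := steps_revU (D := D) t u.bits.reverse x3 (bin n)
    ((v.bits.map some).reverse ++ []) [] []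
  obtain ⟨x5, h5⟩ := steps_revV (D := D) t v.bits.reverse x4 (bin n) []
    (u.bits.map some) []
  obtain ⟨x6, h6⟩ := steps_col (D := D) (Nat.log 2 n) t (D.auto t).init x5 u v n (bits_length_log n)
  obtain ⟨x7, h7⟩ := steps_drainU (D := D) ((D.auto t).accept ((D.auto t).run (D.bu t) (D.bv t)
    (Nat.log 2 n + 1) (D.auto t).init u v n)) (u / 2 ^ (D.bu t * (Nat.log 2 n + 1))).bits x6 [] [] []
    ((v / 2 ^ (D.bv t * (Nat.log 2 n + 1))).bits.map some)
  have h8 := steps_drainV (D := D) ((D.auto t).accept ((D.auto t).run (D.bu t) (D.bv t)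
    (Nat.log 2 n + 1) (D.auto t).init u v n) && (u / 2 ^ (D.bu t * (Nat.log 2 n + 1))).bits.isEmpty)
    (v / 2 ^ (D.bv t * (Nat.log 2 n + 1))).bits x7
  simp only [List.map_reverse, List.reverse_reverse, List.append_nil, List.length_reverse]
    at h2 h3 h4 h5
  rw [bits_isEmpty_div, bits_isEmpty_div] at h8
  rw [bits_isEmpty_div] at h7
  refine ⟨_, ?_, h1.trans (h2.trans (h3.trans (h4.trans (h5.trans (h6.trans (h7.trans h8))))))⟩
  have := bits_div_length_le u (D.bu t * (Nat.log 2 n + 1))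
  have := bits_div_length_le v (D.bv t * (Nat.log 2 n + 1))
  omega

theorem initList_eq (D : Data B) (w : List (Option Bool)) :
    Turing.initList D.machine w = cfg D (.readT 0 0) Data.var₀ w [] [] [] [] := by
  unfold Turing.initList cfg
  congr 1
  funext k
  cases k <;> rfl

theorem haltList_eq (D : Data B) (w : List Bool) :
    Turing.haltList D.machine w = ⟨none, Data.var₀, stk [] [] [] [] [] w⟩ := by
  unfold Turing.haltList
  congr 1
  funext k
  cases k <;> rfl

end QueryMachine

open QueryMachine in
/-- A family of circuits whose tables are recognized by finite automata is `DLOGTIME`-uniform. -/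
theorem dlogtimeUniform_of_recognizable {F : ∀ n, Circuit n} {b : ℕ} {bu bv : Fin 8 → ℕ}
    {P : Fin 8 → ℕ → ℕ → ℕ → ℕ → Prop} (hP : ∀ t, Recognizable (b + 1) (bu t) (bv t) (P t))
    (hsize : ∀ n, (F n).size ≤ 2 ^ ((b + 1) * (Nat.log 2 n + 1)))
    (hout : ∀ n, (F n).outLen ≤ 2 ^ ((b + 1) * (Nat.log 2 n + 1)))
    (hF : ∀ n t u v, u < 2 ^ ((b + 1) * (Nat.log 2 n + 1)) →
      v < 2 ^ ((b + 1) * (Nat.log 2 n + 1)) → ((F n).tableBit t u v ↔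
        P t (Nat.log 2 n + 1) u v n ∧ u < 2 ^ (bu t * (Nat.log 2 n + 1)) ∧
          v < 2 ^ (bv t * (Nat.log 2 n + 1)))) : DlogtimeUniform F := by
  classical
  choose A hA using hP
  let D : Data (b + 1) := ⟨bu, bv, A⟩
  -- With `ℓ = Nat.log 2 n + 1`, six passes over at most `(b + 1) * ℓ` bits cost `6 * (b + 1) * ℓ`,
  -- and `14 * ℓ` more steps cover `11 + Nat.log 2 n`.
  refine ⟨⟨D.machine, Equiv.refl _, Equiv.refl _⟩, b, 6 * b + 20, fun n =>
    ⟨hsize n, hout n, fun t u v hu hv => ?_⟩⟩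
  obtain ⟨m, hm, h⟩ := outputs D t u v n
  have hlen : ∀ w, w < 2 ^ ((b + 1) * (Nat.log 2 n + 1)) →
      w.bits.length ≤ (b + 1) * (Nat.log 2 n + 1) := fun w hw => by
    rw [Nat.size_eq_bits_len]; exact Nat.size_le.2 hw
  refine ⟨⟨⟨m, ?_⟩, ?_⟩⟩
  · have e2 : decide ((F n).tableBit t u v) = ((A t).accept ((A t).run (bu t) (bv t)
        (Nat.log 2 n + 1) (A t).init u v n) && decide (u < 2 ^ (bu t * (Nat.log 2 n + 1))) &&
            decide (v < 2 ^ (bv t * (Nat.log 2 n + 1)))) := by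
      rw [Bool.eq_iff_iff, decide_eq_true_iff, hF n t u v hu hv, ← hA]
      simp [and_assoc]
    have e3 : Turing.initList D.machine ((query t u v n).map (Equiv.refl (Option Bool)).invFun) =
        cfg D (.readT 0 0) Data.var₀ (query t u v n) [] [] [] [] :=
      (initList_eq D _).trans (congrArg (fun w => cfg D (.readT 0 0) Data.var₀ w [] [] [] [])
        (List.map_id _))
    refine (congrArg (fun z => (flip bind D.machine.step)^[m] (some z)) e3).trans (Eq.trans (show _ = some _ from h) ?_)
    refine congrArg some (Eq.symm ((haltList_eq D _).trans ?_))
    rw [e2]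
    rfl
  · have h1 := hlen u hu
    have h2 := hlen v hv
    have h3 : (6 * b + 20) * (Nat.log 2 n + 1) =
      6 * ((b + 1) * (Nat.log 2 n + 1)) + 14 * (Nat.log 2 n + 1) := by ring
    change m ≤ (6 * b + 20) * (Nat.log 2 n + 1)
    rw [h3]
    omega

end ParKernel

namespace ParKernel

/-! ### First-order formulas with counting -/

/-- Formulas with variables indexed by numbers.  The variables range over numbers of
`⌊log₂ n⌋ + 1` bits, where `n` is the length of the word; `count y φ z` states that there are at
least `z` many values for the pair of variables `y`, `y + 1` such that `φ`. -/
inductive Fml : Type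
  | inp (z : ℕ)
  | lt (x y : ℕ)
  | ltLen (x : ℕ)
  | not (φ : Fml)
  | and (φ ψ : Fml)
  | ex (y : ℕ) (φ : Fml)
  | count (y : ℕ) (φ : Fml) (z : ℕ)

/-- The number of bits of the length of a word, where zero is given one bit. -/
def bitLen (n : ℕ) : ℕ := Nat.log 2 n + 1

theorem lt_two_pow_bitLen (n : ℕ) : n < 2 ^ bitLen n := Nat.lt_pow_succ_log_self (by norm_num) n

namespace Fml

/-- The truth value of a formula on a word `w` under an assignment. -/
def eval (w : List Bool) : Fml → (ℕ → ℕ) → Prop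
  | inp z, a => w[a z]? = some true
  | lt x y, a => a x < a y
  | ltLen x, a => a x < w.length
  | not φ, a => ¬ φ.eval w a
  | and φ ψ, a => φ.eval w a ∧ ψ.eval w a
  | ex y φ, a => ∃ c < 2 ^ bitLen w.length, φ.eval w (Function.update a y c)
  | count y φ z, a => a z ≤ Nat.card {p : ℕ × ℕ // p.1 < 2 ^ bitLen w.length ∧
      p.2 < 2 ^ bitLen w.length ∧
      φ.eval w (Function.update (Function.update a y p.1) (y + 1) p.2)}

/-- A strict bound for the variables of a formula. -/
def bound : Fml → ℕ
  | inp z => z + 1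
  | lt x y => max x y + 1
  | ltLen x => x + 1
  | not φ => φ.bound
  | and φ ψ => max φ.bound ψ.bound
  | ex y φ => max (y + 1) φ.bound
  | count y φ z => max (max (y + 2) (z + 1)) φ.bound

/-- The size of a formula. -/
def size : Fml → ℕ
  | inp _ => 0
  | lt _ _ => 0
  | ltLen _ => 0
  | not φ => φ.size + 1
  | and φ ψ => φ.size + ψ.size + 1
  | ex _ φ => φ.size + 1
  | count _ φ _ => φ.size + 1

/-- `χ` is an immediate subformula of `ψ`. -/
def Child (χ : Fml) : Fml → Prop
  | not φ => χ = φ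
  | and φ ψ => χ = φ ∨ χ = ψ
  | ex _ φ => χ = φ
  | count _ φ _ => χ = φ
  | _ => False

/-- The variables bound by the outermost symbol. -/
def Binds (i : ℕ) : Fml → Prop
  | ex y _ => i = y
  | count y _ _ => i = y ∨ i = y + 1
  | _ => False

/-- The set of subformulas. -/
def sub : Fml → Set Fml
  | not φ => insert (not φ) φ.sub
  | and φ ψ => insert (and φ ψ) (φ.sub ∪ ψ.sub)
  | ex y φ => insert (ex y φ) φ.sub
  | count y φ z => insert (count y φ z) φ.sub
  | φ => {φ}

theorem self_mem_sub (φ : Fml) : φ ∈ φ.sub := by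
  cases φ <;> simp [sub]

theorem finite_sub (φ : Fml) : φ.sub.Finite := by
  induction φ <;> simp_all [sub]

theorem Child.mem_sub {χ ψ φ : Fml} (h : χ.Child ψ) (hψ : ψ ∈ φ.sub) : χ ∈ φ.sub := by
  induction φ with
  | inp z => simp only [sub, Set.mem_singleton_iff] at hψ; subst hψ; exact h.elim
  | lt x y => simp only [sub, Set.mem_singleton_iff] at hψ; subst hψ; exact h.elim
  | ltLen x => simp only [sub, Set.mem_singleton_iff] at hψ; subst hψ; exact h.elim
  | not φ ih =>
    rcases hψ with rfl | hψ
    · simp only [Child] at h; subst h; exact Or.inr (self_mem_sub _)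
    · exact Or.inr (ih hψ)
  | and φ φ' ih ih' =>
    rcases hψ with rfl | hψ | hψ
    · rcases h with rfl | rfl
      · exact Or.inr (Or.inl (self_mem_sub _))
      · exact Or.inr (Or.inr (self_mem_sub _))
    · exact Or.inr (Or.inl (ih hψ))
    · exact Or.inr (Or.inr (ih' hψ))
  | ex y φ ih =>
    rcases hψ with rfl | hψ
    · simp only [Child] at h; subst h; exact Or.inr (self_mem_sub _)
    · exact Or.inr (ih hψ)
  | count y φ z ih =>
    rcases hψ with rfl | hψ
    · simp only [Child] at h; subst h; exact Or.inr (self_mem_sub _)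
    · exact Or.inr (ih hψ)

theorem Child.size_lt {χ ψ : Fml} (h : χ.Child ψ) : χ.size < ψ.size := by
  cases ψ <;> simp only [Child] at h <;> simp only [size]
  case and => rcases h with rfl | rfl <;> omega
  all_goals subst h; omega

theorem size_le_of_mem_sub {ψ φ : Fml} (h : ψ ∈ φ.sub) : ψ.size ≤ φ.size := by
  induction φ with
  | inp z => simp only [sub, Set.mem_singleton_iff] at h; subst h; rfl
  | lt x y => simp only [sub, Set.mem_singleton_iff] at h; subst h; rfl
  | ltLen x => simp only [sub, Set.mem_singleton_iff] at h; subst h; rfl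
  | not φ ih =>
    rcases h with rfl | h
    · rfl
    · have := ih h; simp only [size]; omega
  | and φ φ' ih ih' =>
    rcases h with rfl | h | h
    · rfl
    · have := ih h; simp only [size]; omega
    · have := ih' h; simp only [size]; omega
  | ex y φ ih =>
    rcases h with rfl | h
    · rfl
    · have := ih h; simp only [size]; omega
  | count y φ z ih =>
    rcases h with rfl | h
    · rfl
    · have := ih h; simp only [size]; omega

theorem bound_le_of_mem_sub {ψ φ : Fml} (h : ψ ∈ φ.sub) : ψ.bound ≤ φ.bound := by
  induction φ with
  | inp z => simp only [sub, Set.mem_singleton_iff] at h; subst h; rfl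
  | lt x y => simp only [sub, Set.mem_singleton_iff] at h; subst h; rfl
  | ltLen x => simp only [sub, Set.mem_singleton_iff] at h; subst h; rfl
  | not φ ih =>
    rcases h with rfl | h
    · rfl
    · exact ih h
  | and φ φ' ih ih' =>
    rcases h with rfl | h | h
    · rfl
    · exact (ih h).trans (le_max_left _ _)
    · exact (ih' h).trans (le_max_right _ _)
  | ex y φ ih =>
    rcases h with rfl | h
    · rfl
    · exact (ih h).trans (le_max_right _ _)
  | count y φ z ih =>
    rcases h with rfl | h
    · rfl
    · exact (ih h).trans (le_max_right _ _)

theorem eval_congr (w : List Bool) (φ : Fml) {a a' : ℕ → ℕ} (h : ∀ i < φ.bound, a i = a' i) :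
    φ.eval w a ↔ φ.eval w a' := by
  induction φ generalizing a a' with
  | inp z => simp only [eval, h z (Nat.lt_succ_self z)]
  | lt x y => simp only [eval, h x (by simp only [bound]; omega), h y (by simp only [bound]; omega)]
  | ltLen x => simp only [eval, h x (Nat.lt_succ_self x)]
  | not φ ih => simp only [eval, ih h]
  | and φ ψ ih ih' =>
    simp only [eval, ih fun i hi => h i (lt_of_lt_of_le hi (le_max_left _ _)),
      ih' fun i hi => h i (lt_of_lt_of_le hi (le_max_right _ _))]
  | ex y φ ih =>
    simp only [eval]
    refine exists_congr fun c => and_congr_right fun _ => ih fun i hi => ?_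
    by_cases e : i = y
    · subst e; simp
    · simp only [Function.update_of_ne e]
      exact h i (lt_of_lt_of_le hi (le_max_right _ _))
  | count y φ z ih =>
    have hz : a z = a' z := h z (by simp only [bound]; omega)
    have : ∀ p : ℕ × ℕ, φ.eval w (Function.update (Function.update a y p.1) (y + 1) p.2) ↔
        φ.eval w (Function.update (Function.update a' y p.1) (y + 1) p.2) := fun p =>
      ih fun i hi => by
        by_cases e : i = y + 1
        · subst e; simp
        · simp only [Function.update_of_ne e]
          by_cases e' : i = y
          · subst e'; simp
          · simp only [Function.update_of_ne e']
            exact h i (lt_of_lt_of_le hi (le_max_right _ _))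
    simp only [eval, hz, this]

/-! ### Circuits for formulas -/

/-- The subformulas as a type. -/
abbrev Node (φ : Fml) : Type := {ψ : Fml // ψ ∈ φ.sub}

instance (φ : Fml) : Finite φ.Node := φ.finite_sub

/-- A numbering of the subformulas. -/
noncomputable def code (φ : Fml) : φ.Node ≃ Fin (Nat.card φ.Node) := Finite.equivFin _

/-- The number of fields of the addresses of gates, besides the first one. -/
noncomputable def width (φ : Fml) : ℕ := φ.bound + Nat.card φ.Node

/-- The number `g` is the address of a gate for the subformula `ψ`. -/
def IsGate (φ : Fml) (L g : ℕ) (ψ : φ.Node) : Prop :=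
  ∀ i : Fin (Nat.card φ.Node),
    field (φ.width + 1) (φ.bound + 1 + i) L g = (decide (φ.code ψ = i)).toNat

/-- The assignment in an address. -/
noncomputable def env (φ : Fml) (L g : ℕ) (i : ℕ) : ℕ := field (φ.width + 1) i L g

variable {φ : Fml} {L : ℕ}

/-- The code is one-hot, so the field of index `φ.code ψ` already distinguishes `ψ` from every other
subformula. -/
theorem IsGate.unique {g : ℕ} {ψ ψ' : φ.Node} (h : φ.IsGate L g ψ) (h' : φ.IsGate L g ψ') :
    ψ = ψ' := by
  have e := h (φ.code ψ)
  rw [h' (φ.code ψ)] at e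
  rw [decide_eq_true (rfl : φ.code ψ = φ.code ψ), Bool.toNat_true, Bool.toNat_eq_one,
    decide_eq_true_iff] at e
  exact (φ.code.injective e).symm

/-- An address has no fields other than those of the variables and those of the code of the
subformula. -/
theorem IsGate.eq {g g' : Fin (2 ^ ((φ.width + 1) * L))} {ψ : φ.Node} (h : φ.IsGate L g ψ)
    (h' : φ.IsGate L g' ψ) (he : ∀ i ≤ φ.bound, φ.env L g i = φ.env L g' i) : g = g' := by
  refine Fin.ext (eq_of_field_eq g.2 g'.2 fun i hi => ?_)
  by_cases hb : i ≤ φ.bound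
  · exact he i hb
  · obtain ⟨j, rfl⟩ := Nat.exists_eq_add_of_lt (not_le.1 hb)
    have hj : j < Nat.card φ.Node := by unfold width at hi; omega
    have e := h ⟨j, hj⟩
    rw [← h' ⟨j, hj⟩] at e
    rwa [show φ.bound + 1 + j = φ.bound + j + 1 by ring] at e

/-- Fields can be prescribed independently of each other by `fields_bijective`; `0 < L` leaves room
for the bit `1` of the code. -/
theorem exists_isGate (hL : 0 < L) (ψ : φ.Node) (f : ℕ → ℕ) (hf : ∀ i ≤ φ.bound, f i < 2 ^ L) :
    ∃ g : Fin (2 ^ ((φ.width + 1) * L)), φ.IsGate L g ψ ∧ ∀ i ≤ φ.bound, φ.env L g i = f i := by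
  have h1 : 1 < 2 ^ L := Nat.one_lt_two_pow hL.ne'
  let c (i : ℕ) : ℕ := if h : i - (φ.bound + 1) < Nat.card φ.Node then
    (decide (φ.code ψ = ⟨i - (φ.bound + 1), h⟩)).toNat else 0
  have hc : ∀ i, c i < 2 ^ L := fun i => by
    simp only [c]
    split_ifs
    · exact (Bool.toNat_le _).trans_lt h1
    · omega
  obtain ⟨g, hg⟩ := (fields_bijective (φ.width + 1) L).2 fun i =>
    if h : i.val ≤ φ.bound then ⟨f i, hf i h⟩ else ⟨c i, hc i⟩
  have hg' : ∀ i < φ.width + 1, field (φ.width + 1) i L g = if i ≤ φ.bound then f i else c i := by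
    intro i hi
    have e := congrArg Fin.val (congrFun hg ⟨i, hi⟩)
    simp only [fields] at e
    rw [e]
    split_ifs <;> rfl
  refine ⟨g, fun i => ?_, fun i hi => ?_⟩
  · rw [hg' _ (by unfold width; omega), if_neg (by omega)]
    have hi : φ.bound + 1 + i.val - (φ.bound + 1) = i.val := by omega
    simp only [c, hi, i.2, dif_pos]
  · rw [env, hg' i (by unfold width; omega), if_pos hi]

open Classical in
/-- The subformula of a gate. -/
noncomputable def label (φ : Fml) (L g : ℕ) : Option φ.Node :=
  if h : ∃ ψ, φ.IsGate L g ψ then some h.choose else none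

theorem label_eq_some {g : ℕ} {ψ : φ.Node} : φ.label L g = some ψ ↔ φ.IsGate L g ψ := by
  unfold label
  split_ifs with h
  · rw [Option.some_inj]
    exact ⟨fun e => e ▸ h.choose_spec, fun h' => h.choose_spec.unique h'⟩
  · exact ⟨fun e => by simp at e, fun h' => absurd ⟨ψ, h'⟩ h⟩

open Classical in
/-- The kind of a gate for a formula under an assignment. -/
noncomputable def kindOf (n : ℕ) (f : ℕ → ℕ) : Fml → GateKind n
  -- Atomic formulas get no wires: an `or` gate without wires is false and an `and` gate without
  -- wires is true.
  | inp z => if h : f z < n then GateKind.input ⟨f z, h⟩ else GateKind.or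
  | lt x y => if f x < f y then GateKind.and else GateKind.or
  | ltLen x => if f x < n then GateKind.and else GateKind.or
  | not _ => GateKind.not
  | and _ _ => GateKind.and
  | ex _ _ => GateKind.or
  | count _ _ z => GateKind.thr (f z)

/-- The kind of the gate with address `g`. -/
noncomputable def gateKind (φ : Fml) (n g : ℕ) : GateKind n :=
  match φ.label (bitLen n) g with
  | some ψ => kindOf n (φ.env (bitLen n) g) ψ
  | none => GateKind.or

/-- The wires between the gates with addresses `g'` and `g`. -/
def Wire (φ : Fml) (L g' g : ℕ) : Prop :=
  ∃ ψ' ψ : φ.Node, φ.IsGate L g' ψ' ∧ φ.IsGate L g ψ ∧ ψ'.1.Child ψ.1 ∧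
    ∀ i ≤ φ.bound, ¬ ψ.1.Binds i → φ.env L g' i = φ.env L g i

/-- The rank of a gate: the size of its subformula. -/
noncomputable def rank (φ : Fml) (L g : ℕ) : ℕ :=
  match φ.label L g with
  | some ψ => ψ.1.size
  | none => 0

theorem rank_le (φ : Fml) (L g : ℕ) : φ.rank L g ≤ φ.size := by
  unfold rank
  split
  · exact size_le_of_mem_sub (Subtype.prop _)
  · omega

theorem Wire.rank_lt {g' g : ℕ} (h : φ.Wire L g' g) : φ.rank L g' < φ.rank L g := by
  obtain ⟨ψ', ψ, h', h, hc, _⟩ := h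
  rw [rank, rank, label_eq_some.2 h, label_eq_some.2 h']
  exact hc.size_lt

theorem bitLen_pos (n : ℕ) : 0 < bitLen n := Nat.succ_pos _

theorem exists_output_gate (φ : Fml) (n : ℕ) (ψ : φ.Node) (p : Fin n) :
    ∃ g : Fin (2 ^ ((φ.width + 1) * bitLen n)), φ.IsGate (bitLen n) g ψ ∧
      ∀ i ≤ φ.bound, φ.env (bitLen n) g i = if i = 0 then p.val else 0 :=
  exists_isGate (bitLen_pos n) ψ _ fun i _ => by
    have := lt_two_pow_bitLen n
    split_ifs <;> omega

/-- The circuit for the formulas `φ` and `ψ`, which describe the length and the bits of the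
output. -/
noncomputable def circuit (φ ψ : Fml) (n : ℕ) : Circuit n where
  size := 2 ^ (((and φ ψ).width + 1) * bitLen n)
  kind g := (and φ ψ).gateKind n g
  wire g' g := (and φ ψ).Wire (bitLen n) g' g
  acyclic := Subrelation.wf (r := InvImage (· < ·)
    fun g : Fin (2 ^ (((and φ ψ).width + 1) * bitLen n)) => (and φ ψ).rank (bitLen n) g)
    (fun h => h.rank_lt) (InvImage.wf _ Nat.lt_wfRel.wf)
  input_fanin := by
    rintro g i hk g' ⟨χ', χ, h', h, hc, -⟩
    rw [gateKind, label_eq_some.2 h] at hk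
    obtain ⟨χ, hχ⟩ := χ
    cases χ <;> simp only [Child] at hc <;> simp [kindOf] at hk
  not_fanin := by
    intro g hk
    rw [gateKind] at hk
    split at hk
    · rename_i χ hχ
      rw [label_eq_some] at hχ
      obtain ⟨χ, hs⟩ := χ
      cases χ with
      | not χ =>
        have hs' : χ ∈ (and φ ψ).sub := Child.mem_sub (ψ := not χ) (by simp [Child]) hs
        obtain ⟨g', hg', he⟩ := exists_isGate (bitLen_pos n) ⟨χ, hs'⟩
          ((and φ ψ).env (bitLen n) g) fun i _ => field_lt _ _ _ _
        refine ⟨g', ⟨_, _, hg', hχ, by simp [Child], fun i hi _ => he i hi⟩, ?_⟩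
        rintro g'' ⟨χ₁, χ₂, h₁, h₂, hc, he'⟩
        obtain rfl := h₂.unique hχ
        obtain rfl : χ₁ = ⟨χ, hs'⟩ := Subtype.ext hc
        exact h₁.eq hg' fun i hi => (he' i hi (by simp [Binds])).trans (he i hi).symm
      | inp z => simp only [kindOf] at hk; split_ifs at hk
      | lt x y => simp only [kindOf] at hk; split_ifs at hk
      | ltLen x => simp only [kindOf] at hk; split_ifs at hk
      | and _ _ => simp [kindOf] at hk
      | ex _ _ => simp [kindOf] at hk
      | count _ _ _ => simp [kindOf] at hk
    · simp at hk
  -- One output position per input position suffices, since the encoding of the kernel is not longer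
  -- than the input.
  outLen := n
  outPresent p := (exists_output_gate (and φ ψ) n ⟨φ, by simp [sub, self_mem_sub]⟩ p).choose
  outBit p := (exists_output_gate (and φ ψ) n ⟨ψ, by simp [sub, self_mem_sub]⟩ p).choose

end Fml

theorem Circuit.value_iff {n : ℕ} (C : Circuit n) (x : Fin n → Bool) (g : Fin C.size) :
    C.value x g ↔ match C.kind g with
      | GateKind.input i => x i = true
      | GateKind.not => ∀ h, C.wire h g → ¬ C.value x h
      | GateKind.and => ∀ h, C.wire h g → C.value x h
      | GateKind.or => ∃ h, C.wire h g ∧ C.value x h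
      | GateKind.thr t => t ≤ Nat.card {h : Fin C.size // C.wire h g ∧ C.value x h} := by
  unfold Circuit.value
  rw [WellFounded.fix_eq]
  cases C.kind g <;> simp

namespace Fml

variable {φ ψ : Fml}

theorem circuit_kind {n : ℕ} {χ : (and φ ψ).Node} {g : Fin (circuit φ ψ n).size}
    (hg : (and φ ψ).IsGate (bitLen n) g χ) :
    (circuit φ ψ n).kind g = kindOf n ((and φ ψ).env (bitLen n) g) χ := by
  change (and φ ψ).gateKind n g = _
  rw [gateKind, label_eq_some.2 hg]

theorem circuit_wire {n : ℕ} {χ : (and φ ψ).Node} {g : Fin (circuit φ ψ n).size}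
    (hg : (and φ ψ).IsGate (bitLen n) g χ) (g' : Fin (circuit φ ψ n).size) :
    (circuit φ ψ n).wire g' g ↔ ∃ χ' : (and φ ψ).Node, (and φ ψ).IsGate (bitLen n) g' χ' ∧
      χ'.1.Child χ.1 ∧ ∀ i ≤ (and φ ψ).bound, ¬ χ.1.Binds i →
        (and φ ψ).env (bitLen n) g' i = (and φ ψ).env (bitLen n) g i := by
  constructor
  · rintro ⟨χ', χ₂, h1, h2, h3, h4⟩
    obtain rfl := h2.unique hg
    exact ⟨χ', h1, h3, h4⟩
  · rintro ⟨χ', h1, h3, h4⟩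
    exact ⟨χ', _, h1, hg, h3, h4⟩

/-- The value of a gate is the truth value of its subformula. -/
theorem circuit_value (w : List Bool) (χ : Fml) (hχ : χ ∈ (and φ ψ).sub)
    (g : Fin (circuit φ ψ w.length).size)
    (hg : (and φ ψ).IsGate (bitLen w.length) g ⟨χ, hχ⟩) :
    (circuit φ ψ w.length).value w.get g ↔ χ.eval w ((and φ ψ).env (bitLen w.length) g) := by
  have hlt : ∀ (g : ℕ) i, (and φ ψ).env (bitLen w.length) g i < 2 ^ bitLen w.length :=
    fun g i => field_lt _ _ _ _
  have key : ∀ (χ' : Fml) (a a' : ℕ → ℕ), χ' ∈ (and φ ψ).sub →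
      (∀ i ≤ (and φ ψ).bound, a i = a' i) → (χ'.eval w a ↔ χ'.eval w a') := fun χ' a a' h e =>
    eval_congr w χ' fun i hi => e i (hi.le.trans (bound_le_of_mem_sub h))
  induction χ generalizing g with
  | inp z =>
    have hw := circuit_wire hg
    have hk : (circuit φ ψ w.length).kind g = _ := circuit_kind hg
    rw [Circuit.value_iff, hk]
    simp only [kindOf, eval]
    by_cases h : (and φ ψ).env (bitLen w.length) g z < w.length
    · simp [h]
    · simp only [h, dif_neg, not_false_eq_true]
      rw [List.getElem?_eq_none (not_lt.1 h)]
      simp only [reduceCtorEq, iff_false, not_exists, not_and]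
      intro g' h'
      obtain ⟨χ', -, h', -⟩ := (hw g').1 h'
      exact h'.elim
  | lt x y =>
    have h0 : ∀ g', ¬ (circuit φ ψ w.length).wire g' g := fun g' h' => by
      obtain ⟨χ', -, h', -⟩ := (circuit_wire hg g').1 h'
      exact h'.elim
    rw [Circuit.value_iff, circuit_kind hg]
    simp only [kindOf, eval]
    split_ifs with h <;> simp [h, h0]
  | ltLen x =>
    have h0 : ∀ g', ¬ (circuit φ ψ w.length).wire g' g := fun g' h' => by
      obtain ⟨χ', -, h', -⟩ := (circuit_wire hg g').1 h'
      exact h'.elim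
    rw [Circuit.value_iff, circuit_kind hg]
    simp only [kindOf, eval]
    split_ifs with h <;> simp [h, h0]
  | not χ ih =>
    have hs : χ ∈ (and φ ψ).sub := Child.mem_sub (ψ := not χ) (by simp [Child]) hχ
    have hw := circuit_wire hg
    rw [Circuit.value_iff, circuit_kind hg]
    simp only [kindOf, eval]
    constructor
    · intro h
      obtain ⟨g', hg', he⟩ := exists_isGate (bitLen_pos w.length) ⟨χ, hs⟩ _ fun i _ => hlt g i
      have h1 := h g' ((hw g').2 ⟨_, hg', by simp [Child], fun i hi _ => he i hi⟩)
      exact fun h2 => h1 ((ih hs g' hg').2 ((key χ _ _ hs he).2 h2))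
    · rintro h g' h'
      obtain ⟨⟨χ', h'χ⟩, hg', hc, he⟩ := (hw g').1 h'
      obtain rfl : χ' = χ := hc
      exact fun h2 => h ((key χ' _ _ hs fun i hi => he i hi (by simp [Binds])).1 ((ih hs g' hg').1 h2))
  | and χ χ' ih ih' =>
    have hs : χ ∈ (and φ ψ).sub := Child.mem_sub (ψ := and χ χ') (by simp [Child]) hχ
    have hs' : χ' ∈ (and φ ψ).sub := Child.mem_sub (ψ := and χ χ') (by simp [Child]) hχ
    have hw := circuit_wire hg
    rw [Circuit.value_iff, circuit_kind hg]
    simp only [kindOf, eval]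
    constructor
    · intro h
      obtain ⟨g₁, hg₁, he₁⟩ := exists_isGate (bitLen_pos w.length) ⟨χ, hs⟩ _ fun i _ => hlt g i
      obtain ⟨g₂, hg₂, he₂⟩ := exists_isGate (bitLen_pos w.length) ⟨χ', hs'⟩ _ fun i _ => hlt g i
      have h1 := h g₁ ((hw g₁).2 ⟨_, hg₁, by simp [Child], fun i hi _ => he₁ i hi⟩)
      have h2 := h g₂ ((hw g₂).2 ⟨_, hg₂, by simp [Child], fun i hi _ => he₂ i hi⟩)
      exact ⟨(key χ _ _ hs he₁).1 ((ih hs g₁ hg₁).1 h1),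
        (key χ' _ _ hs' he₂).1 ((ih' hs' g₂ hg₂).1 h2)⟩
    · rintro h g' h'
      obtain ⟨⟨χ₁, h₁⟩, hg', hc, he⟩ := (hw g').1 h'
      rcases hc with hc | hc <;> simp only at hc <;> subst hc
      · exact (ih hs g' hg').2 ((key χ₁ _ _ hs fun i hi => he i hi (by simp [Binds])).2 h.1)
      · exact (ih' hs' g' hg').2 ((key χ₁ _ _ hs' fun i hi => he i hi (by simp [Binds])).2 h.2)
  | ex y χ ih =>
    have hs : χ ∈ (and φ ψ).sub := Child.mem_sub (ψ := ex y χ) (by simp [Child]) hχ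
    have hw := circuit_wire hg
    have hy : y ≤ (and φ ψ).bound := by
      have := bound_le_of_mem_sub hχ
      simp only [bound] at this ⊢
      omega
    rw [Circuit.value_iff, circuit_kind hg]
    simp only [kindOf, eval]
    constructor
    · rintro ⟨g', h', hv⟩
      obtain ⟨⟨χ', h'χ⟩, hg', hc, he⟩ := (hw g').1 h'
      obtain rfl : χ' = χ := hc
      replace hv := (ih hs g' hg').1 hv
      refine ⟨(and φ ψ).env (bitLen w.length) g' y, hlt _ _, (key χ' _ _ hs fun i hi => ?_).1 hv⟩
      by_cases e : i = y
      · subst e; simp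
      · rw [Function.update_of_ne e]
        exact he i hi (by simpa [Binds] using e)
    · rintro ⟨c, hc, h⟩
      obtain ⟨g', hg', he⟩ := exists_isGate (bitLen_pos w.length) ⟨χ, hs⟩
        (Function.update ((and φ ψ).env (bitLen w.length) g) y c) fun i _ => by
          by_cases e : i = y
          · subst e; simpa using hc
          · rw [Function.update_of_ne e]; exact hlt _ _
      refine ⟨g', (hw g').2 ⟨_, hg', by simp [Child], fun i hi hb => ?_⟩, ?_⟩
      · rw [he i hi, Function.update_of_ne (by simpa [Binds] using hb)]
      · exact (ih hs g' hg').2 ((key χ _ _ hs he).2 h)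
  | count y χ z ih =>
    have hs : χ ∈ (and φ ψ).sub := Child.mem_sub (ψ := count y χ z) (by simp [Child]) hχ
    have hw := circuit_wire hg
    have hy : y + 1 ≤ (and φ ψ).bound := by
      have := bound_le_of_mem_sub hχ
      simp only [bound] at this ⊢
      omega
    rw [Circuit.value_iff, circuit_kind hg]
    simp only [kindOf, eval]
    have hwv : ∀ g', (circuit φ ψ w.length).wire g' g ∧ (circuit φ ψ w.length).value w.get g' →
        (and φ ψ).IsGate (bitLen w.length) g' ⟨χ, hs⟩ ∧ χ.eval w ((and φ ψ).env (bitLen w.length) g') ∧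
        ∀ i ≤ (and φ ψ).bound, i ≠ y → i ≠ y + 1 →
          (and φ ψ).env (bitLen w.length) g' i = (and φ ψ).env (bitLen w.length) g i := by
      rintro g' ⟨h', hv⟩
      obtain ⟨⟨χ', h'χ⟩, hg', hc, he⟩ := (hw g').1 h'
      obtain rfl : χ' = χ := hc
      exact ⟨hg', (ih hs g' hg').1 hv, fun i hi h1 h2 => he i hi (by simp [Binds, h1, h2])⟩
    -- The predecessors of this gate differ from each other only in the fields `y` and `y + 1`, so
    -- reading off these two fields is a bijection from the true predecessors to the pairs counted
    -- by the formula.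
    refine Eq.to_iff (congrArg _ (Nat.card_eq_of_bijective (fun g' => ⟨((and φ ψ).env (bitLen w.length) g'.1 y,
      (and φ ψ).env (bitLen w.length) g'.1 (y + 1)), hlt _ _, hlt _ _, ?_⟩) ⟨?_, ?_⟩))
    · obtain ⟨-, hv, he⟩ := hwv g'.1 g'.2
      refine (key χ _ _ hs fun i hi => ?_).1 hv
      by_cases e : i = y + 1
      · subst e; simp
      · rw [Function.update_of_ne e]
        by_cases e' : i = y
        · subst e'; simp
        · rw [Function.update_of_ne e']
          exact he i hi e' e
    · rintro ⟨g₁, h₁⟩ ⟨g₂, h₂⟩ he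
      simp only [Subtype.mk.injEq, Prod.mk.injEq] at he ⊢
      obtain ⟨hg₁, -, he₁⟩ := hwv g₁ h₁
      obtain ⟨hg₂, -, he₂⟩ := hwv g₂ h₂
      refine hg₁.eq hg₂ fun i hi => ?_
      by_cases e : i = y + 1
      · rw [e]; exact he.2
      · by_cases e' : i = y
        · rw [e']; exact he.1
        · rw [he₁ i hi e' e, he₂ i hi e' e]
    · rintro ⟨⟨p, q⟩, hp, hq, hv⟩
      obtain ⟨g', hg', he⟩ := exists_isGate (bitLen_pos w.length) ⟨χ, hs⟩
        (Function.update (Function.update ((and φ ψ).env (bitLen w.length) g) y p) (y + 1) q)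
        fun i _ => by
          by_cases e : i = y + 1
          · subst e; simpa using hq
          · rw [Function.update_of_ne e]
            by_cases e' : i = y
            · subst e'; simpa using hp
            · rw [Function.update_of_ne e']; exact hlt _ _
      refine ⟨⟨g', (hw g').2 ⟨_, hg', by simp [Child], fun i hi hb => ?_⟩, ?_⟩, ?_⟩
      · simp only [Binds, not_or] at hb
        rw [he i hi, Function.update_of_ne hb.2, Function.update_of_ne hb.1]
      · exact (ih hs g' hg').2 ((key χ _ _ hs he).2 hv)
      · simp only [Subtype.mk.injEq, Prod.mk.injEq]
        rw [he y (by omega), he (y + 1) hy]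
        simp

end Fml

end ParKernel

namespace ParKernel

/-! ### The word computed by the circuit of two formulas, and its size and depth -/

open Classical in
theorem Circuit.output_eq {n : ℕ} (C : Circuit n) (x : Fin n → Bool) {P Q : ℕ → Prop}
    (hP : ∀ j, C.value x (C.outPresent j) ↔ P j) (hQ : ∀ j, C.value x (C.outBit j) ↔ Q j) :
    C.output x = ((List.range C.outLen).takeWhile fun p => decide (P p)).map fun p =>
      decide (Q p) := by
  unfold Circuit.output
  simp only [hP, hQ]
  rw [← List.map_coe_finRange_eq_range, List.takeWhile_map, List.map_map]
  rfl

namespace Fml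

variable (φ ψ : Fml)

/-- The assignment of `p` to the first variable and of zero to all others. -/
def single (p : ℕ) : ℕ → ℕ := fun i => if i = 0 then p else 0

open Classical in
theorem compute_circuit (w : List Bool) : compute (circuit φ ψ) w =
    ((List.range w.length).takeWhile fun p => decide (φ.eval w (single p))).map
      fun p => decide (ψ.eval w (single p)) := by
  have hp : ∀ p : Fin w.length, (circuit φ ψ w.length).value w.get
      ((circuit φ ψ w.length).outPresent p) ↔ φ.eval w (single p) := by
    intro p
    have hs : φ ∈ (and φ ψ).sub := by simp [sub, self_mem_sub]
    have h := (exists_output_gate (and φ ψ) w.length ⟨φ, hs⟩ p).choose_spec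
    exact (circuit_value w φ hs _ h.1).trans (eval_congr w φ fun i hi =>
      h.2 i (hi.le.trans (bound_le_of_mem_sub hs)))
  have hb : ∀ p : Fin w.length, (circuit φ ψ w.length).value w.get
      ((circuit φ ψ w.length).outBit p) ↔ ψ.eval w (single p) := by
    intro p
    have hs : ψ ∈ (and φ ψ).sub := by simp [sub, self_mem_sub]
    have h := (exists_output_gate (and φ ψ) w.length ⟨ψ, hs⟩ p).choose_spec
    exact (circuit_value w ψ hs _ h.1).trans (eval_congr w ψ fun i hi =>
      h.2 i (hi.le.trans (bound_le_of_mem_sub hs)))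
  exact Circuit.output_eq (circuit φ ψ w.length) w.get hp hb

/-- For `n ≥ 2` one has `2 ^ bitLen n ≤ n ^ 2`, so the size is at most `n ^ (2 * B)`; for `n < 2` it
is the constant `2 ^ B`, covered by the additive term. -/
theorem circuit_poly_size : ∃ c : ℕ, ∀ n, (circuit φ ψ n).size ≤ n ^ c + c := by
  set B := (and φ ψ).width + 1 with hB
  have hB2 := Nat.two_pow_pos B
  refine ⟨2 ^ B + 2 * B, fun n => ?_⟩
  change 2 ^ (B * bitLen n) ≤ _
  rcases Nat.lt_or_ge n 2 with hn | hn
  · have : bitLen n = 1 := by unfold bitLen; rw [Nat.log_of_lt hn]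
    rw [this, mul_one]
    omega
  · have h1 : 2 ^ bitLen n ≤ n ^ 2 := by
      unfold bitLen
      rw [pow_succ, sq]
      exact Nat.mul_le_mul (Nat.pow_log_le_self 2 (by omega)) hn
    calc 2 ^ (B * bitLen n) = (2 ^ bitLen n) ^ B := by rw [← pow_mul, mul_comm]
      _ ≤ (n ^ 2) ^ B := Nat.pow_le_pow_left h1 _
      _ = n ^ (2 * B) := by rw [← pow_mul]
      _ ≤ n ^ (2 ^ B + 2 * B) := Nat.pow_le_pow_right (by omega) (by omega)
      _ ≤ _ := Nat.le_add_right _ _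

/-- The sizes of the subformulas strictly increase along a path and lie between `0` and the size of
the whole formula. -/
theorem circuit_depth (n : ℕ) : (circuit φ ψ n).DepthAtMost (and φ ψ).size := by
  intro l hl
  let r (g : Fin (circuit φ ψ n).size) : ℕ := (and φ ψ).rank (bitLen n) g
  have h1 : (l.map r).IsChain (· < ·) := by
    rw [List.isChain_map]
    exact hl.imp fun g g' h => Wire.rank_lt h
  have h2 : (l.map r).Nodup := (List.isChain_iff_pairwise.1 h1).imp fun h => h.ne
  have h3 : (l.map r).toFinset ⊆ Finset.range ((and φ ψ).size + 1) := fun i hi => by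
    obtain ⟨g, -, rfl⟩ := List.mem_map.1 (List.mem_toFinset.1 hi)
    exact Finset.mem_range.2 (Nat.lt_succ_of_le (rank_le _ _ _))
  have := Finset.card_le_card h3
  rwa [List.toFinset_card_of_nodup h2, List.length_map, Finset.card_range] at this

/-! ### Recognizing the tables of formula circuits by automata -/

/-- Tables 3 and 4 contain a number in the second address, tables 6 and 7 in the first address. -/
def heightFst (B : ℕ) (t : Fin 8) : ℕ := if t.val = 6 ∨ t.val = 7 then 1 else B

/-- Tables 3 and 4 contain a number in the second address, tables 6 and 7 in the first address. -/
def heightSnd (B : ℕ) (t : Fin 8) : ℕ := if t.val = 3 ∨ t.val = 4 then 1 else B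

open Classical in
/-- A gate for `χ` under the assignment `f` is of the kind that is described by table `t` with
parameter `v`. -/
def KindTable (n : ℕ) (t : ℕ) (f : ℕ → ℕ) (v : ℕ) : Fml → Prop
  | inp z => (t = 3 ∧ f z < n ∧ f z = v) ∨ (t = 2 ∧ ¬ f z < n)
  | lt x y => (t = 1 ∧ f x < f y) ∨ (t = 2 ∧ ¬ f x < f y)
  | ltLen x => (t = 1 ∧ f x < n) ∨ (t = 2 ∧ ¬ f x < n)
  | not _ => t = 0
  | and _ _ => t = 1
  | ex _ _ => t = 2
  | count _ _ z => t = 4 ∧ f z = v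

/-- The relation described by table `t` in terms of the gates. -/
def Table (L u v n : ℕ) (t : ℕ) : Prop :=
  if t = 5 then (and φ ψ).Wire L u v
  else if t = 6 then u < n ∧ (and φ ψ).IsGate L v ⟨φ, by simp [sub, self_mem_sub]⟩ ∧
    ∀ i ≤ (and φ ψ).bound, (and φ ψ).env L v i = single u i
  else if t = 7 then u < n ∧ (and φ ψ).IsGate L v ⟨ψ, by simp [sub, self_mem_sub]⟩ ∧
    ∀ i ≤ (and φ ψ).bound, (and φ ψ).env L v i = single u i
  else (∃ χ : (and φ ψ).Node, (and φ ψ).IsGate L u χ ∧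
      KindTable n t ((and φ ψ).env L u) v χ) ∨
    (t = 2 ∧ ¬ ∃ χ : (and φ ψ).Node, (and φ ψ).IsGate L u χ)

theorem kindTable_iff (n : ℕ) (f : ℕ → ℕ) (v : ℕ) (χ : Fml) :
    (kindOf n f χ = GateKind.not ↔ KindTable n 0 f v χ) ∧
    (kindOf n f χ = GateKind.and ↔ KindTable n 1 f v χ) ∧
    (kindOf n f χ = GateKind.or ↔ KindTable n 2 f v χ) ∧
    ((∃ hv : v < n, kindOf n f χ = GateKind.input ⟨v, hv⟩) ↔ KindTable n 3 f v χ) ∧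
    (kindOf n f χ = GateKind.thr v ↔ KindTable n 4 f v χ) := by
  cases χ <;> simp only [kindOf, KindTable]
  case inp z =>
    split_ifs with h
    · simp only [h, GateKind.input.injEq, Fin.mk.injEq]
      simp
      rintro rfl; exact h
    · simp [h]
  case lt => split_ifs with h <;> simp [h]
  case ltLen => split_ifs with h <;> simp [h]
  all_goals simp

/-- Addresses that code no subformula carry dummy `or` gates, whence the second alternative. -/
theorem exists_gateKind_iff {n u : ℕ} {P : GateKind n → Prop} {Q : Prop} {R : Fml → Prop}
    (hor : P GateKind.or ↔ Q)
    (h : ∀ χ : (and φ ψ).Node, P (kindOf n ((and φ ψ).env (bitLen n) u) χ) ↔ R χ) :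
    P ((and φ ψ).gateKind n u) ↔ (∃ χ : (and φ ψ).Node, (and φ ψ).IsGate (bitLen n) u χ ∧ R χ) ∨
      (Q ∧ ¬ ∃ χ : (and φ ψ).Node, (and φ ψ).IsGate (bitLen n) u χ) := by
  unfold gateKind
  split
  · rename_i χ hχ
    rw [label_eq_some] at hχ
    rw [h]
    constructor
    · exact fun h' => Or.inl ⟨χ, hχ, h'⟩
    · rintro (⟨χ', hχ', h'⟩ | ⟨-, hn⟩)
      · obtain rfl := hχ'.unique hχ
        exact h'
      · exact absurd ⟨χ, hχ⟩ hn
  · rename_i hχ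
    have hn : ¬ ∃ χ : (and φ ψ).Node, (and φ ψ).IsGate (bitLen n) u χ := by
      rintro ⟨χ, h'⟩
      rw [← label_eq_some, hχ] at h'
      simp at h'
    rw [hor]
    constructor
    · exact fun h' => Or.inr ⟨h', hn⟩
    · rintro (⟨χ, h1, -⟩ | h')
      · exact absurd ⟨χ, h1⟩ hn
      · exact h'.1

/-- Code and assignment determine the address, so the arbitrarily chosen output gate is the only
gate with this description. -/
theorem output_gate_iff {n u v : ℕ} (χ : (and φ ψ).Node)
    (hv : v < 2 ^ (((and φ ψ).width + 1) * bitLen n)) :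
    (∃ hu : u < n, ((exists_output_gate (and φ ψ) n χ ⟨u, hu⟩).choose : ℕ) = v) ↔
      u < n ∧ (and φ ψ).IsGate (bitLen n) v χ ∧
        ∀ i ≤ (and φ ψ).bound, (and φ ψ).env (bitLen n) v i = single u i := by
  constructor
  · rintro ⟨hu, rfl⟩
    have h := (exists_output_gate (and φ ψ) n χ ⟨u, hu⟩).choose_spec
    exact ⟨hu, h.1, h.2⟩
  · rintro ⟨hu, h1, h2⟩
    have h := (exists_output_gate (and φ ψ) n χ ⟨u, hu⟩).choose_spec
    refine ⟨hu, congrArg Fin.val (h.1.eq (g' := ⟨v, hv⟩) h1 fun i hi => ?_)⟩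
    rw [h.2 i hi]
    exact (h2 i hi).symm

theorem tableBit_circuit (n : ℕ) (t : Fin 8) (u v : ℕ)
    (hu : u < 2 ^ (((and φ ψ).width + 1) * bitLen n))
    (hv : v < 2 ^ (((and φ ψ).width + 1) * bitLen n)) :
    (circuit φ ψ n).tableBit t u v ↔ Table φ ψ (bitLen n) u v n t := by
  have hk : ∀ hu, (circuit φ ψ n).kind ⟨u, hu⟩ = (and φ ψ).gateKind n u := fun _ => rfl
  have hsize : (circuit φ ψ n).size = 2 ^ (((and φ ψ).width + 1) * bitLen n) := rfl
  have hor : ∀ k : GateKind n, k ≠ GateKind.or → (GateKind.or = k ↔ False) := fun k h =>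
    ⟨fun e => h e.symm, False.elim⟩
  have hkt := kindTable_iff n ((and φ ψ).env (bitLen n) u) v
  fin_cases t
  · simp only [Circuit.tableBit, hk, hsize, hu, exists_true_left]
    refine (exists_gateKind_iff φ ψ (P := fun k => k = GateKind.not) (Q := False) (by simp)
      fun χ => (hkt χ).1).trans ?_
    simp [Table]
  · simp only [Circuit.tableBit, hk, hsize, hu, exists_true_left]
    refine (exists_gateKind_iff φ ψ (P := fun k => k = GateKind.and) (Q := False) (by simp)
      fun χ => (hkt χ).2.1).trans ?_
    simp [Table]
  · simp only [Circuit.tableBit, hk, hsize, hu, exists_true_left]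
    refine (exists_gateKind_iff φ ψ (P := fun k => k = GateKind.or) (Q := True) (by simp)
      fun χ => (hkt χ).2.2.1).trans ?_
    simp [Table]
  · simp only [Circuit.tableBit, hk, hsize, hu, exists_true_left]
    refine (exists_gateKind_iff φ ψ (P := fun k => ∃ hv, k = GateKind.input ⟨v, hv⟩) (Q := False)
      (by simp) fun χ => (hkt χ).2.2.2.1).trans ?_
    simp [Table]
  · simp only [Circuit.tableBit, hk, hsize, hu, exists_true_left]
    refine (exists_gateKind_iff φ ψ (P := fun k => k = GateKind.thr v) (Q := False)
      (by simp) fun χ => (hkt χ).2.2.2.2).trans ?_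
    simp [Table]
  · simp only [Circuit.tableBit, hsize, hu, hv, exists_true_left]
    simp only [Table]
    rfl
  · exact output_gate_iff φ ψ ⟨φ, by simp [sub, self_mem_sub]⟩ hv
  · exact output_gate_iff φ ψ ⟨ψ, by simp [sub, self_mem_sub]⟩ hv

theorem recognizable_isGate_fst (ρ : Fml) (χ : ρ.Node) (bv : ℕ) :
    Recognizable (ρ.width + 1) (ρ.width + 1) bv fun L u _ _ => ρ.IsGate L u χ :=
  Recognizable.all fun i => Recognizable.track_const
    (.fst ⟨ρ.bound + 1 + i, by have := i.2; unfold width; omega⟩) (decide (ρ.code χ = i))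

theorem recognizable_isGate_snd (ρ : Fml) (χ : ρ.Node) (bu : ℕ) :
    Recognizable (ρ.width + 1) bu (ρ.width + 1) fun L _ v _ => ρ.IsGate L v χ :=
  Recognizable.all fun i => Recognizable.track_const
    (.snd ⟨ρ.bound + 1 + i, by have := i.2; unfold width; omega⟩) (decide (ρ.code χ = i))

/-- The track of a variable in the first address. -/
def fstTrack (ρ : Fml) (i : ℕ) (hi : i ≤ ρ.bound) : Track (ρ.width + 1) :=
  .fst ⟨i, by unfold width; omega⟩

/-- The track of a variable in the second address. -/
def sndTrack (ρ : Fml) (i : ℕ) (hi : i ≤ ρ.bound) : Track (ρ.width + 1) :=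
  .snd ⟨i, by unfold width; omega⟩

theorem recognizable_kindTable (ρ χ : Fml) (hχ : χ.bound ≤ ρ.bound) (t bv : ℕ) :
    Recognizable (ρ.width + 1) (ρ.width + 1) bv fun L u v n =>
      KindTable (field 1 0 L n) t (ρ.env L u) (field bv 0 L v) χ := by
  have hc := fun p : Prop => Recognizable.const (ρ.width + 1) (ρ.width + 1) bv p
  cases χ with
  | inp z =>
    have h1 : Recognizable (ρ.width + 1) (ρ.width + 1) bv fun L u v n =>
        ρ.env L u z < field 1 0 L n :=
      Recognizable.track_lt (fstTrack ρ z (by simp only [bound] at hχ; omega)) .len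
    have h2 : Recognizable (ρ.width + 1) (ρ.width + 1) bv fun L u v n =>
        ρ.env L u z = field bv 0 L v :=
      Recognizable.track_eq (fstTrack ρ z (by simp only [bound] at hχ; omega))
        (sndTrack ρ 0 (Nat.zero_le _))
    exact ((hc (t = 3)).and (h1.and h2)).or ((hc (t = 2)).and h1.not)
  | lt x y =>
    have h1 : Recognizable (ρ.width + 1) (ρ.width + 1) bv fun L u v n =>
        ρ.env L u x < ρ.env L u y :=
      Recognizable.track_lt (fstTrack ρ x (by simp only [bound] at hχ; omega))
        (fstTrack ρ y (by simp only [bound] at hχ; omega))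
    exact ((hc (t = 1)).and h1).or ((hc (t = 2)).and h1.not)
  | ltLen x =>
    have h1 : Recognizable (ρ.width + 1) (ρ.width + 1) bv fun L u v n =>
        ρ.env L u x < field 1 0 L n :=
      Recognizable.track_lt (fstTrack ρ x (by simp only [bound] at hχ; omega)) .len
    exact ((hc (t = 1)).and h1).or ((hc (t = 2)).and h1.not)
  | not _ => exact hc (t = 0)
  | and _ _ => exact hc (t = 1)
  | ex _ _ => exact hc (t = 2)
  | count y χ z =>
    exact (hc (t = 4)).and (Recognizable.track_eq
      (fstTrack ρ z (by simp only [bound] at hχ; omega)) (sndTrack ρ 0 (Nat.zero_le _)))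

/-- Tables 0, 1 and 2 ignore the second address, so it is harmless that the automaton sees only one
field of it. -/
theorem kindTable_congr {n t : ℕ} (f : ℕ → ℕ) (v v' : ℕ) (h : t < 3) (χ : Fml) :
    KindTable n t f v χ ↔ KindTable n t f v' χ := by
  cases χ <;> simp only [KindTable]
  case inp => simp [h.ne]
  case count => simp [show t ≠ 4 by omega]

/-- In tables 3 and 4 the second address is the value of a variable. Hence it has at most `L` bits,
and columns of height one read all of it. -/
theorem KindTable.lt {L n t : ℕ} {f : ℕ → ℕ} {v : ℕ} (h : 2 < t) (hf : ∀ i, f i < 2 ^ L) {χ : Fml}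
    (hk : KindTable n t f v χ) : v < 2 ^ L := by
  cases χ <;> simp only [KindTable] at hk
  case inp =>
    rcases hk with ⟨-, -, rfl⟩ | ⟨rfl, -⟩
    · exact hf _
    · omega
  case count => rw [← hk.2]; exact hf _
  all_goals omega

/-- The relation described by the tables in terms of automata. -/
def AutoTable (L u v n : ℕ) (t : ℕ) : Prop :=
  if t < 5 then Table φ ψ L u (field (if t < 3 then (and φ ψ).width + 1 else 1) 0 L v)
    (field 1 0 L n) t
  else if t = 5 then (and φ ψ).Wire L u v
  else Table φ ψ L (field 1 0 L u) v (field 1 0 L n) t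

theorem recognizable_wire (ρ : Fml) :
    Recognizable (ρ.width + 1) (ρ.width + 1) (ρ.width + 1) fun L u v _ => ρ.Wire L u v := by
  refine Recognizable.ex fun χ' => Recognizable.ex fun χ => (recognizable_isGate_fst ρ χ' _).and
    ((recognizable_isGate_snd ρ χ _).and ((Recognizable.const _ _ _ _).and ?_))
  have : Finite {i // i ≤ ρ.bound ∧ ¬ χ.1.Binds i} :=
    Finite.of_injective (fun i => (⟨i.1, Nat.lt_succ_of_le i.2.1⟩ : Fin (ρ.bound + 1)))
      fun i j h => Subtype.ext (by simpa using h)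
  refine (Recognizable.all (ι := {i // i ≤ ρ.bound ∧ ¬ χ.1.Binds i})
    (R := fun i L u v n => ρ.env L u i = ρ.env L v i) fun i => ?_).congr fun L u v n => ?_
  · exact Recognizable.track_eq (fstTrack ρ i i.2.1) (sndTrack ρ i i.2.1)
  · simp

theorem recognizable_output (ρ : Fml) (χ : ρ.Node) :
    Recognizable (ρ.width + 1) 1 (ρ.width + 1) fun L u v n =>
      field 1 0 L u < field 1 0 L n ∧ ρ.IsGate L v χ ∧
        ∀ i ≤ ρ.bound, ρ.env L v i = single (field 1 0 L u) i := by
  refine (Recognizable.track_lt (fstTrack ρ 0 (Nat.zero_le _)) .len).and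
    ((recognizable_isGate_snd ρ χ _).and ?_)
  refine (Recognizable.all (ι := {i // i ≤ ρ.bound})
    (R := fun i L u v n => ρ.env L v i = single (field 1 0 L u) i) fun i => ?_).congr
      fun L u v n => by simp
  obtain ⟨i, hi⟩ := i
  by_cases h : i = 0
  · subst h
    exact Recognizable.track_eq (sndTrack ρ 0 hi) (fstTrack ρ 0 hi)
  · simp only [single, if_neg h]
    exact Recognizable.track_const (sndTrack ρ i hi) false

theorem recognizable_autoTable (t : Fin 8) :
    Recognizable ((and φ ψ).width + 1) (heightFst ((and φ ψ).width + 1) t)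
      (heightSnd ((and φ ψ).width + 1) t) fun L u v n => AutoTable φ ψ L u v n t := by
  have h1 : ∀ t bv : ℕ, t < 5 → Recognizable ((and φ ψ).width + 1) ((and φ ψ).width + 1) bv
      fun L u v n => Table φ ψ L u (field bv 0 L v) (field 1 0 L n) t := fun t bv ht => by
    simp only [Table, show t ≠ 5 by omega, show t ≠ 6 by omega, show t ≠ 7 by omega, if_false]
    exact (Recognizable.ex fun χ => (recognizable_isGate_fst _ χ _).and
      (recognizable_kindTable _ _ (bound_le_of_mem_sub χ.2) _ _)).or
      ((Recognizable.const _ _ _ _).and (Recognizable.ex fun χ =>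
        recognizable_isGate_fst _ χ _).not)
  fin_cases t
  · exact h1 0 _ (by norm_num)
  · exact h1 1 _ (by norm_num)
  · exact h1 2 _ (by norm_num)
  · exact h1 3 _ (by norm_num)
  · exact h1 4 _ (by norm_num)
  · exact recognizable_wire _
  · exact recognizable_output _ _
  · exact recognizable_output _ _

/-- The automaton sees only as many bits of an address as fit into its columns. Where an address
stands for a plain number, a true table entry forces this number to fit; the size conditions on the
right reject longer addresses, whose truncation might be accepted. -/
theorem tableBit_iff_autoTable (n : ℕ) (t : Fin 8) (u v : ℕ)
    (hu : u < 2 ^ (((and φ ψ).width + 1) * bitLen n))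
    (hv : v < 2 ^ (((and φ ψ).width + 1) * bitLen n)) :
    (circuit φ ψ n).tableBit t u v ↔ AutoTable φ ψ (bitLen n) u v n t ∧
      u < 2 ^ (heightFst ((and φ ψ).width + 1) t * bitLen n) ∧
      v < 2 ^ (heightSnd ((and φ ψ).width + 1) t * bitLen n) := by
  rw [tableBit_circuit φ ψ n t u v hu hv]
  have hn := lt_two_pow_bitLen n
  have h1 : ∀ t : ℕ, t < 3 → (Table φ ψ (bitLen n) u v n t ↔ AutoTable φ ψ (bitLen n) u v n t) := by
    intro t ht
    simp only [AutoTable, show t < 5 by omega, if_true, ht, Table, show t ≠ 5 by omega,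
      show t ≠ 6 by omega, show t ≠ 7 by omega, if_false, field_one hn]
    simp only [kindTable_congr ((and φ ψ).env (bitLen n) u) v
      (field ((and φ ψ).width + 1) 0 (bitLen n) v) ht]
  have h2 : ∀ t : ℕ, t = 3 ∨ t = 4 → (Table φ ψ (bitLen n) u v n t ↔
      AutoTable φ ψ (bitLen n) u v n t ∧ v < 2 ^ (1 * bitLen n)) := by
    intro t ht
    have e : AutoTable φ ψ (bitLen n) u v n t ↔
        Table φ ψ (bitLen n) u (field 1 0 (bitLen n) v) n t := by
      simp only [AutoTable, show t < 5 by omega, if_true, show ¬ t < 3 by omega, if_false,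
        field_one hn]
    rw [e, one_mul]
    constructor
    · intro h
      have hv : v < 2 ^ bitLen n := by
        simp only [Table, show t ≠ 5 by omega, show t ≠ 6 by omega, show t ≠ 7 by omega,
          if_false] at h
        rcases h with ⟨χ, -, h⟩ | h
        · exact KindTable.lt (by omega) (fun i => field_lt _ _ _ _) h
        · omega
      rw [field_one hv]
      exact ⟨h, hv⟩
    · rintro ⟨h, hv⟩
      rwa [field_one hv] at h
  have h3 : ∀ t : ℕ, t = 6 ∨ t = 7 → (Table φ ψ (bitLen n) u v n t ↔
      AutoTable φ ψ (bitLen n) u v n t ∧ u < 2 ^ (1 * bitLen n)) := by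
    intro t ht
    have e : AutoTable φ ψ (bitLen n) u v n t ↔
        Table φ ψ (bitLen n) (field 1 0 (bitLen n) u) v n t := by
      simp only [AutoTable, show ¬ t < 5 by omega, show t ≠ 5 by omega, if_false, field_one hn]
    rw [e, one_mul]
    constructor
    · intro h
      have hu : u < 2 ^ bitLen n := by
        rcases ht with rfl | rfl
        · exact h.1.trans hn
        · exact h.1.trans hn
      rw [field_one hu]
      exact ⟨h, hu⟩
    · rintro ⟨h, hu⟩
      rwa [field_one hu] at h
  fin_cases t
  · exact (h1 0 (by norm_num)).trans ⟨fun h => ⟨h, hu, hv⟩, fun h => h.1⟩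
  · exact (h1 1 (by norm_num)).trans ⟨fun h => ⟨h, hu, hv⟩, fun h => h.1⟩
  · exact (h1 2 (by norm_num)).trans ⟨fun h => ⟨h, hu, hv⟩, fun h => h.1⟩
  · exact (h2 3 (by norm_num)).trans ⟨fun h => ⟨h.1, hu, h.2⟩, fun h => ⟨h.1, h.2.2⟩⟩
  · exact (h2 4 (by norm_num)).trans ⟨fun h => ⟨h.1, hu, h.2⟩, fun h => ⟨h.1, h.2.2⟩⟩
  · exact ⟨fun h => ⟨h, hu, hv⟩, fun h => h.1⟩
  · exact (h3 6 (by norm_num)).trans ⟨fun h => ⟨h.1, h.2, hv⟩, fun h => ⟨h.1, h.2.1⟩⟩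
  · exact (h3 7 (by norm_num)).trans ⟨fun h => ⟨h.1, h.2, hv⟩, fun h => ⟨h.1, h.2.1⟩⟩

/-- The circuits of formulas form a uniform family of `TC⁰`-circuits. -/
theorem isUniformTC0_circuit : IsUniformTC0 (circuit φ ψ) where
  poly_size := circuit_poly_size φ ψ
  const_depth := ⟨_, circuit_depth φ ψ⟩
  uniform := by
    refine dlogtimeUniform_of_recognizable (b := (and φ ψ).width)
      (recognizable_autoTable φ ψ) (fun n => le_rfl) (fun n => ?_)
      fun n t u v hu hv => tableBit_iff_autoTable φ ψ n t u v hu hv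
    change n ≤ _
    exact (lt_two_pow_bitLen n).le.trans
      (Nat.pow_le_pow_right (by norm_num) (Nat.le_mul_of_pos_left _ (Nat.succ_pos _)))

end Fml
end ParKernel

namespace ParKernel

/-! ### Definable relations -/

/-- Contexts: nested pairs of numbers, read off from the first variables of an assignment. -/
class Ctx (E : Type) where
  depth : ℕ
  of : (ℕ → ℕ) → E
  of_congr : ∀ a a' : ℕ → ℕ, (∀ i < depth, a i = a' i) → of a = of a'

instance : Ctx Unit := ⟨0, fun _ => (), fun _ _ _ => rfl⟩

instance {E : Type} [Ctx E] : Ctx (E × ℕ) where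
  depth := Ctx.depth E + 1
  of a := (Ctx.of a, a (Ctx.depth E))
  of_congr a a' h := by
    rw [Ctx.of_congr a a' fun i hi => h i (Nat.lt_succ_of_lt hi), h _ (Nat.lt_succ_self _)]

/-- The variables of a context. -/
def IsVar {E : Type} [Ctx E] (f : E → ℕ) : Prop :=
  ∃ i < Ctx.depth E, ∀ a, f (Ctx.of a) = a i

/-- The projections of a context to the contexts of which it is an extension. -/
def IsProj {E E' : Type} [Ctx E] [Ctx E'] (π : E' → E) : Prop :=
  Ctx.depth E ≤ Ctx.depth E' ∧ ∀ a, π (Ctx.of a) = Ctx.of a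

/-- Relations on words and contexts that are defined by a formula, as long as the numbers are less
than the length of the word. -/
def Def {E : Type} [Ctx E] (P : List Bool → E → Prop) : Prop :=
  ∃ φ : Fml, ∀ w a, (∀ i < Ctx.depth E, a i < w.length) → (P w (Ctx.of a) ↔ φ.eval w a)

/-- Functions with definable graphs. -/
def DefFun {E : Type} [Ctx E] (t : List Bool → E → ℕ) : Prop :=
  Def fun w (e : E × ℕ) => e.2 = t w e.1

section

variable {E E' : Type} [Ctx E] [Ctx E']

theorem IsVar.last : IsVar fun e : E × ℕ => e.2 := ⟨Ctx.depth E, Nat.lt_succ_self _, fun _ => rfl⟩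

theorem IsVar.w {f : E → ℕ} (h : IsVar f) : IsVar fun e : E × ℕ => f e.1 := by
  obtain ⟨i, hi, h⟩ := h
  exact ⟨i, Nat.lt_succ_of_lt hi, fun a => h a⟩

theorem IsProj.id : IsProj fun e : E => e := ⟨le_rfl, fun _ => rfl⟩

theorem IsProj.w {π : E' → E} (h : IsProj π) : IsProj fun e : E' × ℕ => π e.1 :=
  ⟨Nat.le_succ_of_le h.1, fun a => h.2 a⟩

namespace Def

theorem congr {P Q : List Bool → E → Prop} (h : Def P)
    (e : ∀ w a, (∀ i < Ctx.depth E, a i < w.length) → (P w (Ctx.of a) ↔ Q w (Ctx.of a))) : Def Q := by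
  obtain ⟨φ, h⟩ := h
  exact ⟨φ, fun w a ha => (e w a ha).symm.trans (h w a ha)⟩

theorem not {P : List Bool → E → Prop} (h : Def P) : Def fun w e => ¬ P w e := by
  obtain ⟨φ, h⟩ := h
  exact ⟨φ.not, fun w a ha => not_congr (h w a ha)⟩

theorem and {P Q : List Bool → E → Prop} (h : Def P) (h' : Def Q) : Def fun w e => P w e ∧ Q w e := by
  obtain ⟨φ, h⟩ := h
  obtain ⟨ψ, h'⟩ := h'
  exact ⟨φ.and ψ, fun w a ha => and_congr (h w a ha) (h' w a ha)⟩

theorem or {P Q : List Bool → E → Prop} (h : Def P) (h' : Def Q) : Def fun w e => P w e ∨ Q w e :=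
  (h.not.and h'.not).not.congr fun _ _ _ => by tauto

theorem imp {P Q : List Bool → E → Prop} (h : Def P) (h' : Def Q) : Def fun w e => P w e → Q w e :=
  (h.and h'.not).not.congr fun _ _ _ => by tauto

theorem iff {P Q : List Bool → E → Prop} (h : Def P) (h' : Def Q) :
    Def fun w e => (P w e ↔ Q w e) :=
  ((h.imp h').and (h'.imp h)).congr fun _ _ _ => by tauto

theorem lt {x y : E → ℕ} (hx : IsVar x) (hy : IsVar y) : Def fun _ e => x e < y e := by
  obtain ⟨i, hi, hx⟩ := hx
  obtain ⟨j, hj, hy⟩ := hy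
  exact ⟨.lt i j, fun w a _ => by
    change x _ < y _ ↔ a i < a j
    rw [hx, hy]⟩

theorem le {x y : E → ℕ} (hx : IsVar x) (hy : IsVar y) : Def fun _ e => x e ≤ y e :=
  (lt hy hx).not.congr fun _ _ _ => not_lt

theorem eq {x y : E → ℕ} (hx : IsVar x) (hy : IsVar y) : Def fun _ e => x e = y e :=
  ((le hx hy).and (le hy hx)).congr fun _ _ _ => le_antisymm_iff.symm

theorem inp_var {x : E → ℕ} (hx : IsVar x) : Def fun w e => w[x e]? = some true := by
  obtain ⟨i, hi, hx⟩ := hx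
  exact ⟨.inp i, fun w a _ => by
    change w[x _]? = _ ↔ w[a i]? = _
    rw [hx]⟩

theorem of_update {i : ℕ} (hi : Ctx.depth E ≤ i) (a : ℕ → ℕ) (c : ℕ) :
    (Ctx.of (Function.update a i c) : E) = Ctx.of a :=
  Ctx.of_congr _ _ fun j hj => Function.update_of_ne (by omega) _ _

theorem ex {P : List Bool → E → ℕ → Prop} (h : Def fun w (e : E × ℕ) => P w e.1 e.2) :
    Def fun w e => ∃ y < w.length, P w e y := by
  obtain ⟨φ, h⟩ := h
  -- Quantifiers of formulas range up to the next power of two, so the range is cut down to the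
  -- length of the word.
  refine ⟨.ex (Ctx.depth E) (.and (.ltLen (Ctx.depth E)) φ), fun w a ha => ?_⟩
  have key : ∀ c < w.length, (P w (Ctx.of a) c ↔
      φ.eval w (Function.update a (Ctx.depth E) c)) := fun c hc => by
    have := h w (Function.update a (Ctx.depth E) c) fun i hi => by
      by_cases e : i = Ctx.depth E
      · subst e; simpa using hc
      · rw [Function.update_of_ne e]
        exact ha i (lt_of_le_of_ne (Nat.lt_succ_iff.1 hi) e)
    rw [← this]
    change _ ↔ P w (Ctx.of (Function.update a _ c)) (Function.update a _ c _)
    rw [of_update le_rfl, Function.update_self]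
  simp only [Fml.eval, Function.update_self]
  constructor
  · rintro ⟨c, hc, hP⟩
    exact ⟨c, hc.trans (lt_two_pow_bitLen _), hc, (key c hc).1 hP⟩
  · rintro ⟨c, -, hc, hP⟩
    exact ⟨c, hc, (key c hc).2 hP⟩

theorem all {P : List Bool → E → ℕ → Prop} (h : Def fun w (e : E × ℕ) => P w e.1 e.2) :
    Def fun w e => ∀ y < w.length, P w e y :=
  (ex (P := fun w e y => ¬ P w e y) h.not).not.congr fun _ _ _ => by push Not; rfl

theorem _root_.ParKernel.IsVar.lt_length {x : E → ℕ} (hx : IsVar x) {w : List Bool} {a : ℕ → ℕ}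
    (ha : ∀ i < Ctx.depth E, a i < w.length) : x (Ctx.of a) < w.length := by
  obtain ⟨i, hi, hx⟩ := hx
  rw [hx]
  exact ha i hi

theorem ex_lt {x : E → ℕ} (hx : IsVar x) {P : List Bool → E → ℕ → Prop}
    (h : Def fun w (e : E × ℕ) => P w e.1 e.2) : Def fun w e => ∃ y < x e, P w e y :=
  (ex (P := fun w e y => y < x e ∧ P w e y) ((lt IsVar.last hx.w).and h)).congr fun _ _ ha =>
    ⟨fun ⟨y, _, h1, h2⟩ => ⟨y, h1, h2⟩, fun ⟨y, h1, h2⟩ => ⟨y, h1.trans (hx.lt_length ha), h1, h2⟩⟩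

theorem all_lt {x : E → ℕ} (hx : IsVar x) {P : List Bool → E → ℕ → Prop}
    (h : Def fun w (e : E × ℕ) => P w e.1 e.2) : Def fun w e => ∀ y < x e, P w e y :=
  (ex_lt (P := fun w e y => ¬ P w e y) hx h.not).not.congr fun _ _ _ => by push Not; rfl

theorem subst {P : List Bool → E × ℕ → Prop} (h : Def P) {π : E' → E} (hπ : IsProj π) {x : E' → ℕ}
    (hx : IsVar x) : Def fun w e => P w (π e, x e) := by
  obtain ⟨φ, h⟩ := h
  obtain ⟨i, hi, hx⟩ := hx
  -- The new variable is quantified and forced to equal `x`. If `x` already is that variable, the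
  -- quantifier would hide its value, but then `φ` itself serves.
  by_cases hid : i = Ctx.depth E
  · subst hid
    refine ⟨φ, fun w a ha => ?_⟩
    beta_reduce
    rw [hπ.2, hx]
    exact h w a fun j hj => ha j (lt_of_lt_of_le hj (Nat.succ_le_of_lt hi))
  · refine ⟨.ex (Ctx.depth E) (.and (.and (.not (.lt (Ctx.depth E) i)) (.not (.lt i (Ctx.depth E)))) φ),
      fun w a ha => ?_⟩
    have key := h w (Function.update a (Ctx.depth E) (a i)) fun j hj => by
      by_cases e : j = Ctx.depth E
      · subst e; simpa using ha i hi
      · rw [Function.update_of_ne e]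
        exact ha j (lt_of_lt_of_le (lt_of_le_of_ne (Nat.lt_succ_iff.1 hj) e) hπ.1)
    have e1 : (Ctx.of (Function.update a (Ctx.depth E) (a i)) : E × ℕ) = (Ctx.of a, a i) := by
      change ((Ctx.of (Function.update a _ _), Function.update a _ _ _) : E × ℕ) = _
      rw [of_update le_rfl, Function.update_self]
    rw [e1] at key
    beta_reduce
    rw [hπ.2, hx, key]
    simp only [Fml.eval, Function.update_self, Function.update_of_ne hid]
    constructor
    · exact fun hP => ⟨a i, (ha i hi).trans (lt_two_pow_bitLen _), by simp, hP⟩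
    · rintro ⟨c, -, ⟨h1, h2⟩, hP⟩
      obtain rfl : c = a i := by omega
      exact hP

theorem eq_fun {t : List Bool → E → ℕ} (h : DefFun t) {x : E → ℕ} (hx : IsVar x) :
    Def fun w e => x e = t w e := subst h IsProj.id hx

theorem fun_lt_length {t : List Bool → E → ℕ} (h : DefFun t) : Def fun w e => t w e < w.length :=
  (ex (P := fun w e y => y = t w e) h).congr fun _ _ _ =>
    ⟨fun ⟨_, hy, e⟩ => e ▸ hy, fun h => ⟨_, h, rfl⟩⟩

theorem fun_lt {t : List Bool → E → ℕ} (h : DefFun t) {x : E → ℕ} (hx : IsVar x) :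
    Def fun w e => t w e < x e :=
  (ex (P := fun w e y => y = t w e ∧ y < x e) (h.and (lt IsVar.last hx.w))).congr fun _ _ ha =>
    ⟨fun ⟨_, _, e, h⟩ => e ▸ h, fun h => ⟨_, h.trans (hx.lt_length ha), rfl, h⟩⟩

theorem lt_fun {t : List Bool → E → ℕ} (h : DefFun t) {x : E → ℕ} (hx : IsVar x) :
    Def fun w e => x e < t w e :=
  (ex (P := fun w e y => y = t w e ∧ y ≤ x e) (h.and (le IsVar.last hx.w))).not.congr fun w a ha =>
    ⟨fun h' => not_le.1 fun h => h' ⟨_, h.trans_lt (hx.lt_length ha), rfl, h⟩,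
      fun h ⟨y, _, e, h'⟩ => by omega⟩

theorem inp {t : List Bool → E → ℕ} (h : DefFun t) : Def fun w e => w[t w e]? = some true :=
  (ex (P := fun w e y => y = t w e ∧ w[y]? = some true) (h.and (inp_var IsVar.last))).congr
    fun _ _ _ => ⟨fun ⟨_, _, e, h⟩ => e ▸ h, fun h =>
      ⟨_, (List.getElem?_eq_some_iff.1 h).1, rfl, h⟩⟩

end Def

/-- The number of pairs of numbers less than `n` that satisfy `P`. -/
noncomputable def cntPairs (P : ℕ → ℕ → Prop) (n : ℕ) : ℕ :=
  Nat.card {p : ℕ × ℕ // p.1 < n ∧ p.2 < n ∧ P p.1 p.2}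

theorem cntPairs_eq_card (P : ℕ → ℕ → Prop) [∀ i j, Decidable (P i j)] (n : ℕ) : cntPairs P n =
    ((Finset.range n ×ˢ Finset.range n).filter fun p => P p.1 p.2).card := by
  rw [cntPairs]
  exact Nat.subtype_card _ fun p => by simp [and_assoc]

namespace DefFun

/-- The count equals `z` iff it is at least `z` and not at least any larger `c`. The candidate `z +
1` is in the range of the quantifier because `z` is less than the length of the word. -/
theorem cntPairs {P : List Bool → E → ℕ → ℕ → Prop}
    (h : Def fun w (e : ((E × ℕ) × ℕ) × ℕ) => P w e.1.1.1 e.1.2 e.2) :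
    DefFun fun w e => cntPairs (P w e) w.length := by
  obtain ⟨φ, h⟩ := h
  set d := Ctx.depth E with hd
  let χ : Fml := .and (.and (.ltLen (d + 1)) (.ltLen (d + 2))) φ
  refine ⟨.and (.count (d + 1) χ d) (.not (.ex (d + 3) (.and (.lt d (d + 3))
    (.count (d + 1) χ (d + 3))))), fun w a ha => ?_⟩
  have hc : ∀ a : ℕ → ℕ, (∀ i < d + 1, a i < w.length) → Nat.card {p : ℕ × ℕ //
      p.1 < 2 ^ bitLen w.length ∧ p.2 < 2 ^ bitLen w.length ∧
        χ.eval w (Function.update (Function.update a (d + 1) p.1) (d + 1 + 1) p.2)} =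
      ParKernel.cntPairs (P w (Ctx.of a)) w.length := by
    intro a ha
    refine Nat.card_congr (Equiv.subtypeEquivRight fun p => ?_)
    have hn := lt_two_pow_bitLen w.length
    set a' := Function.update (Function.update a (d + 1) p.1) (d + 1 + 1) p.2 with ha'
    have e1 : a' (d + 1) = p.1 := by simp [ha']
    have e2 : a' (d + 2) = p.2 := by simp [ha']
    have e3 : (Ctx.of a' : E) = Ctx.of a := by
      rw [ha', Def.of_update (by omega), Def.of_update (by omega)]
    simp only [χ, Fml.eval, e1, e2]
    have key : p.1 < w.length → p.2 < w.length → (P w (Ctx.of a) p.1 p.2 ↔ φ.eval w a') := by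
      intro h1 h2
      rw [← h w a' fun i hi => ?_]
      · change _ ↔ P w (Ctx.of a') (a' (d + 1)) (a' (d + 2))
        rw [e1, e2, e3]
      · by_cases c2 : i = d + 2
        · rw [c2, e2]; exact h2
        · by_cases c1 : i = d + 1
          · rw [c1, e1]; exact h1
          · rw [ha', Function.update_of_ne c2, Function.update_of_ne c1]
            have : i < d + 1 + 1 + 1 := hi
            exact ha i (by omega)
    constructor
    · rintro ⟨-, -, ⟨h1, h2⟩, h3⟩
      exact ⟨h1, h2, (key h1 h2).2 h3⟩
    · rintro ⟨h1, h2, h3⟩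
      exact ⟨h1.trans hn, h2.trans hn, ⟨h1, h2⟩, (key h1 h2).1 h3⟩
  have hz : ∀ c, Nat.card {p : ℕ × ℕ // p.1 < 2 ^ bitLen w.length ∧ p.2 < 2 ^ bitLen w.length ∧
        χ.eval w (Function.update (Function.update (Function.update a (d + 3) c) (d + 1) p.1)
          (d + 1 + 1) p.2)} = ParKernel.cntPairs (P w (Ctx.of a)) w.length := fun c => by
    rw [hc _ fun i hi => ?_, Def.of_update (by omega)]
    rw [Function.update_of_ne (by omega)]
    exact ha i hi
  have hzd : ∀ c, Function.update a (d + 3) c d = a d := fun c =>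
    Function.update_of_ne (by omega) _ _
  change a d = ParKernel.cntPairs (P w (Ctx.of a)) w.length ↔ _
  simp only [Fml.eval, hz, hc a ha, hzd, Function.update_self]
  constructor
  · intro h'
    refine ⟨h'.le, ?_⟩
    rintro ⟨c, -, h1, h2⟩
    omega
  · rintro ⟨h1, h2⟩
    refine le_antisymm h1 (not_lt.1 fun h3 => h2 ⟨a d + 1, ?_, by omega, h3⟩)
    have := ha d (Nat.lt_succ_self d)
    have := lt_two_pow_bitLen w.length
    omega

theorem var {x : E → ℕ} (hx : IsVar x) : DefFun fun _ e => x e := Def.eq IsVar.last hx.w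

theorem w {t : List Bool → E → ℕ} (h : DefFun t) : DefFun fun w (e : E × ℕ) => t w e.1 :=
  Def.subst h (π := fun e : (E × ℕ) × ℕ => e.1.1) IsProj.id.w.w IsVar.last

theorem cntPairs_diag (P : ℕ → Prop) [DecidablePred P] (n : ℕ) :
    ParKernel.cntPairs (fun i j => j = i ∧ P i) n = ((Finset.range n).filter P).card := by
  rw [cntPairs_eq_card]
  refine Finset.card_nbij' Prod.fst (fun i => (i, i)) ?_ ?_ ?_ ?_
  · rintro ⟨i, j⟩ h
    simp only [Finset.coe_filter, Finset.mem_product, Finset.mem_range, Set.mem_ofPred_eq] at h ⊢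
    exact ⟨h.1.1, h.2.2⟩
  · intro i h
    simp only [Finset.coe_filter, Finset.mem_product, Finset.mem_range, Set.mem_ofPred_eq] at h ⊢
    exact ⟨⟨h.1, h.1⟩, trivial, h.2⟩
  · rintro ⟨i, j⟩ h
    simp only [Finset.coe_filter, Finset.mem_product, Finset.mem_range, Set.mem_ofPred_eq] at h ⊢
    rw [h.2.1]
  · intro i _
    rfl

theorem card_filter {P : List Bool → E → ℕ → Prop} [∀ w e, DecidablePred (P w e)]
    (h : Def fun w (e : E × ℕ) => P w e.1 e.2) :
    DefFun fun w e => ((Finset.range w.length).filter (P w e)).card := by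
  have := cntPairs (P := fun w e i j => j = i ∧ P w e i)
    ((Def.eq IsVar.last IsVar.last.w).and
      (Def.subst h (π := fun e : ((E × ℕ) × ℕ) × ℕ => e.1.1.1) IsProj.id.w.w.w IsVar.last.w))
  simpa only [cntPairs_diag] using this

theorem cnt {P : List Bool → E → ℕ → Prop} (h : Def fun w (e : E × ℕ) => P w e.1 e.2) {x : E → ℕ}
    (hx : IsVar x) : DefFun fun w e => cnt (P w e) (x e) := by
  classical
  refine Def.congr (card_filter (P := fun w e y => y < x e ∧ P w e y)
    ((Def.lt IsVar.last hx.w).and h)) fun w a ha => ?_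
  have := hx.lt_length fun i hi => ha i (Nat.lt_succ_of_lt hi)
  change _ = _ ↔ _ = ParKernel.cnt (P w (Ctx.of a)) (x (Ctx.of a))
  rw [cnt_eq_card]
  change _ = (Finset.filter (fun y => y < x (Ctx.of a) ∧ P w (Ctx.of a) y) _).card ↔ _
  rw [show (Finset.range w.length).filter (fun y => y < x (Ctx.of a) ∧ P w (Ctx.of a) y) =
    (Finset.range (x (Ctx.of a))).filter (P w (Ctx.of a)) by
      ext y
      simp only [Finset.mem_filter, Finset.mem_range]
      exact ⟨fun h => h.2, fun h => ⟨h.1.trans this, h⟩⟩]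

theorem zero : DefFun fun (_ : List Bool) (_ : E) => 0 :=
  -- Zero is the number with nothing below it; `y ≤ y` merely stands for a definable truth.
  (Def.ex_lt (P := fun _ _ y => y ≤ y) IsVar.last (Def.le IsVar.last IsVar.last)).not.congr
    fun w a _ => by
      beta_reduce
      constructor
      · intro h
        by_contra h0
        exact h ⟨0, Nat.pos_of_ne_zero h0, le_rfl⟩
      · rintro h ⟨y, hy, -⟩
        omega

theorem one : DefFun fun (_ : List Bool) (_ : E) => 1 :=
  ((Def.all_lt (P := fun _ _ y => y = 0) IsVar.last (Def.eq_fun zero IsVar.last)).and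
    zero.not).congr fun w a _ => by
      beta_reduce
      constructor
      · rintro ⟨h1, h2⟩
        by_contra h
        have := h1 1 (by omega)
        omega
      · intro h
        rw [h]
        exact ⟨by omega, by omega⟩

/-- A number `z` is the sum iff `x ≤ z` and the interval from `x` to `z` has `y` elements. -/
theorem add_var {x y : E → ℕ} (hx : IsVar x) (hy : IsVar y) : DefFun fun _ e => x e + y e := by
  have h := Def.eq_fun (card_filter (P := fun _ (e : E × ℕ) i => x e.1 ≤ i ∧ i < e.2)
    ((Def.le hx.w.w IsVar.last).and (Def.lt IsVar.last IsVar.last.w))) hy.w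
  refine ((Def.le hx.w IsVar.last).and h).congr fun w a ha => ?_
  have := (IsVar.last (E := E)).lt_length ha
  beta_reduce
  rw [show (Finset.range w.length).filter (fun i => x (Ctx.of a : E × ℕ).1 ≤ i ∧
    i < (Ctx.of a : E × ℕ).2) = Finset.Ico (x (Ctx.of a : E × ℕ).1) (Ctx.of a : E × ℕ).2 by
      ext i
      simp only [Finset.mem_filter, Finset.mem_range, Finset.mem_Ico]
      omega, Nat.card_Ico]
  omega

/-- The summands do not exceed the sum. As only sums below the length of the word matter,
quantifying over shorter numbers loses nothing. -/
theorem add {s t : List Bool → E → ℕ} (hs : DefFun s) (ht : DefFun t) :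
    DefFun fun w e => s w e + t w e := by
  refine Def.congr (Def.ex (P := fun w (e : E × ℕ) x => x = s w e.1 ∧ ∃ y < w.length,
    y = t w e.1 ∧ e.2 = x + y) ((Def.eq_fun hs.w.w IsVar.last).and (Def.ex (P := fun w (e : (E × ℕ) × ℕ) y =>
      y = t w e.1.1 ∧ e.1.2 = e.2 + y) ((Def.eq_fun ht.w.w.w IsVar.last).and
        (Def.eq_fun (add_var IsVar.last.w IsVar.last) IsVar.last.w.w))))) fun w a ha => ?_
  have := (IsVar.last (E := E)).lt_length ha
  constructor
  · rintro ⟨_, _, rfl, _, _, rfl, h⟩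
    exact h
  · intro h
    beta_reduce at h
    exact ⟨_, by omega, rfl, _, by omega, rfl, h⟩

/-- A product is the number of pairs in a rectangle; this is why formulas count pairs and not just
single numbers. -/
theorem mul {x y : E → ℕ} (hx : IsVar x) (hy : IsVar y) : DefFun fun _ e => x e * y e := by
  classical
  refine Def.congr (cntPairs (P := fun _ e i j => i < x e ∧ j < y e)
    ((Def.lt IsVar.last.w hx.w.w.w).and (Def.lt IsVar.last hy.w.w.w))) fun w a ha => ?_
  have h1 := hx.lt_length fun i hi => ha i (Nat.lt_succ_of_lt hi)
  have h2 := hy.lt_length fun i hi => ha i (Nat.lt_succ_of_lt hi)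
  change _ = ParKernel.cntPairs (fun i j => i < x (Ctx.of a) ∧ j < y (Ctx.of a)) _ ↔
    _ = x (Ctx.of a) * y (Ctx.of a)
  rw [cntPairs_eq_card, show (Finset.range w.length ×ˢ Finset.range w.length).filter
    (fun p : ℕ × ℕ => p.1 < x (Ctx.of a) ∧ p.2 < y (Ctx.of a)) =
      Finset.range (x (Ctx.of a)) ×ˢ Finset.range (y (Ctx.of a)) by
      ext p
      simp only [Finset.mem_filter, Finset.mem_product, Finset.mem_range]
      omega, Finset.card_product, Finset.card_range, Finset.card_range]

end DefFun

end

end ParKernel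

namespace ParKernel

/-! ### Definability of the kernel -/

/-- The powers of two, described by multiplication. -/
def IsPow (w : List Bool) (e : ℕ) : Prop :=
  0 < e ∧ ∀ x < w.length, ∀ y < w.length, e = x * y → x = 1 ∨ ∃ z < w.length, x = z + z

/-- The power of two `e` occurs in the binary expansion of `k`. -/
def HasPow (w : List Bool) (k e : ℕ) : Prop :=
  ∃ q < w.length, ∃ r < w.length, r < e ∧ k = q * e + r ∧ ∃ z < w.length, q = z + z + 1

/-- The adjacency matrix of a word that encodes an instance with `N` vertices. -/
def WAdj (w : List Bool) (N u v : ℕ) : Prop :=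
  u < N ∧ v < N ∧ w[N + 1 + (u * N + v)]? = some true

/-- The vertex cover of a word that encodes an instance with `N` vertices. -/
def WCov (w : List Bool) (N u : ℕ) : Prop := u < N ∧ w[N + 1 + (N * N + u)]? = some true

/-- The word encodes an instance with `N` vertices. -/
def Valid (w : List Bool) (N : ℕ) : Prop :=
  (∀ i < N, w[i]? = some true) ∧ (N < w.length ∧ ¬ w[N]? = some true) ∧
    N + (N * N + N) < w.length ∧
    (∀ u < w.length, ∀ v < w.length, WAdj w N u v → WAdj w N v u ∧ ¬ u = v ∧
      (WCov w N u ∨ WCov w N v)) ∧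
    -- `Nat.bits` lists the lowest bit first and has no leading zeros, so the final symbol of a
    -- nonempty expansion is `1`.
    ∀ p < w.length, N + (N * N + N) < p → (∀ q < w.length, q ≤ p) → w[p]? = some true

/-- The number `k` of a word that encodes an instance with `N` vertices, provided that it is less
than the length of the word. -/
def WNum (w : List Bool) (N k : ℕ) : Prop :=
  (∀ e < w.length, IsPow w e →
    (HasPow w k e ↔ w[N + 1 + (N * N + N) + cnt (IsPow w) e]? = some true)) ∧
  -- This excludes words whose number has a digit `1` at a power of two outside the range of the
  -- variables.
  ∀ p < w.length, N + (N * N + N) < p → w[p]? = some true →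
    ∃ e < w.length, IsPow w e ∧ p = N + 1 + (N * N + N) + cnt (IsPow w) e

/-- The instance encoded by the word is not trivial, and `k` is its number. -/
def Small (w : List Bool) (N k : ℕ) : Prop := WNum w N k ∧ k < cnt (WCov w N) N

/-- The vertices of the kernel of the instance encoded by the word. -/
def WKeep (w : List Bool) (N k u : ℕ) : Prop := Kernel.Keep N k (WAdj w N) (WCov w N) u

/-- The edges of the kernel of the instance encoded by the word. -/
def WKerAdj (w : List Bool) (N k u v : ℕ) : Prop := Kernel.Adj N k (WAdj w N) (WCov w N) u v

/-- The positions of the encoding of the kernel. -/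
def Present (w : List Bool) (p : ℕ) : Prop :=
  -- Position `0` is always present: the encoding of the empty instance is the single symbol `0`.
  -- The last clause copies the length of the binary expansion of `k` from the input.
  ∃ N < w.length, Valid w N ∧ (p = 0 ∨ ∃ k < w.length, Small w N k ∧ ∃ m < w.length,
    m = cnt (WKeep w N k) N ∧ (p < m + 1 + (m * m + m) ∨ ∃ j < w.length,
      p = m + 1 + (m * m + m) + j ∧ N + 1 + (N * N + N) + j < w.length))

/-- The bits of the encoding of the kernel with `m` vertices. -/
def KerBit (w : List Bool) (N k m p : ℕ) : Prop :=
  p < m ∨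
  (∃ i < m, ∃ j < m, p = m + 1 + (i * m + j) ∧ ∃ u < N, ∃ v < N, WKeep w N k u ∧ WKeep w N k v ∧
    i = cnt (WKeep w N k) u ∧ j = cnt (WKeep w N k) v ∧ WKerAdj w N k u v) ∨
  (∃ i < m, p = m + 1 + (m * m + i) ∧ ∃ u < N, WKeep w N k u ∧ i = cnt (WKeep w N k) u ∧
    WCov w N u) ∨
  ∃ j < w.length, p = m + 1 + (m * m + m) + j ∧ w[N + 1 + (N * N + N) + j]? = some true

/-- The bits of the encoding of the kernel. -/
def OutBit (w : List Bool) (p : ℕ) : Prop :=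
  ∃ N < w.length, Valid w N ∧ ∃ k < w.length, Small w N k ∧ ∃ m < w.length,
    m = cnt (WKeep w N k) N ∧ KerBit w N k m p

section

variable {E : Type} [Ctx E] {N k u v x y z : E → ℕ}

open Def DefFun

theorem DefFun.double (hz : IsVar z) : DefFun fun _ e => z e + z e := add_var hz hz

/-- These proofs follow the definitions symbol by symbol; each `.w` moves a variable past one
further quantifier. -/
theorem Def.isPow (hx : IsVar x) : Def fun w e => IsPow w (x e) :=
  .and (fun_lt zero hx) <| .all <| .all <|
    .imp (eq_fun (mul IsVar.last.w IsVar.last) hx.w.w) <|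
      .or (eq_fun one IsVar.last.w) <| .ex <| eq_fun (double IsVar.last) IsVar.last.w.w

theorem Def.hasPow (hk : IsVar k) (hx : IsVar x) : Def fun w e => HasPow w (k e) (x e) :=
  .ex <| .ex <| .and (.lt IsVar.last hx.w.w) <|
    .and (eq_fun (add (mul IsVar.last.w hx.w.w) (var IsVar.last)) hk.w.w) <|
      .ex <| eq_fun (add (double IsVar.last) one) IsVar.last.w.w

theorem Def.wAdj (hN : IsVar N) (hu : IsVar u) (hv : IsVar v) :
    Def fun w e => WAdj w (N e) (u e) (v e) :=
  .and (.lt hu hN) <| .and (.lt hv hN) <| .inp <|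
    add (add (var hN) one) (add (mul hu hN) (var hv))

theorem DefFun.matrix (hN : IsVar N) : DefFun fun _ e => N e + (N e * N e + N e) :=
  add (var hN) (add (mul hN hN) (var hN))

theorem DefFun.offset (hN : IsVar N) : DefFun fun _ e => N e + 1 + (N e * N e + N e) :=
  add (add (var hN) one) (add (mul hN hN) (var hN))

theorem Def.wCov (hN : IsVar N) (hu : IsVar u) : Def fun w e => WCov w (N e) (u e) :=
  .and (.lt hu hN) <| .inp <| add (add (var hN) one) (add (mul hN hN) (var hu))

theorem Def.valid (hN : IsVar N) : Def fun w e => Valid w (N e) :=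
  .and (.all_lt hN <| .inp_var IsVar.last) <|
    .and (.and (fun_lt_length (var hN)) (.not <| .inp_var hN)) <|
    .and (fun_lt_length (matrix hN)) <|
    .and (.all <| .all <| .imp (.wAdj hN.w.w IsVar.last.w IsVar.last) <|
      .and (.wAdj hN.w.w IsVar.last IsVar.last.w) <|
      .and (.not <| .eq IsVar.last.w IsVar.last) <|
      .or (.wCov hN.w.w IsVar.last.w) (.wCov hN.w.w IsVar.last)) <|
    .all <| .imp (fun_lt (matrix hN.w) IsVar.last) <|
      .imp (.all <| .le IsVar.last IsVar.last.w) <| .inp_var IsVar.last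

theorem DefFun.logPos (hN : IsVar N) (hx : IsVar x) :
    DefFun fun w e => N e + 1 + (N e * N e + N e) + ParKernel.cnt (IsPow w) (x e) :=
  add (offset hN) (.cnt (P := fun w _ y => IsPow w y) (.isPow IsVar.last) hx)

theorem Def.wNum (hN : IsVar N) (hk : IsVar k) : Def fun w e => WNum w (N e) (k e) :=
  .and (.all <| .imp (.isPow IsVar.last) <| .iff (.hasPow hk.w IsVar.last) <|
    .inp <| logPos hN.w IsVar.last) <|
  .all <| .imp (fun_lt (matrix hN.w) IsVar.last) <| .imp (.inp_var IsVar.last) <|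
    .ex <| .and (.isPow IsVar.last) <| eq_fun (logPos hN.w.w IsVar.last) IsVar.last.w

theorem Def.small (hN : IsVar N) (hk : IsVar k) : Def fun w e => Small w (N e) (k e) :=
  .and (.wNum hN hk) <| lt_fun (.cnt (P := fun w e u => WCov w (N e) u) (.wCov hN.w IsVar.last) hN) hk

theorem Def.wKerAdj (hN : IsVar N) (hk : IsVar k) (hu : IsVar u) (hv : IsVar v) :
    Def fun w e => WKerAdj w (N e) (k e) (u e) (v e) :=
  .or (.wAdj hN hu hv) <| .and (.not <| .eq hu hv) <| .and (.wCov hN hu) <| .and (.wCov hN hv) <|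
    lt_fun (.cnt (.and (.not <| .wCov hN.w IsVar.last) <| .and (.wAdj hN.w IsVar.last hu.w) <|
      .wAdj hN.w IsVar.last hv.w) hN) hk

theorem Def.simplicial (hN : IsVar N) (hk : IsVar k) (hu : IsVar u) :
    Def fun w e => Kernel.Simplicial (N e) (k e) (WAdj w (N e)) (WCov w (N e)) (u e) :=
  .and (.not <| .wCov hN hu) <| .all_lt hN <| .all_lt hN.w <|
    .imp (.wAdj hN.w.w hu.w.w IsVar.last.w) <| .imp (.wAdj hN.w.w hu.w.w IsVar.last) <|
    .imp (.not <| .eq IsVar.last.w IsVar.last) <|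
    .wKerAdj hN.w.w hk.w.w IsVar.last.w IsVar.last

theorem Def.wKeep (hN : IsVar N) (hk : IsVar k) (hu : IsVar u) :
    Def fun w e => WKeep w (N e) (k e) (u e) :=
  .and (.lt hu hN) <| .not <| .and (.simplicial hN hk hu) <| .all_lt hN <|
    .imp (.wAdj hN.w hu.w IsVar.last) <| lt_fun (.cnt (.and (.simplicial hN.w.w hk.w.w IsVar.last)
      (.wAdj hN.w.w IsVar.last IsVar.last.w)) hu.w) hk.w

theorem DefFun.rank (hN : IsVar N) (hk : IsVar k) (hu : IsVar u) :
    DefFun fun w e => ParKernel.cnt (WKeep w (N e) (k e)) (u e) :=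
  .cnt (P := fun w e v => WKeep w (N e) (k e) v) (.wKeep hN.w hk.w IsVar.last) hu

theorem Def.present (hx : IsVar x) : Def fun w e => Present w (x e) :=
  .ex <| .and (.valid IsVar.last) <| .or (eq_fun zero hx.w) <|
  .ex <| .and (.small IsVar.last.w IsVar.last) <|
  .ex <| .and (eq_fun (rank IsVar.last.w.w IsVar.last.w IsVar.last.w.w) IsVar.last) <|
    .or (lt_fun (offset IsVar.last) hx.w.w.w) <|
    .ex <| .and (eq_fun (add (offset IsVar.last.w) (var IsVar.last)) hx.w.w.w.w) <|
      fun_lt_length (add (offset IsVar.last.w.w.w) (var IsVar.last))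

theorem Def.kerBit (hN : IsVar N) (hk : IsVar k) (hy : IsVar y) (hx : IsVar x) :
    Def fun w e => KerBit w (N e) (k e) (y e) (x e) :=
  .or (.lt hx hy) <|
  .or (.ex_lt hy <| .ex_lt hy.w <| .and (eq_fun (add (add (var hy.w.w) one)
      (add (mul IsVar.last.w hy.w.w) (var IsVar.last))) hx.w.w) <|
    .ex_lt hN.w.w <| .ex_lt hN.w.w.w <|
    .and (.wKeep hN.w.w.w.w hk.w.w.w.w IsVar.last.w) <|
    .and (.wKeep hN.w.w.w.w hk.w.w.w.w IsVar.last) <|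
    .and (eq_fun (rank hN.w.w.w.w hk.w.w.w.w IsVar.last.w) IsVar.last.w.w.w) <|
    .and (eq_fun (rank hN.w.w.w.w hk.w.w.w.w IsVar.last) IsVar.last.w.w) <|
    .wKerAdj hN.w.w.w.w hk.w.w.w.w IsVar.last.w IsVar.last) <|
  .or (.ex_lt hy <| .and (eq_fun (add (add (var hy.w) one)
      (add (mul hy.w hy.w) (var IsVar.last))) hx.w) <|
    .ex_lt hN.w <| .and (.wKeep hN.w.w hk.w.w IsVar.last) <|
    .and (eq_fun (rank hN.w.w hk.w.w IsVar.last) IsVar.last.w) <| .wCov hN.w.w IsVar.last) <|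
  .ex <| .and (eq_fun (add (offset hy.w) (var IsVar.last)) hx.w) <|
    .inp <| add (offset hN.w) (var IsVar.last)

theorem Def.outBit (hx : IsVar x) : Def fun w e => OutBit w (x e) :=
  .ex <| .and (.valid IsVar.last) <|
  .ex <| .and (.small IsVar.last.w IsVar.last) <|
  .ex <| .and (eq_fun (rank IsVar.last.w.w IsVar.last.w IsVar.last.w.w) IsVar.last) <|
    .kerBit IsVar.last.w.w IsVar.last.w IsVar.last hx.w.w.w

end

/-! ### From definable relations to circuits -/

theorem takeWhile_range {P : ℕ → Bool} {m n : ℕ} (hm : m ≤ n) (h : ∀ p < n, P p ↔ p < m) :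
    (List.range n).takeWhile P = List.range m := by
  obtain ⟨b, rfl⟩ := Nat.exists_eq_add_of_le hm
  rw [List.range_add, List.takeWhile_append_of_pos]
  · cases b with
    | zero => simp
    | succ b =>
      have : P m = false := by
        have := h m (by omega)
        simpa using this
      simp [List.range_succ_eq_map, this]
  · intro p hp
    rw [List.mem_range] at hp
    exact (h p (by omega)).2 hp

/-- The functions computed by uniform `TC⁰`-circuits that decide definable relations. -/
theorem exists_isUniformTC0 {P Q : List Bool → ℕ → Prop}
    (hP : Def fun w (e : Unit × ℕ) => P w e.2) (hQ : Def fun w (e : Unit × ℕ) => Q w e.2) :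
    ∃ F : ∀ n, Circuit n, IsUniformTC0 F ∧ ∀ w v : List Bool, v.length ≤ w.length →
      (∀ p < w.length, (P w p ↔ p < v.length)) →
      (∀ p < v.length, (Q w p ↔ v[p]? = some true)) → compute F w = v := by
  classical
  obtain ⟨φ, hφ⟩ := hP
  obtain ⟨ψ, hψ⟩ := hQ
  refine ⟨Fml.circuit φ ψ, Fml.isUniformTC0_circuit φ ψ, fun w v hv h1 h2 => ?_⟩
  have e1 : ∀ p < w.length, (φ.eval w (Fml.single p) ↔ p < v.length) := fun p hp => by
    rw [← hφ w (Fml.single p) fun i hi => ?_]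
    · exact h1 p hp
    · have : i < 1 := hi
      obtain rfl : i = 0 := by omega
      exact hp
  have e2 : ∀ p < v.length, (ψ.eval w (Fml.single p) ↔ v[p]? = some true) := fun p hp => by
    rw [← hψ w (Fml.single p) fun i hi => ?_]
    · exact h2 p hp
    · have : i < 1 := hi
      obtain rfl : i = 0 := by omega
      exact hp.trans_le hv
  rw [Fml.compute_circuit, takeWhile_range hv fun p hp => by simpa using e1 p hp]
  refine List.ext_getElem (by simp) fun p _ hp => ?_
  have := e2 p hp
  rw [List.getElem?_eq_getElem hp, Option.some_inj] at this
  simp [this]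

end ParKernel

namespace ParKernel

/-! ### Encodings of instances -/

namespace Instance

/-- The adjacency relation as a relation on numbers. -/
def adj (I : Instance) (u v : ℕ) : Prop := ∃ (hu : u < I.n) (hv : v < I.n), I.G.Adj ⟨u, hu⟩ ⟨v, hv⟩

/-- The vertex cover as a set of numbers. -/
def cov (I : Instance) (u : ℕ) : Prop := ∃ hu : u < I.n, ⟨u, hu⟩ ∈ I.S

theorem isCovered (I : Instance) : Kernel.IsCovered I.n I.adj I.cov where
  symm _ _ := fun ⟨hu, hv, h⟩ => ⟨hv, hu, h.symm⟩
  irrefl _ := fun ⟨_, _, h⟩ => I.G.loopless.irrefl _ h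
  lt _ _ := fun ⟨hu, _⟩ => hu
  cover _ _ := fun ⟨hu, hv, h⟩ => (I.cover h).imp (fun h => ⟨hu, h⟩) fun h => ⟨hv, h⟩
  cover_lt _ := fun ⟨hu, _⟩ => hu

open Classical in
/-- The instance given by relations on numbers. -/
noncomputable def ofRel {n : ℕ} (k : ℕ) {a : ℕ → ℕ → Prop} {s : ℕ → Prop}
    (h : Kernel.IsCovered n a s) : Instance where
  n := n
  G := { Adj := fun u v => a u v, symm := ⟨fun _ _ => h.symm _ _⟩, loopless := ⟨fun _ => h.irrefl _⟩ }
  k := k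
  S := Finset.univ.filter fun u => s u
  cover _ _ huv := (h.cover _ _ huv).imp (by simp) (by simp)

theorem adj_ofRel {n k : ℕ} {a : ℕ → ℕ → Prop} {s : ℕ → Prop} (h : Kernel.IsCovered n a s) :
    (ofRel k h).adj = a := by
  ext u v
  exact ⟨fun ⟨_, _, h⟩ => h, fun huv => ⟨h.lt _ _ huv, h.lt _ _ (h.symm _ _ huv), huv⟩⟩

open Classical in
theorem cov_ofRel {n k : ℕ} {a : ℕ → ℕ → Prop} {s : ℕ → Prop} (h : Kernel.IsCovered n a s) :
    (ofRel k h).cov = s := by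
  ext u
  exact ⟨fun ⟨_, h⟩ => (Finset.mem_filter.1 h).2, fun hu => 
    ⟨h.cover_lt _ hu, Finset.mem_filter.2 ⟨Finset.mem_univ _, hu⟩⟩⟩

theorem card_eq_cnt (I : Instance) : I.S.card = cnt I.cov I.n := by
  classical
  rw [cnt_eq_card, ← Finset.card_map Fin.valEmbedding]
  congr 1
  ext u
  simp only [Finset.mem_map, Fin.valEmbedding_apply, Finset.mem_filter, Finset.mem_range]
  exact ⟨fun ⟨v, hv, e⟩ => e ▸ ⟨v.2, v.2, hv⟩, fun ⟨_, hu, h⟩ => ⟨⟨u, hu⟩, h, rfl⟩⟩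

theorem treeDepth_le_iff (I : Instance) {k : ℕ} :
    treeDepth I.G ≤ k ↔ HasElim I.adj (Finset.range I.n) k := by
  rw [ParKernel.treeDepth_le_iff]
  constructor
  · intro h
    -- The map from numbers to vertices needs a default vertex, which the empty graph lacks.
    by_cases h0 : I.n = 0
    · rw [h0]
      exact ⟨fun _ _ => True, by simp, by simp, by simp, by simp, by simp, by simp⟩
    · have hv : ∀ u ∈ Finset.range I.n, (if h : u < I.n then (⟨u, h⟩ : Fin I.n) else
          ⟨0, Nat.pos_of_ne_zero h0⟩).val = u := fun u hu => by
        rw [dif_pos (Finset.mem_range.1 hu)]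
      refine h.of_injOn (fun u => if h : u < I.n then ⟨u, h⟩ else ⟨0, Nat.pos_of_ne_zero h0⟩)
        (fun _ _ => Finset.mem_univ _) (fun u hu v hv' e => ?_) fun u hu v hv' ⟨h1, h2, h3⟩ => ?_
      · rw [← hv u hu, ← hv v hv', e]
      · rw [dif_pos h1, dif_pos h2]
        exact h3
  · exact fun h => h.of_injOn (fun u : Fin I.n => (u : ℕ)) (fun u _ => Finset.mem_range.2 u.2)
      (fun u _ v _ => Fin.ext) fun u _ v _ h => ⟨u.2, v.2, h⟩

end Instance

theorem testBit_iff_bits (k j : ℕ) : k.bits[j]? = some true ↔ k.testBit j = true := by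
  rw [Nat.testBit_eq_inth, List.getI_eq_getElem?_getD]
  cases k.bits[j]? <;> simp

section

variable (I : Instance)

theorem length_encode :
    (encode I).length = I.n + 1 + (I.n * I.n + I.n) + I.k.size := by
  simp [encode, Nat.size_eq_bits_len]
  omega

theorem encode_unary {p : ℕ} (hp : p < I.n) : (encode I)[p]? = some true := by
  rw [encode, List.getElem?_append_left (by simpa using hp)]
  simp [hp]

theorem encode_separator : (encode I)[I.n]? = some false := by
  rw [encode, List.getElem?_append_right (by simp)]
  simp

open Classical in
theorem encode_add (p : ℕ) : (encode I)[I.n + 1 + p]? =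
    (List.ofFn (fun p : Fin (I.n * I.n) => decide (I.G.Adj p.divNat p.modNat)) ++ (List.ofFn (fun v : Fin I.n => decide (v ∈ I.S)) ++ I.k.bits))[p]? := by
  rw [encode, List.getElem?_append_right (by simp; omega)]
  simp only [List.length_replicate, show I.n + 1 + p - I.n = p + 1 by omega,
    List.getElem?_cons_succ]

open Classical in
theorem encode_adj {u v : ℕ} (hu : u < I.n) (hv : v < I.n) :
    (encode I)[I.n + 1 + (u * I.n + v)]? = some true ↔ I.adj u v := by
  have h : u * I.n + v < I.n * I.n := by nlinarith
  rw [encode_add, List.getElem?_append_left (by simpa using h), List.getElem?_ofFn, dif_pos h]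
  have h1 : (⟨u * I.n + v, h⟩ : Fin (I.n * I.n)).divNat = ⟨u, hu⟩ := by
    rw [Fin.divNat, Fin.mk.injEq]
    change (u * I.n + v) / I.n = u
    rw [mul_comm, Nat.mul_add_div (by omega), Nat.div_eq_of_lt hv, add_zero]
  have h2 : (⟨u * I.n + v, h⟩ : Fin (I.n * I.n)).modNat = ⟨v, hv⟩ := by
    rw [Fin.modNat, Fin.mk.injEq]
    change (u * I.n + v) % I.n = v
    rw [mul_comm, Nat.mul_add_mod, Nat.mod_eq_of_lt hv]
  rw [h1, h2, Option.some_inj, decide_eq_true_eq]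
  exact ⟨fun h => ⟨hu, hv, h⟩, fun ⟨_, _, h⟩ => h⟩

theorem encode_cov {u : ℕ} (hu : u < I.n) :
    (encode I)[I.n + 1 + (I.n * I.n + u)]? = some true ↔ I.cov u := by
  rw [encode_add, List.getElem?_append_right (by simp), List.getElem?_append_left (by simpa using hu),
    List.getElem?_ofFn, dif_pos (by simpa using hu)]
  simp only [List.length_ofFn, Nat.add_sub_cancel_left, Option.some_inj, decide_eq_true_eq]
  exact ⟨fun h => ⟨hu, h⟩, fun ⟨_, h⟩ => h⟩

theorem encode_num (j : ℕ) : (encode I)[I.n + 1 + (I.n * I.n + I.n) + j]? = some true ↔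
    I.k.testBit j = true := by
  rw [add_assoc, encode_add, List.getElem?_append_right (by simp; omega),
    List.getElem?_append_right (by simp; omega), ← testBit_iff_bits]
  simp [show I.n * I.n + I.n + j - I.n * I.n - I.n = j by omega]

theorem position_cases (N p : ℕ) : p < N ∨ p = N ∨
    (∃ u < N, ∃ v < N, p = N + 1 + (u * N + v)) ∨ (∃ u < N, p = N + 1 + (N * N + u)) ∨
      ∃ j, p = N + 1 + (N * N + N) + j := by
  rcases lt_trichotomy p N with h | h | h
  · exact Or.inl h
  · exact Or.inr (Or.inl h)
  obtain ⟨q, rfl⟩ := Nat.exists_eq_add_of_lt h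
  by_cases h1 : q < N * N
  · have hN : 0 < N := Nat.pos_of_ne_zero fun h => by simp [h] at h1
    refine Or.inr (Or.inr (Or.inl ⟨q / N, Nat.div_lt_of_lt_mul h1, q % N, Nat.mod_lt _ hN, ?_⟩))
    have := Nat.div_add_mod' q N
    omega
  · obtain ⟨r, rfl⟩ := Nat.exists_eq_add_of_le (not_lt.1 h1)
    by_cases h2 : r < N
    · exact Or.inr (Or.inr (Or.inr (Or.inl ⟨r, h2, by omega⟩)))
    · exact Or.inr (Or.inr (Or.inr (Or.inr ⟨r - N, by omega⟩)))

theorem encode_eq_true_iff (p : ℕ) : (encode I)[p]? = some true ↔ p < I.n ∨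
    (∃ u < I.n, ∃ v < I.n, p = I.n + 1 + (u * I.n + v) ∧ I.adj u v) ∨
    (∃ u < I.n, p = I.n + 1 + (I.n * I.n + u) ∧ I.cov u) ∨
    ∃ j, p = I.n + 1 + (I.n * I.n + I.n) + j ∧ I.k.testBit j = true := by
  constructor
  · intro h
    rcases position_cases I.n p with h' | rfl | ⟨u, hu, v, hv, rfl⟩ | ⟨u, hu, rfl⟩ | ⟨j, rfl⟩
    · exact Or.inl h'
    · rw [encode_separator] at h
      simp at h
    · exact Or.inr (Or.inl ⟨u, hu, v, hv, rfl, (encode_adj I hu hv).1 h⟩)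
    · exact Or.inr (Or.inr (Or.inl ⟨u, hu, rfl, (encode_cov I hu).1 h⟩))
    · exact Or.inr (Or.inr (Or.inr ⟨j, rfl, (encode_num I j).1 h⟩))
  · rintro (h | ⟨u, hu, v, hv, rfl, h⟩ | ⟨u, hu, rfl, h⟩ | ⟨j, rfl, h⟩)
    · exact encode_unary I h
    · exact (encode_adj I hu hv).2 h
    · exact (encode_cov I hu).2 h
    · exact (encode_num I j).2 h

theorem wAdj_encode : WAdj (encode I) I.n = I.adj := by
  ext u v
  exact ⟨fun ⟨hu, hv, h⟩ => (encode_adj I hu hv).1 h,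
    fun h => ⟨h.1, h.2.1, (encode_adj I h.1 h.2.1).2 h⟩⟩

theorem wCov_encode : WCov (encode I) I.n = I.cov := by
  ext u
  exact ⟨fun ⟨hu, h⟩ => (encode_cov I hu).1 h, fun h => ⟨h.1, (encode_cov I h.1).2 h⟩⟩

/-- The first `0` of an encoding is at position `I.n`, which fixes `N`. -/
theorem valid_encode_iff (N : ℕ) : Valid (encode I) N ↔ N = I.n := by
  constructor
  · rintro ⟨h1, ⟨_, h2⟩, _⟩
    by_contra hne
    rcases lt_or_gt_of_ne hne with h | h
    · exact h2 (encode_unary I h)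
    · have := h1 _ h
      rw [encode_separator] at this
      simp at this
  · rintro rfl
    have hl := length_encode I
    refine ⟨fun i hi => encode_unary I hi, ⟨by omega, by rw [encode_separator]; simp⟩, by omega,
      fun u _ v _ h => ?_, fun p hp h1 h2 => ?_⟩
    · rw [wAdj_encode] at h ⊢
      rw [wCov_encode]
      exact ⟨I.isCovered.symm _ _ h, fun e => I.isCovered.irrefl v (e ▸ h), I.isCovered.cover _ _ h⟩
    · have := h2 ((encode I).length - 1) (by omega)
      obtain ⟨j, rfl⟩ := Nat.exists_eq_add_of_le (show I.n + 1 + (I.n * I.n + I.n) ≤ p by omega)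
      have e : I.k.size = j + 1 := by omega
      have h3 : 2 ^ j ≤ I.k := Nat.lt_size.1 (by omega)
      have h4 : I.k < 2 ^ (j + 1) := Nat.size_le.1 e.le
      rw [encode_num, Nat.testBit_eq_decide_div_mod_eq, decide_eq_true_eq]
      have : I.k / 2 ^ j = 1 := Nat.div_eq_of_lt_le (by omega) (by rw [pow_succ] at h4; omega)
      rw [this]

end

theorem exists_bits_eq (T : List Bool) (h : ∀ hT : T ≠ [], T.getLast hT = true) :
    ∃ k : ℕ, k.bits = T := by
  let f : Bool → ℕ := fun b => cond b 1 0
  refine ⟨Nat.ofDigits 2 (T.map f), ?_⟩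
  have hf : Function.Injective f := by
    intro a b; cases a <;> cases b <;> simp [f]
  apply List.map_injective_iff.2 hf
  rw [← Nat.digits_two_eq_bits, Nat.digits_ofDigits 2 (by norm_num)]
  · intro l hl
    obtain ⟨b, -, rfl⟩ := List.mem_map.1 hl
    cases b <;> simp [f]
  · intro hT
    rw [List.getLast_map, h (by simpa using hT)]
    simp [f]

theorem ext_true {l l' : List Bool} (hl : l.length = l'.length)
    (h : ∀ p < l.length, l[p]? = some true ↔ l'[p]? = some true) : l = l' := by
  refine List.ext_getElem hl fun p h1 h2 => ?_
  have := h p h1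
  rw [List.getElem?_eq_getElem h1, List.getElem?_eq_getElem h2, Option.some_inj,
    Option.some_inj] at this
  exact Bool.eq_iff_iff.2 this

/-- Graph, cover and number are read off from the word. The encoding of the resulting instance has
the length of the word and agrees with it at every position. -/
theorem Valid.exists_encode {w : List Bool} {N : ℕ} (h : Valid w N) : ∃ I, encode I = w := by
  obtain ⟨h1, ⟨h2, h2'⟩, h3, h4, h5⟩ := h
  have hc : Kernel.IsCovered N (WAdj w N) (WCov w N) :=
    ⟨fun u v h => (h4 u (h.1.trans h2) v (h.2.1.trans h2) h).1,
      fun u h => (h4 u (h.1.trans h2) u (h.2.1.trans h2) h).2.1 rfl, fun u v h => h.1,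
      fun u v h => (h4 u (h.1.trans h2) v (h.2.1.trans h2) h).2.2, fun u h => h.1⟩
  obtain ⟨k, hk⟩ := exists_bits_eq (w.drop (N + 1 + (N * N + N))) fun hT => by
    have hlt : N + 1 + (N * N + N) < w.length := by simpa using hT
    have := h5 (w.length - 1) (by omega) (by omega) fun q hq => by omega
    rw [List.getLast_drop, List.getLast_eq_getElem]
    rwa [List.getElem?_eq_getElem (by omega), Option.some_inj] at this
  have hl := congrArg List.length hk
  rw [Nat.size_eq_bits_len, List.length_drop] at hl
  set I := Instance.ofRel k hc with hI
  have hn : I.n = N := rfl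
  have hIk : I.k = k := rfl
  have hle := length_encode I
  rw [hn, hIk] at hle
  refine ⟨I, ext_true (by omega) fun p _ => ?_⟩
  rcases position_cases N p with h' | rfl | ⟨u, hu, v, hv, rfl⟩ | ⟨u, hu, rfl⟩ | ⟨j, rfl⟩
  · rw [h1 p h', encode_unary I h']
  · rw [← hn, encode_separator I, hn]
    simpa using h2'
  · rw [← hn, encode_adj I hu hv, hI, Instance.adj_ofRel]
    exact ⟨fun h => h.2.2, fun h => ⟨hu, hv, h⟩⟩
  · rw [← hn, encode_cov I hu, hI, Instance.cov_ofRel]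
    exact ⟨fun h => h.2, fun h => ⟨hu, h⟩⟩
  · rw [← hn, encode_num, hIk, ← testBit_iff_bits, hk, List.getElem?_drop, hn]

end ParKernel

namespace ParKernel

/-! ### The number of an instance -/

/-- A positive number that is not a power of two has an odd prime factor `p`, and `e = p * q`
violates the condition; all factors are at most `e` and so are in range. Conversely, a divisor of a
power of two is `1` or even. -/
theorem isPow_iff {w : List Bool} {e : ℕ} (he : e < w.length) : IsPow w e ↔ ∃ j, e = 2 ^ j := by
  constructor
  · rintro ⟨h0, h⟩
    rcases Nat.eq_two_pow_or_exists_odd_prime_and_dvd e with h1 | ⟨p, hp, ⟨q, hq⟩, ho⟩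
    · exact h1
    · have hpe : p ≤ e := Nat.le_of_dvd h0 ⟨q, hq⟩
      have hqe : q ≤ e := Nat.le_of_dvd h0 ⟨p, by rw [hq, mul_comm]⟩
      rcases h p (by omega) q (by omega) hq with h2 | ⟨z, -, h2⟩
      · exact absurd h2 hp.ne_one
      · obtain ⟨y, hy⟩ := ho
        omega
  · rintro ⟨j, rfl⟩
    refine ⟨by positivity, fun x hx y _ h => ?_⟩
    obtain ⟨i, -, rfl⟩ := (Nat.dvd_prime_pow Nat.prime_two).1 ⟨y, h⟩
    cases i with
    | zero => exact Or.inl rfl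
    | succ i => exact Or.inr ⟨2 ^ i, by rw [pow_succ] at hx; omega, by rw [pow_succ]; omega⟩

/-- The powers below `2 ^ j` are those with exponents `0, …, j - 1`. Counting them yields the
logarithm, and with it the position of a binary digit. -/
theorem cnt_isPow {w : List Bool} {j : ℕ} (hj : 2 ^ j < w.length) : cnt (IsPow w) (2 ^ j) = j := by
  classical
  rw [cnt_eq_card, show (Finset.range (2 ^ j)).filter (IsPow w) =
    (Finset.range j).image (2 ^ ·) from ?_, Finset.card_image_of_injective _
      (Nat.pow_right_injective le_rfl), Finset.card_range]
  ext e
  simp only [Finset.mem_filter, Finset.mem_range, Finset.mem_image]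
  constructor
  · rintro ⟨h1, h2⟩
    obtain ⟨i, rfl⟩ := (isPow_iff (h1.trans hj)).1 h2
    exact ⟨i, (Nat.pow_lt_pow_iff_right (by norm_num)).1 h1, rfl⟩
  · rintro ⟨i, hi, rfl⟩
    have := Nat.pow_lt_pow_right (show 1 < 2 by norm_num) hi
    exact ⟨this, (isPow_iff (this.trans hj)).2 ⟨i, rfl⟩⟩

theorem hasPow_iff {w : List Bool} {k j : ℕ} (hk : k < w.length) (hj : 2 ^ j < w.length) :
    HasPow w k (2 ^ j) ↔ k.testBit j = true := by
  have hpos : 0 < 2 ^ j := by positivity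
  rw [Nat.testBit_eq_decide_div_mod_eq, decide_eq_true_eq]
  constructor
  · rintro ⟨q, _, r, _, hr, rfl, z, _, rfl⟩
    rw [mul_comm, Nat.mul_add_div hpos, Nat.div_eq_of_lt hr]
    omega
  · intro h
    have h1 : k / 2 ^ j ≤ k := Nat.div_le_self _ _
    have h2 : k % 2 ^ j < 2 ^ j := Nat.mod_lt _ hpos
    exact ⟨k / 2 ^ j, by omega, k % 2 ^ j, by omega, h2, (Nat.div_add_mod' _ _).symm,
      k / 2 ^ j / 2, by omega, by omega⟩

/-- Digits at powers of two below the length of the word are compared directly. The higher ones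
vanish in `k` because `k` is short, and in `I.k` by the second clause of `WNum`. -/
theorem wNum_encode_iff (I : Instance) {k : ℕ} (hk : k < (encode I).length) :
    WNum (encode I) I.n k ↔ k = I.k := by
  set w := encode I with hw
  constructor
  · rintro ⟨h1, h2⟩
    refine Nat.eq_of_testBit_eq fun j => Bool.eq_iff_iff.2 ?_
    by_cases hj : 2 ^ j < w.length
    · rw [← hasPow_iff hk hj, h1 _ hj ((isPow_iff hj).2 ⟨j, rfl⟩), cnt_isPow hj, hw, encode_num]
    · constructor
      · intro h
        have := Nat.ge_two_pow_of_testBit h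
        omega
      · intro h
        have h' := (encode_num I j).2 h
        obtain ⟨e, he, hp, h3⟩ := h2 _ (List.getElem?_eq_some_iff.1 h').1 (by omega) h'
        obtain ⟨i, rfl⟩ := (isPow_iff he).1 hp
        rw [cnt_isPow he] at h3
        obtain rfl : j = i := by omega
        exact absurd he hj
  · rintro rfl
    constructor
    · intro e he hp
      obtain ⟨j, rfl⟩ := (isPow_iff he).1 hp
      rw [hasPow_iff hk he, cnt_isPow he, hw, encode_num]
    · intro p _ h h'
      obtain ⟨j, rfl⟩ := Nat.exists_eq_add_of_le (show I.n + 1 + (I.n * I.n + I.n) ≤ p by omega)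
      rw [hw, encode_num] at h'
      have hj : 2 ^ j < w.length := (Nat.ge_two_pow_of_testBit h').trans_lt hk
      exact ⟨2 ^ j, hj, (isPow_iff hj).2 ⟨j, rfl⟩, by rw [cnt_isPow hj]⟩

theorem small_encode_iff (I : Instance) {k : ℕ} (hk : k < (encode I).length) :
    Small (encode I) I.n k ↔ k = I.k ∧ I.k < I.S.card := by
  rw [Small, wNum_encode_iff I hk, wCov_encode, I.card_eq_cnt]
  exact ⟨fun ⟨h1, h2⟩ => ⟨h1, h1 ▸ h2⟩, fun ⟨h1, h2⟩ => ⟨h1, h1 ▸ h2⟩⟩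

/-! ### The kernel of an instance -/

theorem exists_cnt_eq {P : ℕ → Prop} {n i : ℕ} (h : i < cnt P n) : ∃ u < n, P u ∧ cnt P u = i := by
  classical
  induction n with
  | zero => simp [cnt_eq_count] at h
  | succ n ih =>
    by_cases hi : i < cnt P n
    · obtain ⟨u, hu, h⟩ := ih hi
      exact ⟨u, by omega, h⟩
    · rw [cnt_eq_count] at h hi
      rw [Nat.count_succ] at h
      split_ifs at h with hP
      · exact ⟨n, by omega, hP, by rw [cnt_eq_count]; omega⟩
      · omega

theorem cnt_lt_cnt {P : ℕ → Prop} {u n : ℕ} (hu : u < n) (h : P u) : cnt P u < cnt P n := by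
  classical
  rw [cnt_eq_count, cnt_eq_count]
  exact Nat.count_strict_mono h hu

namespace Instance

variable (I : Instance)

/-- The vertices of the kernel. -/
def Keep (u : ℕ) : Prop := Kernel.Keep I.n I.k I.adj I.cov u

/-- The edges of the kernel, with vertices renumbered consecutively. -/
def kerAdj (i j : ℕ) : Prop := ∃ u < I.n, ∃ v < I.n, I.Keep u ∧ I.Keep v ∧ i = cnt I.Keep u ∧
  j = cnt I.Keep v ∧ Kernel.Adj I.n I.k I.adj I.cov u v

/-- The vertex cover of the kernel, with vertices renumbered consecutively. -/
def kerCov (i : ℕ) : Prop := ∃ u < I.n, I.Keep u ∧ i = cnt I.Keep u ∧ I.cov u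

theorem isCovered_ker : Kernel.IsCovered (cnt I.Keep I.n) I.kerAdj I.kerCov where
  symm := fun _ _ ⟨u, hu, v, hv, ku, kv, e1, e2, h⟩ =>
    ⟨v, hv, u, hu, kv, ku, e2, e1, h.symm I.isCovered⟩
  irrefl := fun _ ⟨u, _, v, _, ku, kv, e1, e2, h⟩ => by
    obtain rfl := cnt_injective ku kv (e1.symm.trans e2)
    exact (Kernel.Adj.isCovered I.isCovered).irrefl u h
  lt := fun _ _ ⟨u, hu, _, _, ku, _, e1, _⟩ => e1 ▸ cnt_lt_cnt hu ku
  cover := fun _ _ ⟨u, hu, v, hv, ku, kv, e1, e2, h⟩ =>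
    ((Kernel.Adj.isCovered I.isCovered).cover u v h).imp (fun h => ⟨u, hu, ku, e1, h⟩)
      fun h => ⟨v, hv, kv, e2, h⟩
  cover_lt := fun _ ⟨_, hu, ku, e, _⟩ => e ▸ cnt_lt_cnt hu ku

/-- The kernel. -/
noncomputable def kernel : Instance := ofRel I.k I.isCovered_ker

/-- Numbering the kept vertices consecutively is an isomorphism from the augmented graph on them to
the kernel, so elimination orders transfer in both directions. -/
theorem treeDepth_kernel_le_iff : treeDepth I.kernel.G ≤ I.kernel.k ↔ treeDepth I.G ≤ I.k := by
  classical
  rw [treeDepth_le_iff, treeDepth_le_iff, kernel, adj_ofRel]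
  change HasElim I.kerAdj (Finset.range (cnt I.Keep I.n)) I.k ↔ _
  have hW : ∀ u, u ∈ (Finset.range I.n).filter (Kernel.Keep I.n I.k I.adj I.cov) ↔
      u < I.n ∧ I.Keep u := fun u => by
    rw [Finset.mem_filter, Finset.mem_range]
    rfl
  constructor
  · intro h
    have : HasElim (Kernel.Adj I.n I.k I.adj I.cov)
        ((Finset.range I.n).filter (Kernel.Keep I.n I.k I.adj I.cov)) I.k := by
      refine h.of_injOn (cnt I.Keep) (fun u hu => ?_) (fun u hu v hv => ?_) fun u hu v hv h => ?_
      · rw [hW] at hu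
        exact Finset.mem_range.2 (cnt_lt_cnt hu.1 hu.2)
      · rw [hW] at hu hv
        exact cnt_injective hu.2 hv.2
      · rw [hW] at hu hv
        exact ⟨u, hu.1, v, hv.1, hu.2, hv.2, rfl, rfl, h⟩
    refine Kernel.HasElim.of_kernel I.isCovered ?_
    convert this
  · intro h
    have h' := Kernel.HasElim.kernel I.isCovered h
    have : ∀ i, ∃ u, i < cnt I.Keep I.n → u < I.n ∧ I.Keep u ∧ cnt I.Keep u = i := fun i => by
      by_cases hi : i < cnt I.Keep I.n
      · obtain ⟨u, hu⟩ := exists_cnt_eq hi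
        exact ⟨u, fun _ => hu⟩
      · exact ⟨0, fun h => absurd h hi⟩
    choose f hf using this
    refine HasElim.of_injOn f (fun i hi => ?_) (fun i hi j hj e => ?_) (fun i hi j hj h => ?_) h'
    · have := hf i (Finset.mem_range.1 hi)
      exact Finset.mem_filter.2 ⟨Finset.mem_range.2 this.1, this.2.1⟩
    · rw [← (hf i (Finset.mem_range.1 hi)).2.2, e, (hf j (Finset.mem_range.1 hj)).2.2]
    · obtain ⟨u, hu, v, hv, ku, kv, e1, e2, h⟩ := h
      obtain ⟨hi1, hi2, hi3⟩ := hf i (Finset.mem_range.1 hi)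
      obtain ⟨hj1, hj2, hj3⟩ := hf j (Finset.mem_range.1 hj)
      rw [cnt_injective hi2 ku (hi3.trans e1), cnt_injective hj2 kv (hj3.trans e2)]
      exact h

theorem treeDepth_le_of_card_le (h : I.S.card ≤ I.k) : treeDepth I.G ≤ I.k :=
  I.treeDepth_le_iff.2 (Kernel.hasElim_of_cover_le I.isCovered (I.card_eq_cnt ▸ h))

theorem kernel_n_le (h : I.k < I.S.card) : I.kernel.n ≤ 3 * I.S.card ^ 3 := by
  rw [I.card_eq_cnt] at h ⊢
  exact Kernel.count_keep_le I.isCovered h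

/-- The empty graph. -/
def empty : Instance := ⟨0, ⊥, 0, ∅, fun v => v.elim0⟩

theorem treeDepth_empty_le : treeDepth empty.G ≤ empty.k :=
  empty.treeDepth_le_of_card_le le_rfl

open Classical in
/-- The output of the kernelization. -/
noncomputable def reduce : Instance := if I.k < I.S.card then I.kernel else empty

variable {I}

theorem reduce_of_lt (h : I.k < I.S.card) : I.reduce = I.kernel := if_pos h

theorem reduce_of_le (h : ¬ I.k < I.S.card) : I.reduce = empty := if_neg h

variable (I)

theorem treeDepth_reduce_le_iff : treeDepth I.reduce.G ≤ I.reduce.k ↔ treeDepth I.G ≤ I.k := by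
  by_cases h : I.k < I.S.card
  · rw [reduce_of_lt h]
    exact I.treeDepth_kernel_le_iff
  · rw [reduce_of_le h]
    exact iff_of_true treeDepth_empty_le (I.treeDepth_le_of_card_le (not_lt.1 h))

theorem reduce_n_le : I.reduce.n ≤ 3 * I.S.card ^ 3 := by
  by_cases h : I.k < I.S.card
  · rw [reduce_of_lt h]
    exact I.kernel_n_le h
  · rw [reduce_of_le h]
    exact Nat.zero_le _

theorem reduce_k_le : I.reduce.k ≤ I.S.card := by
  by_cases h : I.k < I.S.card
  · rw [reduce_of_lt h]
    exact h.le
  · rw [reduce_of_le h]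
    exact Nat.zero_le _

theorem card_le : I.S.card ≤ I.n := by simpa using Finset.card_le_univ I.S

theorem kernel_n_le_n : I.kernel.n ≤ I.n := by
  classical
  change cnt I.Keep I.n ≤ I.n
  rw [cnt_eq_count]
  exact Nat.count_le _

end Instance

theorem size_le_self (k : ℕ) : k.size ≤ k := Nat.size_le.2 Nat.lt_two_pow_self

theorem wKeep_encode (I : Instance) : WKeep (encode I) I.n I.k = I.Keep := by
  funext u
  rw [WKeep, wAdj_encode, wCov_encode]
  rfl

theorem wKerAdj_encode (I : Instance) :
    WKerAdj (encode I) I.n I.k = Kernel.Adj I.n I.k I.adj I.cov := by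
  funext u v
  rw [WKerAdj, wAdj_encode, wCov_encode]

theorem length_encode_empty : (encode Instance.empty).length = 1 := by
  rw [length_encode]
  rfl

theorem length_encode_kernel (I : Instance) : (encode I.kernel).length =
    I.kernel.n + 1 + (I.kernel.n * I.kernel.n + I.kernel.n) + I.k.size := length_encode _

theorem length_encode_reduce_le (I : Instance) : (encode I.reduce).length ≤ (encode I).length := by
  have h1 := length_encode I
  by_cases h : I.k < I.S.card
  · have h2 := length_encode_kernel I
    have h3 := I.kernel_n_le_n
    have h4 := Nat.mul_le_mul h3 h3
    rw [Instance.reduce_of_lt h]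
    omega
  · rw [Instance.reduce_of_le h, length_encode_empty]
    omega

theorem present_encode_iff (I : Instance) {p : ℕ} (hp : p < (encode I).length) :
    Present (encode I) p ↔ p < (encode I.reduce).length := by
  have hl := length_encode I
  constructor
  · rintro ⟨N, _, hN, h⟩
    obtain rfl := (valid_encode_iff I N).1 hN
    rcases h with rfl | ⟨k, hk, hs, m, _, hm, h⟩
    · rw [length_encode]
      omega
    · obtain ⟨rfl, hlt⟩ := (small_encode_iff I hk).1 hs
      rw [wKeep_encode] at hm
      replace hm : m = I.kernel.n := hm
      subst hm
      rw [Instance.reduce_of_lt hlt, length_encode_kernel]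
      rcases h with h | ⟨j, _, h⟩ <;> omega
  · intro h
    refine ⟨I.n, by omega, (valid_encode_iff I _).2 rfl, ?_⟩
    by_cases hs : I.k < I.S.card
    · have h1 := I.card_le
      have h2 := I.kernel_n_le_n
      -- Here `I.k < |S| ≤ I.n`, and this is below the length of the encoding: the number is in the
      -- range of the variables.
      have hk : I.k < (encode I).length := by omega
      rw [Instance.reduce_of_lt hs, length_encode_kernel] at h
      refine Or.inr ⟨I.k, hk, (small_encode_iff I hk).2 ⟨rfl, hs⟩, I.kernel.n, by omega, ?_, ?_⟩
      · rw [wKeep_encode]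
        rfl
      · by_cases h3 : p < I.kernel.n + 1 + (I.kernel.n * I.kernel.n + I.kernel.n)
        · exact Or.inl h3
        · obtain ⟨j, rfl⟩ := Nat.exists_eq_add_of_le (not_lt.1 h3)
          exact Or.inr ⟨j, by omega, rfl, by omega⟩
    · rw [Instance.reduce_of_le hs, length_encode_empty] at h
      exact Or.inl (by omega)

theorem kerBit_encode_iff (I : Instance) (p : ℕ) :
    KerBit (encode I) I.n I.k I.kernel.n p ↔ (encode I.kernel)[p]? = some true := by
  rw [encode_eq_true_iff, KerBit, wKeep_encode, wKerAdj_encode, wCov_encode]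
  refine or_congr Iff.rfl (or_congr ?_ (or_congr ?_ ?_))
  · rw [show I.kernel.adj = I.kerAdj from Instance.adj_ofRel _]
    rfl
  · rw [show I.kernel.cov = I.kerCov from Instance.cov_ofRel _]
    rfl
  · constructor
    · rintro ⟨j, _, h1, h2⟩
      exact ⟨j, h1, (encode_num I j).1 h2⟩
    · rintro ⟨j, h1, h2⟩
      have h3 := (encode_num I j).2 h2
      have h4 := (List.getElem?_eq_some_iff.1 h3).1
      exact ⟨j, by omega, h1, h3⟩

theorem outBit_encode_iff (I : Instance) (p : ℕ) :
    OutBit (encode I) p ↔ (encode I.reduce)[p]? = some true := by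
  have hl := length_encode I
  constructor
  · rintro ⟨N, _, hN, k, hk, hs, m, _, hm, h⟩
    obtain rfl := (valid_encode_iff I N).1 hN
    obtain ⟨rfl, hlt⟩ := (small_encode_iff I hk).1 hs
    rw [wKeep_encode] at hm
    replace hm : m = I.kernel.n := hm
    subst hm
    rw [Instance.reduce_of_lt hlt]
    exact (kerBit_encode_iff I p).1 h
  · intro h
    by_cases hs : I.k < I.S.card
    · have h1 := I.card_le
      have h2 := I.kernel_n_le_n
      have hk : I.k < (encode I).length := by omega
      rw [Instance.reduce_of_lt hs] at h
      refine ⟨I.n, by omega, (valid_encode_iff I _).2 rfl, I.k, hk,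
        (small_encode_iff I hk).2 ⟨rfl, hs⟩, I.kernel.n, by omega, ?_, (kerBit_encode_iff I p).2 h⟩
      rw [wKeep_encode]
      rfl
    · rw [Instance.reduce_of_le hs] at h
      have h1 := (List.getElem?_eq_some_iff.1 h).1
      rw [length_encode_empty] at h1
      obtain rfl : p = 0 := by omega
      have := encode_separator Instance.empty
      rw [show Instance.empty.n = 0 from rfl, h] at this
      simp at this

theorem mem_tdLanguage_iff (I : Instance) : encode I ∈ tdLanguage ↔ treeDepth I.G ≤ I.k := by
  constructor
  · rintro ⟨J, h, hJ⟩
    rwa [encode_injective h] at hJ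
  · exact fun h => ⟨I, rfl, h⟩

/-- A bound on the length of the encoding of the kernel. -/
def lengthBound (s : ℕ) : ℕ := 3 * s ^ 3 + 1 + (3 * s ^ 3 * (3 * s ^ 3) + 3 * s ^ 3) + s

theorem computable_lengthBound : Computable lengthBound := by
  have h1 : Primrec fun s : ℕ => 3 * s ^ 3 :=
    Primrec.nat_mul.comp (Primrec.const 3) ((Primrec.nat_mul.comp (Primrec.nat_mul.comp Primrec.id
      Primrec.id) Primrec.id).of_eq fun s => by simp only [id]; ring)
  exact (Primrec.nat_add.comp (Primrec.nat_add.comp (Primrec.nat_add.comp h1 (Primrec.const 1))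
    (Primrec.nat_add.comp (Primrec.nat_mul.comp h1 h1) h1)) Primrec.id).to_comp

theorem length_encode_reduce_le_bound (I : Instance) :
    (encode I.reduce).length ≤ lengthBound I.S.card := by
  have h1 := I.reduce_n_le
  have h2 := Nat.mul_le_mul h1 h1
  have h3 := (size_le_self _).trans I.reduce_k_le
  rw [length_encode, lengthBound]
  omega

end ParKernel

theorem mainTheorem9 :
    ∃ F : ∀ n : ℕ, ParKernel.Circuit n,
      ParKernel.IsUniformTC0 F ∧
      ParKernel.IsKernelization ParKernel.tdLanguage ParKernel.tdParam (ParKernel.compute F) ∧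
      ∃ C : ℕ, ∀ I : ParKernel.Instance, ∃ J : ParKernel.Instance,
        ParKernel.compute F (ParKernel.encode I) = ParKernel.encode J ∧
        J.n ≤ C * I.S.card ^ 3 := by
  obtain ⟨F, hF, h⟩ := ParKernel.exists_isUniformTC0
    (ParKernel.Def.present ParKernel.IsVar.last) (ParKernel.Def.outBit ParKernel.IsVar.last)
  have hI : ∀ I, ParKernel.compute F (ParKernel.encode I) = ParKernel.encode I.reduce := fun I =>
    h _ _ (ParKernel.length_encode_reduce_le I) (fun _ hp => ParKernel.present_encode_iff I hp)
      fun p _ => ParKernel.outBit_encode_iff I p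
  refine ⟨F, hF, ⟨ParKernel.lengthBound, ParKernel.computable_lengthBound, fun x => ?_⟩,
    3, fun I => ⟨I.reduce, hI I, I.reduce_n_le⟩⟩
  by_cases hx : ∃ I, ParKernel.encode I = x
  · obtain ⟨I, rfl⟩ := hx
    rw [hI, ParKernel.mem_tdLanguage_iff, ParKernel.mem_tdLanguage_iff,
      I.treeDepth_reduce_le_iff, ParKernel.tdParam, ParKernel.encode_injective.extend_apply]
    exact ⟨Iff.rfl, ParKernel.length_encode_reduce_le_bound I⟩
  -- Words that encode no instance are mapped to the empty word. It encodes none either, since every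
  -- encoding contains the separator, and its length `0` satisfies any bound.
  · have hnil : ParKernel.compute F x = [] := by
      refine h x [] (Nat.zero_le _) (fun p _ => ?_) fun p hp => absurd hp (Nat.not_lt_zero p)
      exact iff_of_false (fun ⟨_, _, hN, _⟩ => hx hN.exists_encode) (Nat.not_lt_zero p)
    rw [hnil]
    refine ⟨iff_of_false (fun ⟨I, e, _⟩ => hx ⟨I, e⟩) fun ⟨I, e, _⟩ => ?_, Nat.zero_le _⟩
    have := ParKernel.length_encode I
    rw [e, List.length_nil] at this
    omega
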